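/- Let $\mathrm{Cart}$ be the category of Cartesian spaces (smooth manifolds diffeomorphic to some $\mathbb{R}^n$) and smooth maps. A smooth groupoid is a category fibred in groupoids over $\mathrm{Cart}$; smooth groupoids form a strict 2-category $\mathscr{H}$, whose 1-morphisms are the functors strictly over $\mathrm{Cart}$ and whose 2-morphisms are the natural transformations that project to the identity. A smooth 2-group is a group object in $\mathscr{H}$ (a monoid object for which $(\otimes,\mathrm{pr}_1)$ is an equivalence), and it is abelian if it carries a symmetric braiding. For a diffeological abelian group $H$, the delooping $\mathsf{B}\underline{H}$ is the smooth abelian 2-group whose objects are the Cartesian spaces and whose morphisms $c_0\to c_1$ are pairs $(f,h)$ of smooth maps $f\colon c_0\to c_1$ and $h\colon c_0\to H$, with composition $(f',h')\circ(f,h)=(f'\circ f,\,h\,(h'\circ f))$. A smooth 2-group $\mathsf{A}$ is string-admissible if it is abelian and equivalent, as a smooth 2-group, to $\mathsf{B}\underline{H}$ for a diffeological abelian group $H$ whose underlying topological space (with the D-topology) is an Eilenberg--MacLane space $K(\mathbb{Z},1)$. For a smooth manifold $M$ (Hausdorff, second countable, finite-dimensional, without boundary), let $\mathrm{HLBdl}^M$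 be the smooth abelian 2-group whose objects over $c$ are the smooth hermitean line bundles $L$ on $c\times M$, whose morphisms $(c,L)\to(c',L')$ are pairs $(\varphi,\psi)$ of a smooth map $\varphi\colon c\to c'$ and an isomorphism $\psi\colon L\to(\varphi\times 1_M)^*L'$ of hermitean line bundles, and whose product is the tensor product. Let $\mathrm{U}(1)^M$ be the diffeological group of smooth maps $M\to \mathrm{U}(1)$ with the mapping space diffeology. Theorem. Let $M$ be a 2-connected manifold. Then $\mathrm{HLBdl}^M$ is string-admissible. More precisely, the underlying topological space of $\mathrm{U}(1)^M$ is a $K(\mathbb{Z},1)$, and $\mathrm{HLBdl}^M$ is equivalent as a smooth 2-group to $\mathsf{B}\underline{\mathrm{U}(1)^M}$. -/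

import Mathlib

open scoped Manifold ContDiff Topology
open CategoryTheory

universe u v u₁ v₁ u₂ v₂ u₃ v₃ w

noncomputable section

/-! ### Cartesian spaces -/

/-- A Cartesian space: a smooth manifold diffeomorphic to some `ℝⁿ`. -/
structure Cart : Type 1 where
  dim : ℕ
  carrier : Type
  [top : TopologicalSpace carrier]
  [charted : ChartedSpace (EuclideanSpace ℝ (Fin dim)) carrier]
  [manifold : IsManifold (𝓡 dim) ∞ carrier]
  diffeo : Nonempty (carrier ≃ₘ^∞⟮𝓡 dim, 𝓡 dim⟯ EuclideanSpace ℝ (Fin dim))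

attribute [instance] Cart.top Cart.charted Cart.manifold

/-- The category of Cartesian spaces and smooth maps. -/
instance : Category Cart where
  Hom c c' := C^∞⟮𝓡 c.dim, c.carrier; 𝓡 c'.dim, c'.carrier⟯
  id c := ContMDiffMap.id
  comp f g := ContMDiffMap.comp g f

/-- The smooth map underlying a morphism of Cartesian spaces. -/
def Cart.map {c c' : Cart} (f : c ⟶ c') : C^∞⟮𝓡 c.dim, c.carrier; 𝓡 c'.dim, c'.carrier⟯ := f

/-! ### Smooth groupoids -/

/-- A smooth groupoid, i.e. a category fibred in groupoids `π : X → Cart`.  The category over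
`Cart` is given by its objects `Obj c` over each `c` and its morphisms `Hom f x y` over each
`f : c ⟶ c'`; the total category has as objects the pairs `(c, x)` and as morphisms the pairs
`(f, φ)`.  As composition in `Cart` is strictly associative and unital, the axioms of a
category can be stated directly. -/
structure SmoothGroupoid where
  Obj : Cart → Type u
  Hom : {c c' : Cart} → (c ⟶ c') → Obj c → Obj c' → Type v
  id : {c : Cart} → (x : Obj c) → Hom (𝟙 c) x x
  comp : {c₀ c₁ c₂ : Cart} → {f : c₀ ⟶ c₁} → {g : c₁ ⟶ c₂} →
    {x : Obj c₀} → {y : Obj c₁} → {z : Obj c₂} → Hom f x y → Hom g y z → Hom (f ≫ g) x z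
  id_comp : ∀ {c c' : Cart} {f : c ⟶ c'} {x : Obj c} {y : Obj c'} (φ : Hom f x y),
    comp (id x) φ = φ
  comp_id : ∀ {c c' : Cart} {f : c ⟶ c'} {x : Obj c} {y : Obj c'} (φ : Hom f x y),
    comp φ (id y) = φ
  assoc : ∀ {c₀ c₁ c₂ c₃ : Cart} {f : c₀ ⟶ c₁} {g : c₁ ⟶ c₂} {h : c₂ ⟶ c₃}
    {x : Obj c₀} {y : Obj c₁} {z : Obj c₂} {w : Obj c₃}
    (φ : Hom f x y) (ψ : Hom g y z) (χ : Hom h z w),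
    comp (comp φ ψ) χ = comp φ (comp ψ χ)
  /-- Every morphism of `Cart` into the image of an object lifts to a morphism into it. -/
  lift : ∀ {c c' : Cart} (f : c ⟶ c') (y : Obj c'), ∃ x : Obj c, Nonempty (Hom f x y)
  /-- Every morphism is Cartesian. -/
  fill : ∀ {c₀ c₁ c₂ : Cart} (f : c₀ ⟶ c₁) (g : c₁ ⟶ c₂)
    {x : Obj c₀} {y : Obj c₁} {z : Obj c₂} (χ : Hom (f ≫ g) x z) (ψ : Hom g y z),
    ∃! φ : Hom f x y, comp φ ψ = χ

namespace SmoothGroupoid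

variable {A : SmoothGroupoid.{u, v}} {B : SmoothGroupoid.{u₁, v₁}}
  {C : SmoothGroupoid.{u₂, v₂}} {D : SmoothGroupoid.{u₃, v₃}}

/-- Composition in the fibre of a smooth groupoid over `c`. -/
def vcomp (A : SmoothGroupoid.{u, v}) {c : Cart} {x y z : A.Obj c}
    (φ : A.Hom (𝟙 c) x y) (ψ : A.Hom (𝟙 c) y z) : A.Hom (𝟙 c) x z := A.comp φ ψ

/-- A 1-morphism of smooth groupoids: a functor strictly over `Cart`. -/
structure Morphism (A : SmoothGroupoid.{u, v}) (B : SmoothGroupoid.{u₁, v₁}) where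
  obj : {c : Cart} → A.Obj c → B.Obj c
  map : {c c' : Cart} → {f : c ⟶ c'} → {x : A.Obj c} → {y : A.Obj c'} →
    A.Hom f x y → B.Hom f (obj x) (obj y)
  map_id : ∀ {c : Cart} (x : A.Obj c), map (A.id x) = B.id (obj x)
  map_comp : ∀ {c₀ c₁ c₂ : Cart} {f : c₀ ⟶ c₁} {g : c₁ ⟶ c₂}
    {x : A.Obj c₀} {y : A.Obj c₁} {z : A.Obj c₂} (φ : A.Hom f x y) (ψ : A.Hom g y z),
    map (A.comp φ ψ) = B.comp (map φ) (map ψ)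

/-- A 2-morphism of smooth groupoids: a natural transformation that projects to the identity on
`Cart`.  As its components are morphisms of the fibres, every 2-morphism is invertible. -/
structure TwoMorphism (F G : Morphism A B) where
  app : {c : Cart} → (x : A.Obj c) → B.Hom (𝟙 c) (F.obj x) (G.obj x)
  naturality : ∀ {c c' : Cart} {f : c ⟶ c'} {x : A.Obj c} {y : A.Obj c'} (φ : A.Hom f x y),
    (B.comp (F.map φ) (app y) : B.Hom f (F.obj x) (G.obj y)) = B.comp (app x) (G.map φ)

/-- The identity 1-morphism. -/
def Morphism.id (A : SmoothGroupoid.{u, v}) : Morphism A A where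
  obj x := x
  map φ := φ
  map_id _ := rfl
  map_comp _ _ := rfl

/-- Composition of 1-morphisms, in diagrammatic order. -/
def Morphism.comp (F : Morphism A B) (G : Morphism B C) : Morphism A C where
  obj x := G.obj (F.obj x)
  map φ := G.map (F.map φ)
  map_id x := by rw [F.map_id, G.map_id]
  map_comp φ ψ := by rw [F.map_comp, G.map_comp]

/-- A 1-morphism is an equivalence if it has an inverse up to 2-isomorphism. -/
def Morphism.IsEquivalence (F : Morphism A B) : Prop :=
  ∃ G : Morphism B A, Nonempty (TwoMorphism (Morphism.id A) (F.comp G)) ∧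
    Nonempty (TwoMorphism (G.comp F) (Morphism.id B))

/-- The identity 2-morphism. -/
def TwoMorphism.id (F : Morphism A B) : TwoMorphism F F where
  app x := B.id (F.obj x)
  naturality _ := (B.comp_id _).trans (B.id_comp _).symm

/-- Vertical composition of 2-morphisms. -/
def TwoMorphism.comp {F G H : Morphism A B} (α : TwoMorphism F G) (β : TwoMorphism G H) :
    TwoMorphism F H where
  app x := B.vcomp (α.app x) (β.app x)
  naturality {c c' f x y} φ := by
    have h1 := B.assoc (F.map φ) (α.app y) (β.app y)
    have h2 := B.assoc (α.app x) (G.map φ) (β.app y)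
    have h3 := B.assoc (α.app x) (β.app x) (H.map φ)
    have h4 : B.comp (B.comp (F.map φ) (α.app y)) (β.app y)
        = B.comp (B.comp (α.app x) (G.map φ)) (β.app y) :=
      congrArg (fun t : B.Hom f (F.obj x) (G.obj y) => B.comp t (β.app y)) (α.naturality φ)
    have h5 : B.comp (α.app x) (B.comp (G.map φ) (β.app y))
        = B.comp (α.app x) (B.comp (β.app x) (H.map φ)) :=
      congrArg (fun t : B.Hom f (G.obj x) (H.obj y) => B.comp (α.app x) t) (β.naturality φ)
    exact h1.symm.trans (h4.trans (h2.trans (h5.trans h3.symm)))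

/-- Precomposition of a 2-morphism with a 1-morphism. -/
def TwoMorphism.whiskerLeft (F : Morphism A B) {G H : Morphism B C} (α : TwoMorphism G H) :
    TwoMorphism (F.comp G) (F.comp H) where
  app x := α.app (F.obj x)
  naturality φ := α.naturality (F.map φ)

/-- Postcomposition of a 2-morphism with a 1-morphism. -/
def TwoMorphism.whiskerRight {F G : Morphism A B} (α : TwoMorphism F G) (H : Morphism B C) :
    TwoMorphism (F.comp H) (G.comp H) where
  app x := H.map (α.app x)
  naturality {c c' f x y} φ := by
    have h : H.map (B.comp (F.map φ) (α.app y)) = H.map (B.comp (α.app x) (G.map φ)) :=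
      congrArg (fun t : B.Hom f (F.obj x) (G.obj y) => H.map t) (α.naturality φ)
    exact ((H.map_comp _ _).symm.trans h).trans (H.map_comp _ _)

/-- The terminal smooth groupoid `* = Cart`. -/
def terminal : SmoothGroupoid.{0, 0} where
  Obj _ := Unit
  Hom _ _ _ := Unit
  id _ := ()
  comp _ _ := ()
  id_comp _ := rfl
  comp_id _ := rfl
  assoc _ _ _ := rfl
  lift _ _ := ⟨(), ⟨()⟩⟩
  fill _ _ _ _ _ _ _ := ⟨(), rfl, fun _ _ => rfl⟩

/-- The product of smooth groupoids: the pullback of categories over `Cart`. -/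
def prod (A : SmoothGroupoid.{u, v}) (B : SmoothGroupoid.{u₁, v₁}) :
    SmoothGroupoid.{max u u₁, max v v₁} where
  Obj c := A.Obj c × B.Obj c
  Hom f x y := A.Hom f x.1 y.1 × B.Hom f x.2 y.2
  id x := (A.id x.1, B.id x.2)
  comp φ ψ := (A.comp φ.1 ψ.1, B.comp φ.2 ψ.2)
  id_comp φ := Prod.ext (A.id_comp φ.1) (B.id_comp φ.2)
  comp_id φ := Prod.ext (A.comp_id φ.1) (B.comp_id φ.2)
  assoc φ ψ χ := Prod.ext (A.assoc φ.1 ψ.1 χ.1) (B.assoc φ.2 ψ.2 χ.2)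
  lift f y := by
    obtain ⟨x, ⟨φ⟩⟩ := A.lift f y.1
    obtain ⟨x', ⟨φ'⟩⟩ := B.lift f y.2
    exact ⟨(x, x'), ⟨(φ, φ')⟩⟩
  fill f g _ _ _ χ ψ := by
    obtain ⟨φ, h, hu⟩ := A.fill f g χ.1 ψ.1
    obtain ⟨φ', h', hu'⟩ := B.fill f g χ.2 ψ.2
    exact ⟨(φ, φ'), Prod.ext h h', fun t ht =>
      Prod.ext (hu t.1 (congrArg Prod.fst ht)) (hu' t.2 (congrArg Prod.snd ht))⟩

/-- The first projection. -/
def fst (A : SmoothGroupoid.{u, v}) (B : SmoothGroupoid.{u₁, v₁}) : Morphism (A.prod B) A where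
  obj x := x.1
  map φ := φ.1
  map_id _ := rfl
  map_comp _ _ := rfl

/-- The second projection. -/
def snd (A : SmoothGroupoid.{u, v}) (B : SmoothGroupoid.{u₁, v₁}) : Morphism (A.prod B) B where
  obj x := x.2
  map φ := φ.2
  map_id _ := rfl
  map_comp _ _ := rfl

/-- The 1-morphism to the terminal smooth groupoid. -/
def toTerminal (A : SmoothGroupoid.{u, v}) : Morphism A terminal where
  obj _ := ()
  map _ := ()
  map_id _ := rfl
  map_comp _ _ := rfl

/-- The 1-morphism `(F, G)` into a product. -/
def Morphism.pair (F : Morphism A B) (G : Morphism A C) : Morphism A (B.prod C) where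
  obj x := (F.obj x, G.obj x)
  map φ := (F.map φ, G.map φ)
  map_id x := Prod.ext (F.map_id x) (G.map_id x)
  map_comp φ ψ := Prod.ext (F.map_comp φ ψ) (G.map_comp φ ψ)

/-- The product `F × G` of 1-morphisms. -/
def Morphism.prodMap (F : Morphism A B) (G : Morphism C D) :
    Morphism (A.prod C) (B.prod D) :=
  ((fst A C).comp F).pair ((snd A C).comp G)

/-- The interchange of factors. -/
def swap (A : SmoothGroupoid.{u, v}) (B : SmoothGroupoid.{u₁, v₁}) :
    Morphism (A.prod B) (B.prod A) :=
  (snd A B).pair (fst A B)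

/-- The canonical isomorphism `(A × B) × C ≅ A × (B × C)`. -/
def prodAssoc (A : SmoothGroupoid.{u, v}) (B : SmoothGroupoid.{u₁, v₁})
    (C : SmoothGroupoid.{u₂, v₂}) : Morphism ((A.prod B).prod C) (A.prod (B.prod C)) :=
  ((fst (A.prod B) C).comp (fst A B)).pair
    (((fst (A.prod B) C).comp (snd A B)).pair (snd (A.prod B) C))

theorem vcomp_assoc {c : Cart} {x y z w : A.Obj c} (φ : A.Hom (𝟙 c) x y)
    (ψ : A.Hom (𝟙 c) y z) (χ : A.Hom (𝟙 c) z w) :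
    A.vcomp (A.vcomp φ ψ) χ = A.vcomp φ (A.vcomp ψ χ) := A.assoc φ ψ χ

theorem id_vcomp {c : Cart} {x y : A.Obj c} (φ : A.Hom (𝟙 c) x y) :
    A.vcomp (A.id x) φ = φ := A.id_comp φ

theorem vcomp_id {c : Cart} {x y : A.Obj c} (φ : A.Hom (𝟙 c) x y) :
    A.vcomp φ (A.id y) = φ := A.comp_id φ

theorem Morphism.map_vcomp (F : Morphism A B) {c : Cart} {x y z : A.Obj c}
    (φ : A.Hom (𝟙 c) x y) (ψ : A.Hom (𝟙 c) y z) :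
    F.map (A.vcomp φ ψ) = B.vcomp (F.map φ) (F.map ψ) := F.map_comp φ ψ

end SmoothGroupoid

/-! ### Smooth 2-groups -/

open SmoothGroupoid

/-- The data of a monoid object in the 2-category of smooth groupoids. -/
structure SmoothMonoidData where
  X : SmoothGroupoid.{u, v}
  unit : Morphism terminal X
  tensor : Morphism (X.prod X) X
  assoc : TwoMorphism ((tensor.prodMap (Morphism.id X)).comp tensor)
    ((prodAssoc X X X).comp (((Morphism.id X).prodMap tensor).comp tensor))
  leftUnitor : TwoMorphism ((((toTerminal X).comp unit).pair (Morphism.id X)).comp tensor)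
    (Morphism.id X)
  rightUnitor : TwoMorphism (((Morphism.id X).pair ((toTerminal X).comp unit)).comp tensor)
    (Morphism.id X)

namespace SmoothMonoidData

variable (A : SmoothMonoidData.{u, v}) {c : Cart}

/-- The unit object over `c`. -/
def one (c : Cart) : A.X.Obj c := A.unit.obj ()

/-- The product of objects over `c`. -/
def mul (x y : A.X.Obj c) : A.X.Obj c := A.tensor.obj (x, y)

variable {A} in
/-- The product of morphisms in the fibre over `c`. -/
def mulHom {x y x' y' : A.X.Obj c} (φ : A.X.Hom (𝟙 c) x y) (φ' : A.X.Hom (𝟙 c) x' y') :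
    A.X.Hom (𝟙 c) (A.mul x x') (A.mul y y') :=
  A.tensor.map (x := (x, x')) (y := (y, y')) (f := 𝟙 c) (φ, φ')

/-- The components `(x ⊗ y) ⊗ z ⟶ x ⊗ (y ⊗ z)` of the associator. -/
def a (x y z : A.X.Obj c) : A.X.Hom (𝟙 c) (A.mul (A.mul x y) z) (A.mul x (A.mul y z)) :=
  A.assoc.app ((x, y), z)

/-- The components `1 ⊗ x ⟶ x` of the left unitor. -/
def l (x : A.X.Obj c) : A.X.Hom (𝟙 c) (A.mul (A.one c) x) x := A.leftUnitor.app x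

/-- The components `x ⊗ 1 ⟶ x` of the right unitor. -/
def r (x : A.X.Obj c) : A.X.Hom (𝟙 c) (A.mul x (A.one c)) x := A.rightUnitor.app x

end SmoothMonoidData

/-- A monoid object in the 2-category of smooth groupoids. -/
structure SmoothMonoid extends SmoothMonoidData.{u, v} where
  pentagon : ∀ {c : Cart} (w x y z : X.Obj c),
    X.vcomp (X.vcomp (toSmoothMonoidData.mulHom (toSmoothMonoidData.a w x y) (X.id z))
        (toSmoothMonoidData.a w (toSmoothMonoidData.mul x y) z))
      (toSmoothMonoidData.mulHom (X.id w) (toSmoothMonoidData.a x y z)) =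
    X.vcomp (toSmoothMonoidData.a (toSmoothMonoidData.mul w x) y z)
      (toSmoothMonoidData.a w x (toSmoothMonoidData.mul y z))
  triangle : ∀ {c : Cart} (x y : X.Obj c),
    X.vcomp (toSmoothMonoidData.a x (toSmoothMonoidData.one c) y)
      (toSmoothMonoidData.mulHom (X.id x) (toSmoothMonoidData.l y)) =
    toSmoothMonoidData.mulHom (toSmoothMonoidData.r x) (X.id y)

/-- A smooth 2-group: a group object in the 2-category of smooth groupoids, i.e. a monoid object
such that `(⊗, pr₁)` is an equivalence. -/
structure SmoothTwoGroup extends SmoothMonoid.{u, v} where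
  invertible : (tensor.pair (fst X X)).IsEquivalence

/-- A symmetry `β_{x,y} : y ⊗ x ⟶ x ⊗ y` on a monoid object in smooth groupoids. -/
structure SmoothMonoid.Symmetry (A : SmoothMonoid.{u, v}) where
  braiding : TwoMorphism ((swap A.X A.X).comp A.tensor) A.tensor
  symm : ∀ {c : Cart} (x y : A.X.Obj c),
    A.X.vcomp (braiding.app (x, y) : A.X.Hom (𝟙 c) (A.mul y x) (A.mul x y))
      (braiding.app (y, x)) = A.X.id (A.mul y x)
  hexagon : ∀ {c : Cart} (x y z : A.X.Obj c),
    A.X.vcomp (A.X.vcomp (A.a x y z)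
        (braiding.app (A.mul y z, x) : A.X.Hom (𝟙 c) (A.mul x (A.mul y z)) _)) (A.a y z x) =
    A.X.vcomp (A.X.vcomp
        (A.mulHom (braiding.app (y, x) : A.X.Hom (𝟙 c) (A.mul x y) (A.mul y x)) (A.X.id z))
        (A.a y x z))
      (A.mulHom (A.X.id y) (braiding.app (z, x) : A.X.Hom (𝟙 c) (A.mul x z) (A.mul z x)))

/-- A smooth abelian 2-group: an abelian group object in the 2-category of smooth groupoids. -/
structure SmoothAbelianTwoGroup extends SmoothTwoGroup.{u, v} where
  symmetry : toSmoothMonoid.Symmetry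

namespace SmoothMonoid

/-- The data of a 1-morphism of monoid objects in smooth groupoids. -/
structure HomData (A : SmoothMonoid.{u, v}) (B : SmoothMonoid.{u₁, v₁}) where
  F : Morphism A.X B.X
  tensorIso : TwoMorphism ((F.prodMap F).comp B.tensor) (A.tensor.comp F)
  unitIso : TwoMorphism B.unit (A.unit.comp F)

namespace HomData

variable {A : SmoothMonoid.{u, v}} {B : SmoothMonoid.{u₁, v₁}} (S : HomData A B)

/-- The components `F x ⊗ F y ⟶ F (x ⊗ y)`. -/
def mu {c : Cart} (x y : A.X.Obj c) :
    B.X.Hom (𝟙 c) (B.mul (S.F.obj x) (S.F.obj y)) (S.F.obj (A.mul x y)) :=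
  S.tensorIso.app (x, y)

/-- The components `1 ⟶ F 1`. -/
def eps (c : Cart) : B.X.Hom (𝟙 c) (B.one c) (S.F.obj (A.one c)) := S.unitIso.app ()

end HomData

/-- A 1-morphism of monoid objects in smooth groupoids. -/
structure Hom (A : SmoothMonoid.{u, v}) (B : SmoothMonoid.{u₁, v₁}) extends HomData A B where
  associativity : ∀ {c : Cart} (x y z : A.X.Obj c),
    B.X.vcomp (B.X.vcomp (B.mulHom (toHomData.mu x y) (B.X.id (F.obj z)))
        (toHomData.mu (A.mul x y) z)) (F.map (A.a x y z)) =
    B.X.vcomp (B.X.vcomp (B.a (F.obj x) (F.obj y) (F.obj z))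
        (B.mulHom (B.X.id (F.obj x)) (toHomData.mu y z))) (toHomData.mu x (A.mul y z))
  left_unitality : ∀ {c : Cart} (x : A.X.Obj c),
    B.X.vcomp (B.X.vcomp (B.mulHom (toHomData.eps c) (B.X.id (F.obj x)))
        (toHomData.mu (A.one c) x)) (F.map (A.l x)) = B.l (F.obj x)
  right_unitality : ∀ {c : Cart} (x : A.X.Obj c),
    B.X.vcomp (B.X.vcomp (B.mulHom (B.X.id (F.obj x)) (toHomData.eps c))
        (toHomData.mu x (A.one c))) (F.map (A.r x)) = B.r (F.obj x)

/-- A 2-morphism of monoid objects in smooth groupoids. -/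
structure TwoHom {A : SmoothMonoid.{u, v}} {B : SmoothMonoid.{u₁, v₁}} (S T : Hom A B) where
  theta : TwoMorphism S.F T.F
  tensor_compat : ∀ {c : Cart} (x y : A.X.Obj c),
    B.X.vcomp (B.mulHom (theta.app x) (theta.app y)) (T.mu x y) =
    B.X.vcomp (S.mu x y) (theta.app (A.mul x y))
  unit_compat : ∀ c : Cart, B.X.vcomp (S.eps c) (theta.app (A.one c)) = T.eps c

theorem mulHom_vcomp (A : SmoothMonoid.{u, v}) {c : Cart} {x y z x' y' z' : A.X.Obj c}
    (φ : A.X.Hom (𝟙 c) x y) (ψ : A.X.Hom (𝟙 c) y z)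
    (φ' : A.X.Hom (𝟙 c) x' y') (ψ' : A.X.Hom (𝟙 c) y' z') :
    A.mulHom (A.X.vcomp φ ψ) (A.X.vcomp φ' ψ') =
      A.X.vcomp (A.mulHom φ φ') (A.mulHom ψ ψ') :=
  A.tensor.map_comp (x := (x, x')) (y := (y, y')) (z := (z, z')) (f := 𝟙 c) (g := 𝟙 c)
    (φ, φ') (ψ, ψ')

theorem mulHom_vcomp_id (A : SmoothMonoid.{u, v}) {c : Cart} {x y z x' : A.X.Obj c}
    (φ : A.X.Hom (𝟙 c) x y) (ψ : A.X.Hom (𝟙 c) y z) :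
    A.mulHom (A.X.vcomp φ ψ) (A.X.id x') =
      A.X.vcomp (A.mulHom φ (A.X.id x')) (A.mulHom ψ (A.X.id x')) := by
  rw [← mulHom_vcomp, vcomp_id]

theorem mulHom_id_vcomp (A : SmoothMonoid.{u, v}) {c : Cart} {x y z x' : A.X.Obj c}
    (φ : A.X.Hom (𝟙 c) x y) (ψ : A.X.Hom (𝟙 c) y z) :
    A.mulHom (A.X.id x') (A.X.vcomp φ ψ) =
      A.X.vcomp (A.mulHom (A.X.id x') φ) (A.mulHom (A.X.id x') ψ) := by
  rw [← mulHom_vcomp, vcomp_id]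

theorem mulHom_id (A : SmoothMonoid.{u, v}) {c : Cart} (x y : A.X.Obj c) :
    A.mulHom (A.X.id x) (A.X.id y) = A.X.id (A.mul x y) :=
  A.tensor.map_id (x, y)

theorem HomData.mu_natural {A : SmoothMonoid.{u, v}} {B : SmoothMonoid.{u₁, v₁}}
    (S : HomData A B) {c : Cart} {x y x' y' : A.X.Obj c}
    (φ : A.X.Hom (𝟙 c) x y) (φ' : A.X.Hom (𝟙 c) x' y') :
    B.X.vcomp (B.mulHom (S.F.map φ) (S.F.map φ')) (S.mu y y') =
      B.X.vcomp (S.mu x x') (S.F.map (A.mulHom φ φ')) :=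
  S.tensorIso.naturality (x := (x, x')) (y := (y, y')) (f := 𝟙 c) (φ, φ')

namespace Hom

variable {A : SmoothMonoid.{u, v}} {B : SmoothMonoid.{u₁, v₁}} {C : SmoothMonoid.{u₂, v₂}}

/-- The identity 1-morphism of monoid objects. -/
def id (A : SmoothMonoid.{u, v}) : Hom A A where
  F := Morphism.id A.X
  tensorIso := TwoMorphism.id A.tensor
  unitIso := TwoMorphism.id A.unit
  associativity x y z := by
    change A.X.vcomp (A.X.vcomp (A.mulHom (A.X.id (A.mul x y)) (A.X.id z))
        (A.X.id (A.mul (A.mul x y) z))) (A.a x y z) =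
      A.X.vcomp (A.X.vcomp (A.a x y z) (A.mulHom (A.X.id x) (A.X.id (A.mul y z))))
        (A.X.id (A.mul x (A.mul y z)))
    simp only [mulHom_id, vcomp_id, id_vcomp]
  left_unitality {c} x := by
    change A.X.vcomp (A.X.vcomp (A.mulHom (A.X.id (A.one c)) (A.X.id x))
        (A.X.id (A.mul (A.one c) x))) (A.l x) = A.l x
    simp only [mulHom_id, id_vcomp]
  right_unitality {c} x := by
    change A.X.vcomp (A.X.vcomp (A.mulHom (A.X.id x) (A.X.id (A.one c)))
        (A.X.id (A.mul x (A.one c)))) (A.r x) = A.r x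
    simp only [mulHom_id, id_vcomp]

/-- Composition of 1-morphisms of monoid objects, in diagrammatic order. -/
def comp (S : Hom A B) (T : Hom B C) : Hom A C where
  F := S.F.comp T.F
  tensorIso := (TwoMorphism.whiskerLeft (S.F.prodMap S.F) T.tensorIso).comp
    (TwoMorphism.whiskerRight S.tensorIso T.F)
  unitIso := T.unitIso.comp (TwoMorphism.whiskerRight S.unitIso T.F)
  associativity {c} x y z := by
    set x' := S.F.obj x
    set y' := S.F.obj y
    set z' := S.F.obj z
    change C.X.vcomp (C.X.vcomp
        (C.mulHom (C.X.vcomp (T.mu x' y') (T.F.map (S.mu x y))) (C.X.id (T.F.obj z')))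
        (C.X.vcomp (T.mu (S.F.obj (A.mul x y)) z') (T.F.map (S.mu (A.mul x y) z))))
        (T.F.map (S.F.map (A.a x y z))) =
      C.X.vcomp (C.X.vcomp (C.a (T.F.obj x') (T.F.obj y') (T.F.obj z'))
        (C.mulHom (C.X.id (T.F.obj x')) (C.X.vcomp (T.mu y' z') (T.F.map (S.mu y z)))))
        (C.X.vcomp (T.mu x' (S.F.obj (A.mul y z))) (T.F.map (S.mu x (A.mul y z))))
    have nat1 := T.mu_natural (S.mu x y) (B.X.id z')
    have nat2 := T.mu_natural (B.X.id x') (S.mu y z)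
    rw [T.F.map_id] at nat1 nat2
    have hT := T.associativity x' y' z'
    have hS := congrArg T.F.map (S.associativity x y z)
    simp only [Morphism.map_vcomp] at hS
    rw [mulHom_vcomp_id, mulHom_id_vcomp]
    simp only [vcomp_assoc] at nat1 nat2 hT hS ⊢
    rw [← vcomp_assoc (C.mulHom (T.F.map (S.mu x y)) _), nat1, vcomp_assoc, hS,
      ← vcomp_assoc (C.mulHom _ (T.F.map (S.mu y z))), nat2]
    simp only [← vcomp_assoc] at hT ⊢
    rw [hT]
  left_unitality {c} x := by
    set x' := S.F.obj x
    change C.X.vcomp (C.X.vcomp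
        (C.mulHom (C.X.vcomp (T.eps c) (T.F.map (S.eps c))) (C.X.id (T.F.obj x')))
        (C.X.vcomp (T.mu (S.F.obj (A.one c)) x') (T.F.map (S.mu (A.one c) x))))
        (T.F.map (S.F.map (A.l x))) = C.l (T.F.obj x')
    have nat1 := T.mu_natural (S.eps c) (B.X.id x')
    rw [T.F.map_id] at nat1
    have hT := T.left_unitality x'
    have hS := congrArg T.F.map (S.left_unitality x)
    simp only [Morphism.map_vcomp] at hS
    rw [mulHom_vcomp_id]
    simp only [vcomp_assoc] at nat1 hT hS ⊢
    rw [← vcomp_assoc (C.mulHom (T.F.map (S.eps c)) _), nat1, vcomp_assoc, hS]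
    exact hT
  right_unitality {c} x := by
    set x' := S.F.obj x
    change C.X.vcomp (C.X.vcomp
        (C.mulHom (C.X.id (T.F.obj x')) (C.X.vcomp (T.eps c) (T.F.map (S.eps c))))
        (C.X.vcomp (T.mu x' (S.F.obj (A.one c))) (T.F.map (S.mu x (A.one c)))))
        (T.F.map (S.F.map (A.r x))) = C.r (T.F.obj x')
    have nat1 := T.mu_natural (B.X.id x') (S.eps c)
    rw [T.F.map_id] at nat1
    have hT := T.right_unitality x'
    have hS := congrArg T.F.map (S.right_unitality x)
    simp only [Morphism.map_vcomp] at hS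
    rw [mulHom_id_vcomp]
    simp only [vcomp_assoc] at nat1 hT hS ⊢
    rw [← vcomp_assoc (C.mulHom _ (T.F.map (S.eps c))), nat1, vcomp_assoc, hS]
    exact hT

end Hom

end SmoothMonoid

/-- An equivalence of smooth 2-groups.  The 2-morphisms `unit` and `counit` are automatically
invertible. -/
structure SmoothTwoGroup.Equivalence (A : SmoothTwoGroup.{u, v}) (B : SmoothTwoGroup.{u₁, v₁}) where
  hom : SmoothMonoid.Hom A.toSmoothMonoid B.toSmoothMonoid
  inv : SmoothMonoid.Hom B.toSmoothMonoid A.toSmoothMonoid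
  unit : SmoothMonoid.TwoHom (SmoothMonoid.Hom.id A.toSmoothMonoid) (hom.comp inv)
  counit : SmoothMonoid.TwoHom (inv.comp hom) (SmoothMonoid.Hom.id B.toSmoothMonoid)

namespace SmoothGroupoid

variable {A : SmoothGroupoid.{u, v}} {B : SmoothGroupoid.{u₁, v₁}}

/-- Right cancellation in a smooth groupoid. -/
theorem cancel_right {c₀ c₁ c₂ : Cart} {f : c₀ ⟶ c₁} {g : c₁ ⟶ c₂}
    {x : A.Obj c₀} {y : A.Obj c₁} {z : A.Obj c₂} {φ φ' : A.Hom f x y} (ψ : A.Hom g y z)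
    (h : A.comp φ ψ = A.comp φ' ψ) : φ = φ' :=
  (A.fill f g (A.comp φ' ψ) ψ).unique h rfl

/-- A fully faithful 1-morphism that is essentially surjective on fibres is an equivalence. -/
theorem Morphism.isEquivalence_of_fullyFaithful (F : Morphism A B)
    (hff : ∀ {c c' : Cart} {f : c ⟶ c'} {x : A.Obj c} {y : A.Obj c'}
      (ψ : B.Hom f (F.obj x) (F.obj y)), ∃! φ : A.Hom f x y, F.map φ = ψ)
    (hes : ∀ {c : Cart} (z : B.Obj c), ∃ x : A.Obj c, Nonempty (B.Hom (𝟙 c) (F.obj x) z)) :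
    F.IsEquivalence := by
  have hinj : ∀ {c c' : Cart} {f : c ⟶ c'} {x : A.Obj c} {y : A.Obj c'} {φ φ' : A.Hom f x y},
      F.map φ = F.map φ' → φ = φ' := fun {c c' f x y φ φ'} h => (hff (F.map φ')).unique h rfl
  let g {c : Cart} (z : B.Obj c) : A.Obj c := (hes z).choose
  let e {c : Cart} (z : B.Obj c) : B.Hom (𝟙 c) (F.obj (g z)) z := (hes z).choose_spec.some
  have hG : ∀ {c c' : Cart} {f : c ⟶ c'} {z : B.Obj c} {w : B.Obj c'} (ψ : B.Hom f z w),
      ∃ φ : A.Hom f (g z) (g w), (B.comp (F.map φ) (e w) : B.Hom f _ _) = B.comp (e z) ψ := by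
    intro c c' f z w ψ
    obtain ⟨χ, hχ, -⟩ := B.fill f (𝟙 c') (B.comp (e z) ψ : B.Hom f _ _) (e w)
    obtain ⟨φ, hφ, -⟩ := hff χ
    exact ⟨φ, by rw [hφ]; exact hχ⟩
  choose G hG using @hG
  have hGu : ∀ {c c' : Cart} {f : c ⟶ c'} {z : B.Obj c} {w : B.Obj c'} (ψ : B.Hom f z w)
      (φ : A.Hom f (g z) (g w)), (B.comp (F.map φ) (e w) : B.Hom f _ _) = B.comp (e z) ψ →
      G ψ = φ := by
    intro c c' f z w ψ φ h
    exact hinj (cancel_right (e w) ((hG ψ).trans h.symm))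
  let GG : Morphism B A :=
    { obj := fun z => g z
      map := fun ψ => G ψ
      map_id := fun {c} z => hGu _ _ (by
        rw [F.map_id]; exact (B.id_comp (e z)).trans (B.comp_id (e z)).symm)
      map_comp := by
        intro c₀ c₁ c₂ f h x y z φ ψ
        apply hGu
        rw [F.map_comp]
        have h1 : B.comp (B.comp (F.map (G φ)) (F.map (G ψ))) (e z) =
          B.comp (F.map (G φ)) (B.comp (F.map (G ψ)) (e z)) := B.assoc _ _ _
        have h2 : B.comp (F.map (G φ)) (B.comp (F.map (G ψ)) (e z)) =
          B.comp (F.map (G φ)) (B.comp (e y) ψ) :=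
          congrArg (fun t : B.Hom h _ _ => B.comp (F.map (G φ)) t) (hG ψ)
        have h3 : B.comp (B.comp (F.map (G φ)) (e y)) ψ =
          B.comp (B.comp (e x) φ) ψ :=
          congrArg (fun t : B.Hom f _ _ => B.comp t ψ) (hG φ)
        exact ((h1.trans h2).trans (B.assoc _ _ _).symm).trans (h3.trans (B.assoc _ _ _)) }
  have hη : ∀ {c : Cart} (x : A.Obj c), ∃ φ : A.Hom (𝟙 c) x (g (F.obj x)),
      B.vcomp (F.map φ) (e (F.obj x)) = B.id (F.obj x) := by
    intro c x
    obtain ⟨χ, hχ, -⟩ := B.fill (𝟙 c) (𝟙 c) (B.id (F.obj x)) (e (F.obj x))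
    obtain ⟨φ, hφ, -⟩ := hff χ
    exact ⟨φ, by rw [hφ]; exact hχ⟩
  choose η hη using @hη
  refine ⟨GG, ⟨⟨fun x => η x, ?_⟩⟩, ⟨⟨fun z => e z, fun ψ => hG ψ⟩⟩⟩
  intro c c' f x y φ
  apply hinj
  apply cancel_right (e (F.obj y))
  have a1 : F.map (A.comp φ (η y)) = B.comp (F.map φ) (F.map (η y)) := F.map_comp _ _
  have a2 : F.map (A.comp (η x) (G (F.map φ))) = B.comp (F.map (η x)) (F.map (G (F.map φ))) :=
    F.map_comp _ _
  have b1 : B.comp (B.comp (F.map φ) (F.map (η y))) (e (F.obj y)) = F.map φ :=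
    (B.assoc _ _ _).trans ((congrArg (fun t : B.Hom (𝟙 c') _ _ => B.comp (F.map φ) t)
      (hη y)).trans (B.comp_id _))
  have b2 : B.comp (B.comp (F.map (η x)) (F.map (G (F.map φ)))) (e (F.obj y)) = F.map φ :=
    (B.assoc _ _ _).trans ((congrArg (fun t : B.Hom f _ _ => B.comp (F.map (η x)) t)
      (hG (F.map φ))).trans ((B.assoc _ _ _).symm.trans
      ((congrArg (fun t : B.Hom (𝟙 c) _ _ => B.comp t (F.map φ)) (hη x)).trans (B.id_comp _))))
  exact (congrArg (fun t : B.Hom f _ _ => B.comp t (e (F.obj y))) a1).trans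
    (b1.trans (b2.symm.trans
      (congrArg (fun t : B.Hom f _ _ => B.comp t (e (F.obj y))) a2.symm)))

end SmoothGroupoid

/-! ### Diffeological groups and their deloopings -/

open Diffeology in
/-- A diffeological group: a group with a diffeology such that multiplication and inversion are
smooth. -/
class DiffeologicalGroup (H : Type w) [Group H] [DiffeologicalSpace H] : Prop where
  isPlot_mul : ∀ {n : ℕ} {p q : EuclideanSpace ℝ (Fin n) → H},
    IsPlot p → IsPlot q → IsPlot (fun t => p t * q t)
  isPlot_inv : ∀ {n : ℕ} {p : EuclideanSpace ℝ (Fin n) → H},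
    IsPlot p → IsPlot (fun t => (p t)⁻¹)

/-- A map from a Cartesian space to a diffeological space is smooth if it sends the plots of `c`,
i.e. the smooth maps `ℝⁿ → c`, to plots. -/
def Cart.IsSmooth {H : Type w} [DiffeologicalSpace H] (c : Cart) (h : c.carrier → H) : Prop :=
  ∀ (n : ℕ) (p : EuclideanSpace ℝ (Fin n) → c.carrier), ContMDiff (𝓡 n) (𝓡 c.dim) ∞ p →
    Diffeology.IsPlot (h ∘ p)

section Delooping

variable (H : Type w) [Group H] [DiffeologicalSpace H] [DiffeologicalGroup H]

/-- The group of smooth maps from a Cartesian space to a diffeological group. -/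
def Cart.smoothMaps (c : Cart) : Subgroup (c.carrier → H) where
  carrier := {h | c.IsSmooth h}
  one_mem' _ _ _ := Diffeology.isPlot_const (x := (1 : H))
  mul_mem' ha hb n p hp := DiffeologicalGroup.isPlot_mul (ha n p hp) (hb n p hp)
  inv_mem' ha n _ hp := DiffeologicalGroup.isPlot_inv (ha n _ hp)

variable {H} in
/-- Precomposition of smooth maps with a morphism of Cartesian spaces. -/
def Cart.precomp {c c' : Cart} (f : c ⟶ c') (h : c'.smoothMaps H) : c.smoothMaps H :=
  ⟨fun t => h.1 (Cart.map f t), fun n p hp => h.2 n _ ((Cart.map f).contMDiff.comp hp)⟩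

/-- The delooping `B H` of a diffeological group as a smooth groupoid: its objects are the
Cartesian spaces, and its morphisms are pairs of a smooth map `f : c ⟶ c'` and a smooth map
`h : c → H`. -/
def delooping : SmoothGroupoid.{0, w} where
  Obj _ := Unit
  Hom {c _} _ _ _ := c.smoothMaps H
  id _ := 1
  comp {_ _ _ f _ _ _ _} h h' := h * Cart.precomp f h'
  id_comp φ := one_mul φ
  comp_id φ := mul_one φ
  assoc φ ψ χ := mul_assoc φ _ _
  lift _ _ := ⟨(), ⟨1⟩⟩
  fill f g _ _ _ χ ψ := by
    refine ⟨χ * (Cart.precomp f ψ)⁻¹, inv_mul_cancel_right χ _, fun φ h => ?_⟩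
    exact eq_mul_inv_of_mul_eq h

end Delooping

section DeloopingAbelian

variable (H : Type w) [CommGroup H] [DiffeologicalSpace H] [DiffeologicalGroup H]

/-- The delooping of a diffeological abelian group as a smooth abelian 2-group: the product of
morphisms `(f, h)` and `(f, h')` is `(f, h * h')`, and all coherence isomorphisms are
identities. -/
def deloopingTwoGroup : SmoothAbelianTwoGroup.{0, w} where
  X := delooping H
  unit :=
    { obj := fun _ => ()
      map := fun _ => (1 : Cart.smoothMaps H _)
      map_id := fun _ => rfl
      map_comp := fun _ _ => (mul_one (1 : Cart.smoothMaps H _)).symm }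
  tensor :=
    { obj := fun _ => ()
      map := fun {c _ _ _ _} φ => (show c.smoothMaps H from φ.1) * (show c.smoothMaps H from φ.2)
      map_id := fun {c} _ => mul_one (1 : c.smoothMaps H)
      map_comp := fun {c _ _ f _ _ _ _} φ ψ => mul_mul_mul_comm
        (show c.smoothMaps H from φ.1) (Cart.precomp f (show Cart.smoothMaps H _ from ψ.1))
        (show c.smoothMaps H from φ.2) (Cart.precomp f (show Cart.smoothMaps H _ from ψ.2)) }
  assoc :=
    { app := fun {c} _ => (1 : c.smoothMaps H)
      naturality := fun {c _ _ _ _} φ => (mul_one (_ : c.smoothMaps H)).trans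
        ((mul_assoc (show c.smoothMaps H from φ.1.1) _ _).trans
          (one_mul (_ : c.smoothMaps H)).symm) }
  leftUnitor :=
    { app := fun {c} _ => (1 : c.smoothMaps H)
      naturality := fun {c _ _ _ _} φ => mul_one (1 * (show c.smoothMaps H from φ)) }
  rightUnitor :=
    { app := fun {c} _ => (1 : c.smoothMaps H)
      naturality := fun {c _ _ _ _} φ => (mul_one ((show c.smoothMaps H from φ) * 1)).trans
        (mul_comm (show c.smoothMaps H from φ) 1) }
  pentagon {c} _ _ _ _ := by
    change ((1 * 1 : c.smoothMaps H) * 1) * (1 * 1) = 1 * 1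
    simp only [mul_one]
  triangle {c} _ _ := by
    change (1 : c.smoothMaps H) * (1 * 1) = 1 * 1
    simp only [mul_one]
  invertible := by
    apply Morphism.isEquivalence_of_fullyFaithful
    · rintro c c' f x y ⟨p, q⟩
      change c.smoothMaps H at p q
      refine ⟨(q, (q⁻¹ * p : c.smoothMaps H)), Prod.ext (mul_inv_cancel_left q p) rfl, ?_⟩
      rintro ⟨p', q'⟩ h
      change c.smoothMaps H at p' q'
      have h1 : p' * q' = p := congrArg Prod.fst h
      have h2 : p' = q := congrArg Prod.snd h
      refine Prod.ext h2 ?_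
      change q' = q⁻¹ * p
      rw [← h1, ← h2, inv_mul_cancel_left]
    · exact fun {c} z => ⟨((), ()), ⟨((1 : c.smoothMaps H), (1 : c.smoothMaps H))⟩⟩
  symmetry :=
    { braiding :=
        { app := fun {c} _ => (1 : c.smoothMaps H)
          naturality := fun {c _ _ _ _} φ => (mul_one (_ : c.smoothMaps H)).trans
            ((mul_comm (show c.smoothMaps H from φ.2) (show c.smoothMaps H from φ.1)).trans
              (one_mul (_ : c.smoothMaps H)).symm) }
      symm := fun {c} _ _ => mul_one (1 : c.smoothMaps H)
      hexagon := fun {c} _ _ _ => by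
        change ((1 : c.smoothMaps H) * 1) * 1 = ((1 * 1) * 1) * (1 * 1)
        simp only [mul_one] }

end DeloopingAbelian

/-! ### Hermitean line bundles -/

section Bundles

open scoped TensorProduct

variable {E : Type u₁} [NormedAddCommGroup E] [NormedSpace ℝ E] {H : Type u₂} [TopologicalSpace H]
  (I : ModelWithCorners ℝ E H) (X : Type u) [TopologicalSpace X] [ChartedSpace H X]

/-- A smooth hermitean line bundle on a manifold `X`: a family of complex lines with a hermitean
inner product, together with a bundle atlas, given by local frames whose transition functions are
smooth and in which the hermitean metric is smooth. -/
structure HermitianLineBundle where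
  Fib : X → Type
  [normed : ∀ x, NormedAddCommGroup (Fib x)]
  [innerProduct : ∀ x, InnerProductSpace ℂ (Fib x)]
  finrank_fib : ∀ x, Module.finrank ℂ (Fib x) = 1
  /-- The index type of the bundle atlas. -/
  index : Type
  dom : index → TopologicalSpace.Opens X
  exists_mem_dom : ∀ x, ∃ i, x ∈ dom i
  frame : index → ∀ x, Fib x
  frame_ne_zero : ∀ i, ∀ x ∈ dom i, frame i x ≠ 0
  transition : ∀ i j, ∃ g : X → ℂ, ContMDiffOn I 𝓘(ℝ, ℂ) ∞ g (dom i ∩ dom j) ∧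
    ∀ x ∈ (dom i ∩ dom j : Set X), frame i x = g x • frame j x
  metric : ∀ i, ContMDiffOn I 𝓘(ℝ, ℝ) ∞ (fun x => ‖frame i x‖ ^ 2) (dom i)

attribute [instance] HermitianLineBundle.normed HermitianLineBundle.innerProduct

namespace HermitianLineBundle

variable {I X}

theorem smoothOn_mul {f g : X → ℂ} {s : Set X} (hf : ContMDiffOn I 𝓘(ℝ, ℂ) ∞ f s)
    (hg : ContMDiffOn I 𝓘(ℝ, ℂ) ∞ g s) : ContMDiffOn I 𝓘(ℝ, ℂ) ∞ (fun x => f x * g x) s := by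
  have h : ContDiff ℝ ∞ fun p : ℂ × ℂ => p.1 * p.2 := contDiff_fst.mul contDiff_snd
  exact h.contMDiff.comp_contMDiffOn (hf.prodMk_space hg)

theorem smoothOn_inv {f : X → ℂ} {s : Set X} (hf : ContMDiffOn I 𝓘(ℝ, ℂ) ∞ f s)
    (h0 : ∀ x ∈ s, f x ≠ 0) : ContMDiffOn I 𝓘(ℝ, ℂ) ∞ (fun x => (f x)⁻¹) s := by
  intro x hx
  have h : ContDiffAt ℝ ∞ (fun z : ℂ => z⁻¹) (f x) := contDiffAt_inv ℝ (h0 x hx)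
  exact h.contMDiffAt.comp_contMDiffWithinAt x (hf x hx)

/-- An isomorphism of hermitean line bundles: a family of linear isometries between the fibres
which is smooth with respect to the local frames. -/
structure Iso (L K : HermitianLineBundle I X) where
  toEquiv : ∀ x, L.Fib x ≃ₗᵢ[ℂ] K.Fib x
  smooth : ∀ i j, ∃ g : X → ℂ, ContMDiffOn I 𝓘(ℝ, ℂ) ∞ g (L.dom i ∩ K.dom j) ∧
    ∀ x ∈ (L.dom i ∩ K.dom j : Set X), toEquiv x (L.frame i x) = g x • K.frame j x

theorem Iso.ext {L K : HermitianLineBundle I X} {φ ψ : Iso L K}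
    (h : ∀ x v, φ.toEquiv x v = ψ.toEquiv x v) : φ = ψ := by
  obtain ⟨f, _⟩ := φ
  obtain ⟨g, _⟩ := ψ
  have : f = g := funext fun x => LinearIsometryEquiv.ext (h x)
  subst this
  rfl

/-- Smoothness of a family of isometries may be checked locally, in some frames. -/
theorem smooth_of_local {L K : HermitianLineBundle I X} (φ : ∀ x, L.Fib x ≃ₗᵢ[ℂ] K.Fib x)
    (h : ∀ x, ∃ i j, ∃ U : Set X, IsOpen U ∧ x ∈ U ∧ U ⊆ L.dom i ∩ K.dom j ∧ ∃ g : X → ℂ,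
      ContMDiffOn I 𝓘(ℝ, ℂ) ∞ g U ∧ ∀ y ∈ U, φ y (L.frame i y) = g y • K.frame j y)
    (i : L.index) (j : K.index) :
    ∃ g : X → ℂ, ContMDiffOn I 𝓘(ℝ, ℂ) ∞ g (L.dom i ∩ K.dom j) ∧
      ∀ x ∈ (L.dom i ∩ K.dom j : Set X), φ x (L.frame i x) = g x • K.frame j x := by
  have key : ∀ x ∈ (L.dom i ∩ K.dom j : Set X), ∃ V : Set X, IsOpen V ∧ x ∈ V ∧ ∃ g : X → ℂ,
      ContMDiffOn I 𝓘(ℝ, ℂ) ∞ g V ∧ ∀ y ∈ V, φ y (L.frame i y) = g y • K.frame j y := by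
    intro x hx
    obtain ⟨i', j', U, hU, hxU, hUs, g, hg, hgf⟩ := h x
    obtain ⟨s, hs, hsf⟩ := L.transition i i'
    obtain ⟨t, ht, htf⟩ := K.transition j' j
    refine ⟨U ∩ (L.dom i ∩ K.dom j), hU.inter ((L.dom i).2.inter (K.dom j).2), ⟨hxU, hx⟩,
      fun y => s y * (g y * t y), ?_, ?_⟩
    · refine smoothOn_mul (hs.mono ?_) (smoothOn_mul (hg.mono ?_) (ht.mono ?_))
      · exact fun y hy => ⟨hy.2.1, (hUs hy.1).1⟩
      · exact fun y hy => hy.1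
      · exact fun y hy => ⟨(hUs hy.1).2, hy.2.2⟩
    · intro y hy
      rw [hsf y ⟨hy.2.1, (hUs hy.1).1⟩, map_smul, hgf y hy.1,
        htf y ⟨(hUs hy.1).2, hy.2.2⟩, smul_smul, smul_smul, mul_assoc]
  let G : X → ℂ := fun x =>
    inner ℂ (K.frame j x) (φ x (L.frame i x)) / inner ℂ (K.frame j x) (K.frame j x)
  have hG : ∀ y ∈ K.dom j, ∀ a : ℂ, φ y (L.frame i y) = a • K.frame j y → G y = a := by
    intro y hy a ha
    have hne : inner ℂ (K.frame j y) (K.frame j y) ≠ 0 :=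
      inner_self_ne_zero.2 (K.frame_ne_zero j y hy)
    simp only [G, ha, inner_smul_right]
    exact mul_div_cancel_right₀ _ hne
  refine ⟨G, ?_, ?_⟩
  · intro x hx
    obtain ⟨V, hV, hxV, g, hg, hgf⟩ := key x hx
    have hVo : IsOpen (V ∩ (L.dom i ∩ K.dom j : Set X)) :=
      hV.inter ((L.dom i).2.inter (K.dom j).2)
    have : ContMDiffOn I 𝓘(ℝ, ℂ) ∞ G (V ∩ (L.dom i ∩ K.dom j)) :=
      (hg.mono Set.inter_subset_left).congr fun y hy => hG y hy.2.2 _ (hgf y hy.1)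
    exact (this.contMDiffAt (hVo.mem_nhds ⟨hxV, hx⟩)).contMDiffWithinAt
  · intro x hx
    obtain ⟨V, hV, hxV, g, hg, hgf⟩ := key x hx
    rw [hG x hx.2 _ (hgf x hxV)]
    exact hgf x hxV

/-- A family of isometries that maps some frames around every point to frames is smooth. -/
theorem smooth_of_frames {L K : HermitianLineBundle I X} (φ : ∀ x, L.Fib x ≃ₗᵢ[ℂ] K.Fib x)
    (h : ∀ x, ∃ i j, x ∈ L.dom i ∧ x ∈ K.dom j ∧ ∀ y, φ y (L.frame i y) = K.frame j y)
    (i : L.index) (j : K.index) :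
    ∃ g : X → ℂ, ContMDiffOn I 𝓘(ℝ, ℂ) ∞ g (L.dom i ∩ K.dom j) ∧
      ∀ x ∈ (L.dom i ∩ K.dom j : Set X), φ x (L.frame i x) = g x • K.frame j x := by
  refine smooth_of_local φ (fun x => ?_) i j
  obtain ⟨i, j, hi, hj, hf⟩ := h x
  exact ⟨i, j, _, (L.dom i).2.inter (K.dom j).2, ⟨hi, hj⟩, subset_rfl, fun _ => 1,
    contMDiffOn_const, fun y _ => by rw [hf, one_smul]⟩

/-- The identity isomorphism. -/
def Iso.refl (L : HermitianLineBundle I X) : Iso L L where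
  toEquiv x := LinearIsometryEquiv.refl ℂ (L.Fib x)
  smooth := smooth_of_frames _ fun x => by
    obtain ⟨i, hi⟩ := L.exists_mem_dom x
    exact ⟨i, i, hi, hi, fun _ => rfl⟩

/-- Composition of isomorphisms, in diagrammatic order. -/
def Iso.trans {L K N : HermitianLineBundle I X} (φ : Iso L K) (ψ : Iso K N) : Iso L N where
  toEquiv x := (φ.toEquiv x).trans (ψ.toEquiv x)
  smooth := smooth_of_local _ fun x => by
    obtain ⟨i, hi⟩ := L.exists_mem_dom x
    obtain ⟨j, hj⟩ := K.exists_mem_dom x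
    obtain ⟨k, hk⟩ := N.exists_mem_dom x
    obtain ⟨g, hg, hgf⟩ := φ.smooth i j
    obtain ⟨h, hh, hhf⟩ := ψ.smooth j k
    refine ⟨i, k, (L.dom i ∩ K.dom j) ∩ N.dom k, ((L.dom i).2.inter (K.dom j).2).inter (N.dom k).2,
      ⟨⟨hi, hj⟩, hk⟩, fun y hy => ⟨hy.1.1, hy.2⟩, fun y => g y * h y, ?_, ?_⟩
    · exact smoothOn_mul (hg.mono fun y hy => hy.1) (hh.mono fun y hy => ⟨hy.1.2, hy.2⟩)
    · intro y hy
      rw [LinearIsometryEquiv.trans_apply, hgf y hy.1, map_smul, hhf y ⟨hy.1.2, hy.2⟩, smul_smul]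

/-- The inverse isomorphism. -/
def Iso.symm {L K : HermitianLineBundle I X} (φ : Iso L K) : Iso K L where
  toEquiv x := (φ.toEquiv x).symm
  smooth := smooth_of_local _ fun x => by
    obtain ⟨i, hi⟩ := L.exists_mem_dom x
    obtain ⟨j, hj⟩ := K.exists_mem_dom x
    obtain ⟨g, hg, hgf⟩ := φ.smooth i j
    have hg0 : ∀ y ∈ (L.dom i ∩ K.dom j : Set X), g y ≠ 0 := by
      intro y hy h0
      have := hgf y hy
      rw [h0, zero_smul] at this
      exact L.frame_ne_zero i y hy.1 ((φ.toEquiv y).map_eq_zero_iff.1 this)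
    refine ⟨j, i, L.dom i ∩ K.dom j, (L.dom i).2.inter (K.dom j).2, ⟨hi, hj⟩,
      fun y hy => ⟨hy.2, hy.1⟩, fun y => (g y)⁻¹, ?_, ?_⟩
    · exact smoothOn_inv hg hg0
    · intro y hy
      rw [LinearIsometryEquiv.symm_apply_eq, map_smul, hgf y hy, smul_smul,
        inv_mul_cancel₀ (hg0 y hy), one_smul]

/-- The trivial hermitean line bundle. -/
def trivial (I : ModelWithCorners ℝ E H) (X : Type u) [TopologicalSpace X] [ChartedSpace H X] :
    HermitianLineBundle I X where
  Fib _ := ℂ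
  finrank_fib _ := Module.finrank_self ℂ
  index := Unit
  dom _ := ⊤
  exists_mem_dom _ := ⟨(), _root_.trivial⟩
  frame _ _ := 1
  frame_ne_zero _ _ _ := one_ne_zero
  transition _ _ := ⟨fun _ => 1, contMDiffOn_const, fun _ _ => (one_smul ℂ (1 : ℂ)).symm⟩
  metric _ := contMDiffOn_const

/-- The tensor product of hermitean line bundles. -/
def tensor (L K : HermitianLineBundle I X) : HermitianLineBundle I X where
  Fib x := L.Fib x ⊗[ℂ] K.Fib x
  finrank_fib x := by
    rw [Module.finrank_tensorProduct, L.finrank_fib, K.finrank_fib]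
  index := L.index × K.index
  dom i := L.dom i.1 ⊓ K.dom i.2
  exists_mem_dom x := by
    obtain ⟨i, hi⟩ := L.exists_mem_dom x
    obtain ⟨j, hj⟩ := K.exists_mem_dom x
    exact ⟨(i, j), hi, hj⟩
  frame i x := L.frame i.1 x ⊗ₜ K.frame i.2 x
  frame_ne_zero i x hx h := by
    have h' := congrArg norm h
    rw [TensorProduct.norm_tmul, norm_zero] at h'
    exact mul_ne_zero (norm_ne_zero_iff.2 (L.frame_ne_zero _ x hx.1))
      (norm_ne_zero_iff.2 (K.frame_ne_zero _ x hx.2)) h'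
  transition i j := by
    obtain ⟨g, hg, hgf⟩ := L.transition i.1 j.1
    obtain ⟨h, hh, hhf⟩ := K.transition i.2 j.2
    refine ⟨fun y => g y * h y, smoothOn_mul (hg.mono ?_) (hh.mono ?_), fun y hy => ?_⟩
    · exact fun y hy => ⟨hy.1.1, hy.2.1⟩
    · exact fun y hy => ⟨hy.1.2, hy.2.2⟩
    · rw [hgf y ⟨hy.1.1, hy.2.1⟩, hhf y ⟨hy.1.2, hy.2.2⟩, TensorProduct.smul_tmul_smul]
  metric i := by
    have h1 : ContMDiffOn I 𝓘(ℝ, ℝ) ∞ (fun x => ‖L.frame i.1 x‖ ^ 2)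
        (L.dom i.1 ⊓ K.dom i.2 : TopologicalSpace.Opens X) := (L.metric i.1).mono fun y hy => hy.1
    have h2 : ContMDiffOn I 𝓘(ℝ, ℝ) ∞ (fun x => ‖K.frame i.2 x‖ ^ 2)
        (L.dom i.1 ⊓ K.dom i.2 : TopologicalSpace.Opens X) := (K.metric i.2).mono fun y hy => hy.2
    have := h1.mul h2
    refine this.congr fun y _ => ?_
    rw [TensorProduct.norm_tmul, mul_pow]
    rfl

/-- The tensor product of isomorphisms. -/
def Iso.tensor {L K L' K' : HermitianLineBundle I X} (φ : Iso L L') (ψ : Iso K K') :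
    Iso (L.tensor K) (L'.tensor K') where
  toEquiv x := TensorProduct.congrIsometry (φ.toEquiv x) (ψ.toEquiv x)
  smooth i j := by
    obtain ⟨g, hg, hgf⟩ := φ.smooth i.1 j.1
    obtain ⟨h, hh, hhf⟩ := ψ.smooth i.2 j.2
    refine ⟨fun y => g y * h y, smoothOn_mul (hg.mono ?_) (hh.mono ?_), fun y hy => ?_⟩
    · exact fun y hy => ⟨hy.1.1, hy.2.1⟩
    · exact fun y hy => ⟨hy.1.2, hy.2.2⟩
    · change φ.toEquiv y (L.frame i.1 y) ⊗ₜ[ℂ] ψ.toEquiv y (K.frame i.2 y) =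
        (g y * h y) • (L'.frame j.1 y ⊗ₜ[ℂ] K'.frame j.2 y)
      rw [hgf y ⟨hy.1.1, hy.2.1⟩, hhf y ⟨hy.1.2, hy.2.2⟩, TensorProduct.smul_tmul_smul]

/-- The associativity isomorphism of the tensor product. -/
def tensorAssoc (L K N : HermitianLineBundle I X) :
    Iso ((L.tensor K).tensor N) (L.tensor (K.tensor N)) where
  toEquiv x := TensorProduct.assocIsometry ℂ (L.Fib x) (K.Fib x) (N.Fib x)
  smooth := smooth_of_frames _ fun x => by
    obtain ⟨i, hi⟩ := L.exists_mem_dom x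
    obtain ⟨j, hj⟩ := K.exists_mem_dom x
    obtain ⟨k, hk⟩ := N.exists_mem_dom x
    exact ⟨((i, j), k), (i, (j, k)), ⟨⟨hi, hj⟩, hk⟩, ⟨hi, ⟨hj, hk⟩⟩, fun y => rfl⟩

/-- The isomorphism `1 ⊗ L ≅ L`. -/
def tensorLeftUnit (L : HermitianLineBundle I X) : Iso ((trivial I X).tensor L) L where
  toEquiv x := TensorProduct.lidIsometry ℂ (L.Fib x)
  smooth := smooth_of_frames _ fun x => by
    obtain ⟨i, hi⟩ := L.exists_mem_dom x
    exact ⟨((), i), i, ⟨_root_.trivial, hi⟩, hi, fun y => one_smul ℂ (L.frame i y)⟩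

/-- The isomorphism `L ⊗ 1 ≅ L`. -/
def tensorRightUnit (L : HermitianLineBundle I X) : Iso (L.tensor (trivial I X)) L where
  toEquiv x := TensorProduct.ridIsometry ℂ (L.Fib x)
  smooth := smooth_of_frames _ fun x => by
    obtain ⟨i, hi⟩ := L.exists_mem_dom x
    exact ⟨(i, ()), i, ⟨hi, _root_.trivial⟩, hi, fun y => one_smul ℂ (L.frame i y)⟩

theorem tensorLeftUnit_tmul (L : HermitianLineBundle I X) (x : X) (a : ℂ) (v : L.Fib x) :
    (tensorLeftUnit L).toEquiv x (a ⊗ₜ[ℂ] v) = a • v := rfl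

theorem tensorRightUnit_tmul (L : HermitianLineBundle I X) (x : X) (a : ℂ) (v : L.Fib x) :
    (tensorRightUnit L).toEquiv x (v ⊗ₜ[ℂ] a) = a • v := rfl

/-- The flip `K ⊗ L ≅ L ⊗ K`. -/
def tensorComm (K L : HermitianLineBundle I X) : Iso (K.tensor L) (L.tensor K) where
  toEquiv x := TensorProduct.commIsometry ℂ (K.Fib x) (L.Fib x)
  smooth := smooth_of_frames _ fun x => by
    obtain ⟨i, hi⟩ := L.exists_mem_dom x
    obtain ⟨j, hj⟩ := K.exists_mem_dom x
    exact ⟨(j, i), (i, j), ⟨hj, hi⟩, ⟨hi, hj⟩, fun y => rfl⟩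

theorem Iso.ext_tensor {L K N : HermitianLineBundle I X} {φ ψ : Iso (L.tensor K) N}
    (h : ∀ x v w, φ.toEquiv x (v ⊗ₜ[ℂ] w) = ψ.toEquiv x (v ⊗ₜ[ℂ] w)) : φ = ψ := by
  refine Iso.ext fun x t => ?_
  induction t using TensorProduct.induction_on with
  | zero => exact (map_zero (φ.toEquiv x)).trans (map_zero (ψ.toEquiv x)).symm
  | tmul v w => exact h x v w
  | add v w hv hw =>
    exact (map_add (φ.toEquiv x) v w).trans ((congrArg₂ (· + ·) hv hw).trans
      (map_add (ψ.toEquiv x) v w).symm)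

theorem Iso.ext_tensor₃ {L K N P : HermitianLineBundle I X}
    {φ ψ : Iso ((L.tensor K).tensor N) P}
    (h : ∀ x u v w, φ.toEquiv x ((u ⊗ₜ[ℂ] v) ⊗ₜ[ℂ] w) = ψ.toEquiv x ((u ⊗ₜ[ℂ] v) ⊗ₜ[ℂ] w)) :
    φ = ψ := by
  refine Iso.ext_tensor fun x t w => ?_
  have hz : ((0 : L.Fib x ⊗[ℂ] K.Fib x) ⊗ₜ[ℂ] w) = 0 := TensorProduct.zero_tmul _ w
  have ha : ∀ a b : L.Fib x ⊗[ℂ] K.Fib x, (a + b) ⊗ₜ[ℂ] w = a ⊗ₜ[ℂ] w + b ⊗ₜ[ℂ] w :=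
    fun a b => TensorProduct.add_tmul a b w
  induction t using TensorProduct.induction_on with
  | zero =>
    exact (congrArg (φ.toEquiv x) hz).trans ((map_zero (φ.toEquiv x)).trans
      ((map_zero (ψ.toEquiv x)).symm.trans (congrArg (ψ.toEquiv x) hz.symm)))
  | tmul u v => exact h x u v w
  | add a b hv hw =>
    exact (congrArg (φ.toEquiv x) (ha a b)).trans ((map_add (φ.toEquiv x) _ _).trans
      ((congrArg₂ (· + ·) hv hw).trans ((map_add (ψ.toEquiv x) _ _).symm.trans
        (congrArg (ψ.toEquiv x) (ha a b).symm))))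

theorem Iso.ext_tensor₄ {L K N P Q : HermitianLineBundle I X}
    {φ ψ : Iso (((L.tensor K).tensor N).tensor P) Q}
    (h : ∀ x t u v w, φ.toEquiv x (((t ⊗ₜ[ℂ] u) ⊗ₜ[ℂ] v) ⊗ₜ[ℂ] w) =
      ψ.toEquiv x (((t ⊗ₜ[ℂ] u) ⊗ₜ[ℂ] v) ⊗ₜ[ℂ] w)) :
    φ = ψ := by
  refine Iso.ext_tensor₃ fun x t v w => ?_
  have hz : (((0 : L.Fib x ⊗[ℂ] K.Fib x) ⊗ₜ[ℂ] v) ⊗ₜ[ℂ] w) = 0 := by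
    rw [TensorProduct.zero_tmul, TensorProduct.zero_tmul]
  have ha : ∀ a b : L.Fib x ⊗[ℂ] K.Fib x, ((a + b) ⊗ₜ[ℂ] v) ⊗ₜ[ℂ] w =
      (a ⊗ₜ[ℂ] v) ⊗ₜ[ℂ] w + (b ⊗ₜ[ℂ] v) ⊗ₜ[ℂ] w :=
    fun a b => by rw [TensorProduct.add_tmul, TensorProduct.add_tmul]
  induction t using TensorProduct.induction_on with
  | zero =>
    exact (congrArg (φ.toEquiv x) hz).trans ((map_zero (φ.toEquiv x)).trans
      ((map_zero (ψ.toEquiv x)).symm.trans (congrArg (ψ.toEquiv x) hz.symm)))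
  | tmul u u' => exact h x u u' v w
  | add a b hv hw =>
    exact (congrArg (φ.toEquiv x) (ha a b)).trans ((map_add (φ.toEquiv x) _ _).trans
      ((congrArg₂ (· + ·) hv hw).trans ((map_add (ψ.toEquiv x) _ _).symm.trans
        (congrArg (ψ.toEquiv x) (ha a b).symm))))

theorem tensorAssoc_naturality {L K N L' K' N' : HermitianLineBundle I X} (α : Iso L L')
    (β : Iso K K') (γ : Iso N N') :
    ((α.tensor β).tensor γ).trans (tensorAssoc L' K' N') =
      (tensorAssoc L K N).trans (α.tensor (β.tensor γ)) :=
  Iso.ext_tensor₃ fun _ _ _ _ => rfl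

theorem tensorLeftUnit_naturality {L L' : HermitianLineBundle I X} (α : Iso L L') :
    ((Iso.refl (trivial I X)).tensor α).trans (tensorLeftUnit L') =
      (tensorLeftUnit L).trans α :=
  Iso.ext_tensor fun x a v => ((α.toEquiv x).map_smul a v).symm

theorem tensorRightUnit_naturality {L L' : HermitianLineBundle I X} (α : Iso L L') :
    (α.tensor (Iso.refl (trivial I X))).trans (tensorRightUnit L') =
      (tensorRightUnit L).trans α :=
  Iso.ext_tensor fun x v a => ((α.toEquiv x).map_smul a v).symm

theorem tensorComm_naturality {L L' K K' : HermitianLineBundle I X} (α : Iso L L')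
    (β : Iso K K') :
    (α.tensor β).trans (tensorComm L' K') = (tensorComm L K).trans (β.tensor α) :=
  Iso.ext_tensor fun _ _ _ => rfl

theorem tensor_pentagon (L K N P : HermitianLineBundle I X) :
    (((tensorAssoc L K N).tensor (Iso.refl P)).trans (tensorAssoc L (K.tensor N) P)).trans
        ((Iso.refl L).tensor (tensorAssoc K N P)) =
      (tensorAssoc (L.tensor K) N P).trans (tensorAssoc L K (N.tensor P)) :=
  Iso.ext_tensor₄ fun _ _ _ _ _ => rfl

theorem tensor_triangle (L K : HermitianLineBundle I X) :
    (tensorAssoc L (trivial I X) K).trans ((Iso.refl L).tensor (tensorLeftUnit K)) =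
      (tensorRightUnit L).tensor (Iso.refl K) :=
  Iso.ext_tensor₃ fun _ v (a : ℂ) w => (TensorProduct.smul_tmul a v w).symm

theorem tensor_symm (L K : HermitianLineBundle I X) :
    (tensorComm L K).trans (tensorComm K L) = Iso.refl (L.tensor K) :=
  Iso.ext_tensor fun _ _ _ => rfl

theorem tensor_hexagon (L K N : HermitianLineBundle I X) :
    ((tensorAssoc L K N).trans (tensorComm L (K.tensor N))).trans (tensorAssoc K N L) =
      (((tensorComm L K).tensor (Iso.refl N)).trans (tensorAssoc K L N)).trans
        ((Iso.refl K).tensor (tensorComm L N)) :=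
  Iso.ext_tensor₃ fun _ _ _ _ => rfl

/-- Every complex line with an inner product contains a unit vector. -/
theorem exists_unit {V : Type} [NormedAddCommGroup V] [InnerProductSpace ℂ V]
    (hV : Module.finrank ℂ V = 1) : ∃ v : V, ‖v‖ = 1 := by
  have : Nontrivial V := Module.nontrivial_of_finrank_pos (R := ℂ) (by omega)
  obtain ⟨v, hv⟩ := exists_ne (0 : V)
  exact ⟨((‖v‖⁻¹ : ℝ) : ℂ) • v, by
    rw [norm_smul, Complex.norm_real, norm_inv, norm_norm, inv_mul_cancel₀ (norm_ne_zero_iff.2 hv)]⟩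

/-- In a complex line, every vector is a multiple of a given nonzero one. -/
theorem exists_smul {V : Type} [NormedAddCommGroup V] [InnerProductSpace ℂ V]
    (hV : Module.finrank ℂ V = 1) {v : V} (hv : v ≠ 0) (w : V) : ∃ a : ℂ, w = a • v := by
  obtain ⟨a, ha⟩ := (finrank_eq_one_iff_of_nonzero' v hv).1 hV w
  exact ⟨a, ha.symm⟩

/-- The isometry between complex lines that sends a given unit vector to another one. -/
theorem exists_isometry {V W : Type} [NormedAddCommGroup V] [InnerProductSpace ℂ V]
    [NormedAddCommGroup W] [InnerProductSpace ℂ W] (hV : Module.finrank ℂ V = 1)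
    (hW : Module.finrank ℂ W = 1) {v : V} {w : W} (hv : ‖v‖ = 1) (hw : ‖w‖ = 1) :
    ∃ f : V ≃ₗᵢ[ℂ] W, f v = w := by
  have : FiniteDimensional ℂ V := Module.finite_of_finrank_pos (by omega)
  have : FiniteDimensional ℂ W := Module.finite_of_finrank_pos (by omega)
  let a : ℂ ≃ₗᵢ[ℂ] V := (LinearIsometry.toSpanSingleton ℂ V hv).toLinearIsometryEquiv
    (by rw [hV, Module.finrank_self])
  let b : ℂ ≃ₗᵢ[ℂ] W := (LinearIsometry.toSpanSingleton ℂ W hw).toLinearIsometryEquiv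
    (by rw [hW, Module.finrank_self])
  have ha : a 1 = v := one_smul ℂ v
  have hb : b 1 = w := one_smul ℂ w
  refine ⟨a.symm.trans b, ?_⟩
  rw [LinearIsometryEquiv.trans_apply, ← ha, LinearIsometryEquiv.symm_apply_apply, hb]

/-- Isomorphisms can be divided in the second tensor factor. -/
theorem Iso.exists_unique_tensor {L K L' K' : HermitianLineBundle I X} (φ : Iso L L')
    (θ : Iso (L.tensor K) (L'.tensor K')) : ∃! ψ : Iso K K', φ.tensor ψ = θ := by
  have hex : ∀ x, ∃ χ : K.Fib x ≃ₗᵢ[ℂ] K'.Fib x, ∀ v w,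
      θ.toEquiv x (v ⊗ₜ[ℂ] w) = φ.toEquiv x v ⊗ₜ[ℂ] χ w := by
    intro x
    obtain ⟨e, he⟩ := exists_unit (L.finrank_fib x)
    obtain ⟨k, hk⟩ := exists_unit (K.finrank_fib x)
    obtain ⟨k', hk'⟩ := exists_unit (K'.finrank_fib x)
    have he0 : e ≠ 0 := fun h => by simp [h] at he
    have hk0 : k ≠ 0 := fun h => by simp [h] at hk
    have hn : ‖φ.toEquiv x e ⊗ₜ[ℂ] k'‖ = 1 := by
      rw [TensorProduct.norm_tmul, LinearIsometryEquiv.norm_map, he, hk', one_mul]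
    have hn0 : φ.toEquiv x e ⊗ₜ[ℂ] k' ≠ 0 := fun h => by
      rw [h, norm_zero] at hn; exact zero_ne_one hn
    obtain ⟨s, hs⟩ := exists_smul ((L'.tensor K').finrank_fib x) hn0
      (θ.toEquiv x (e ⊗ₜ[ℂ] k))
    have hs1 : ‖s • k'‖ = 1 := by
      have h : ‖e ⊗ₜ[ℂ] k‖ = ‖s • (φ.toEquiv x e ⊗ₜ[ℂ] k')‖ :=
        ((θ.toEquiv x).norm_map _).symm.trans (congrArg norm hs)
      rw [TensorProduct.norm_tmul, he, hk, one_mul, norm_smul, hn, mul_one] at h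
      rw [norm_smul, hk', mul_one, ← h]
    obtain ⟨χ, hχ⟩ := exists_isometry (K.finrank_fib x) (K'.finrank_fib x) hk hs1
    refine ⟨χ, fun v w => ?_⟩
    obtain ⟨a, rfl⟩ := exists_smul (L.finrank_fib x) he0 v
    obtain ⟨b, rfl⟩ := exists_smul (K.finrank_fib x) hk0 w
    rw [TensorProduct.smul_tmul_smul]
    refine ((θ.toEquiv x).map_smul (a * b) (e ⊗ₜ[ℂ] k)).trans ?_
    rw [hs, map_smul, map_smul, hχ, TensorProduct.smul_tmul_smul, TensorProduct.tmul_smul]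
    rfl
  choose χ hχ using hex
  refine ⟨⟨χ, smooth_of_local χ fun x => ?_⟩, ?_, ?_⟩
  · obtain ⟨i, hi⟩ := L.exists_mem_dom x
    obtain ⟨j, hj⟩ := K.exists_mem_dom x
    obtain ⟨i', hi'⟩ := L'.exists_mem_dom x
    obtain ⟨j', hj'⟩ := K'.exists_mem_dom x
    obtain ⟨g, hg, hgf⟩ := φ.smooth i i'
    obtain ⟨h, hh, hhf⟩ := θ.smooth (i, j) (i', j')
    set U : Set X := (L.dom i ∩ L'.dom i') ∩ (K.dom j ∩ K'.dom j') with hU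
    have hg0 : ∀ y ∈ U, g y ≠ 0 := by
      intro y hy h0
      have := hgf y hy.1
      rw [h0, zero_smul] at this
      exact L.frame_ne_zero i y hy.1.1 ((φ.toEquiv y).map_eq_zero_iff.1 this)
    have hUs : U ⊆ (L.tensor K).dom (i, j) ∩ (L'.tensor K').dom (i', j') :=
      fun y hy => ⟨⟨hy.1.1, hy.2.1⟩, ⟨hy.1.2, hy.2.2⟩⟩
    refine ⟨j, j', U, ((L.dom i).2.inter (L'.dom i').2).inter ((K.dom j).2.inter (K'.dom j').2),
      ⟨⟨hi, hi'⟩, ⟨hj, hj'⟩⟩, fun y hy => hy.2, fun y => (g y)⁻¹ * h y, ?_, ?_⟩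
    · exact smoothOn_mul (smoothOn_inv (hg.mono fun z hz => hz.1) hg0) (hh.mono hUs)
    · intro y hy
      have h1 := hhf y (hUs hy)
      have h2 := hχ y (L.frame i y) (K.frame j y)
      have hne : K'.frame j' y ≠ 0 := K'.frame_ne_zero j' y hy.2.2
      have hne' : L'.frame i' y ≠ 0 := L'.frame_ne_zero i' y hy.1.2
      obtain ⟨a, ha⟩ := exists_smul (K'.finrank_fib y) hne (χ y (K.frame j y))
      have h3 : (g y * a) • (L'.frame i' y ⊗ₜ[ℂ] K'.frame j' y) =
          h y • (L'.frame i' y ⊗ₜ[ℂ] K'.frame j' y) := by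
        rw [← TensorProduct.smul_tmul_smul, ← ha, ← hgf y hy.1]
        exact h2.symm.trans h1
      have h4 : (L'.frame i' y ⊗ₜ[ℂ] K'.frame j' y) ≠ 0 :=
        (L'.tensor K').frame_ne_zero (i', j') y ⟨hy.1.2, hy.2.2⟩
      have h5 := smul_left_injective ℂ h4 h3
      change χ y (K.frame j y) = ((g y)⁻¹ * h y) • K'.frame j' y
      rw [ha, ← h5, inv_mul_cancel_left₀ (hg0 y hy)]
  · refine Iso.ext fun x v => ?_
    change TensorProduct.congrIsometry (φ.toEquiv x) (χ x) v = θ.toEquiv x v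
    induction v using TensorProduct.induction_on with
    | zero => rw [map_zero]; exact (map_zero (θ.toEquiv x)).symm
    | tmul v w => rw [hχ]; rfl
    | add v w hv hw => rw [map_add, hv, hw]; exact (map_add (θ.toEquiv x) v w).symm
  · intro ψ hψ
    refine Iso.ext fun x w => ?_
    obtain ⟨e, he⟩ := exists_unit (L.finrank_fib x)
    have h1 : φ.toEquiv x e ⊗ₜ[ℂ] (ψ.toEquiv x w) = φ.toEquiv x e ⊗ₜ[ℂ] (χ x w) := by
      rw [← hχ, ← hψ]; rfl
    have h2 : φ.toEquiv x e ⊗ₜ[ℂ] (ψ.toEquiv x w - χ x w) = 0 := by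
      rw [TensorProduct.tmul_sub, h1, sub_self]
    have h3 := congrArg norm h2
    rw [TensorProduct.norm_tmul, LinearIsometryEquiv.norm_map, he, one_mul, norm_zero,
      norm_eq_zero] at h3
    exact sub_eq_zero.1 h3

/-- Every hermitean line bundle is invertible for the tensor product. -/
theorem exists_dual (L : HermitianLineBundle I X) :
    ∃ L' : HermitianLineBundle I X, Nonempty (Iso (L.tensor L') (trivial I X)) := by
  choose e he using fun x => exists_unit (L.finrank_fib x)
  have he0 : ∀ x, e x ≠ 0 := fun x h => by simpa [h] using he x
  choose f hf using fun x => exists_isometry (L.finrank_fib x) (Module.finrank_self ℂ) (he x)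
    (norm_one (α := ℂ))
  have hf0 : ∀ i, ∀ x ∈ L.dom i, f x (L.frame i x) ≠ 0 := fun i x hx h =>
    L.frame_ne_zero i x hx ((f x).map_eq_zero_iff.1 h)
  let L' : HermitianLineBundle I X :=
    { Fib := fun _ => ℂ
      finrank_fib := fun _ => Module.finrank_self ℂ
      index := L.index
      dom := L.dom
      exists_mem_dom := L.exists_mem_dom
      frame := fun i x => (f x (L.frame i x))⁻¹
      frame_ne_zero := fun i x hx => inv_ne_zero (hf0 i x hx)
      transition := fun i j => by
        obtain ⟨g, hg, hgf⟩ := L.transition j i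
        refine ⟨g, hg.mono fun z hz => ⟨hz.2, hz.1⟩, fun y hy => ?_⟩
        have hne := hf0 j y hy.2
        have h1 : f y (L.frame j y) = g y * f y (L.frame i y) := by
          rw [hgf y ⟨hy.2, hy.1⟩, map_smul, smul_eq_mul]
        have hg0 : g y ≠ 0 := fun h => hne (by rw [h1, h, zero_mul])
        rw [smul_eq_mul, h1, mul_inv, mul_inv_cancel_left₀ hg0]
      metric := fun i => by
        have h : ContMDiffOn I 𝓘(ℝ, ℝ) ∞ (fun x => (‖L.frame i x‖ ^ 2)⁻¹) (L.dom i) :=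
          fun y hy => ((L.metric i) y hy).inv₀
            (pow_ne_zero 2 (norm_ne_zero_iff.2 (L.frame_ne_zero i y hy)))
        refine h.congr fun y _ => ?_
        rw [norm_inv, inv_pow, LinearIsometryEquiv.norm_map] }
  refine ⟨L', ⟨⟨fun x => (TensorProduct.congrIsometry (f x)
    (LinearIsometryEquiv.refl ℂ ℂ)).trans (TensorProduct.lidIsometry ℂ ℂ),
    smooth_of_local _ fun x => ?_⟩⟩⟩
  obtain ⟨i, hi⟩ := L.exists_mem_dom x
  refine ⟨(i, i), (), L.dom i, (L.dom i).2, hi, fun y hy => ⟨⟨hy, hy⟩, _root_.trivial⟩,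
    fun _ => 1, contMDiffOn_const, fun y hy => ?_⟩
  change f y (L.frame i y) • ((f y (L.frame i y))⁻¹ : ℂ) = (1 : ℂ) • (1 : ℂ)
  rw [smul_eq_mul, mul_inv_cancel₀ (hf0 i y hy), one_smul]

section Pullback

variable {E' : Type u₁} [NormedAddCommGroup E'] [NormedSpace ℝ E'] {H' : Type u₂}
  [TopologicalSpace H'] {I' : ModelWithCorners ℝ E' H'} {Y : Type v} [TopologicalSpace Y]
  [ChartedSpace H' Y]

/-- The pullback of a hermitean line bundle along a smooth map. -/
def pullback (L : HermitianLineBundle I' Y) (F : C^∞⟮I, X; I', Y⟯) : HermitianLineBundle I X where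
  Fib x := L.Fib (F x)
  finrank_fib x := L.finrank_fib (F x)
  index := L.index
  dom i := (L.dom i).comap ⟨F, F.contMDiff.continuous⟩
  exists_mem_dom x := L.exists_mem_dom (F x)
  frame i x := L.frame i (F x)
  frame_ne_zero i x hx := L.frame_ne_zero i (F x) hx
  transition i j := by
    obtain ⟨g, hg, hgf⟩ := L.transition i j
    exact ⟨fun x => g (F x), hg.comp F.contMDiff.contMDiffOn fun x hx => hx,
      fun x hx => hgf (F x) hx⟩
  metric i := (L.metric i).comp F.contMDiff.contMDiffOn fun x hx => hx

/-- The pullback of an isomorphism of hermitean line bundles along a smooth map. -/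
def Iso.pullback {L K : HermitianLineBundle I' Y} (φ : Iso L K) (F : C^∞⟮I, X; I', Y⟯) :
    Iso (L.pullback F) (K.pullback F) where
  toEquiv x := φ.toEquiv (F x)
  smooth i j := by
    obtain ⟨g, hg, hgf⟩ := φ.smooth i j
    exact ⟨fun x => g (F x), hg.comp F.contMDiff.contMDiffOn fun x hx => hx,
      fun x hx => hgf (F x) hx⟩

end Pullback

end HermitianLineBundle

end Bundles

/-! ### The smooth 2-group of hermitean line bundles on a manifold -/

section HLBdl

open scoped TensorProduct
open HermitianLineBundle

variable (d : ℕ) (M : Type u) [TopologicalSpace M] [ChartedSpace (EuclideanSpace ℝ (Fin d)) M]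

/-- The smooth map `f × 1 : c × M ⟶ c' × M`. -/
def Cart.timesId {c c' : Cart} (f : c ⟶ c') :
    C^∞⟮(𝓡 c.dim).prod (𝓡 d), c.carrier × M; (𝓡 c'.dim).prod (𝓡 d), c'.carrier × M⟯ :=
  ⟨fun p => (Cart.map f p.1, p.2),
    ((Cart.map f).contMDiff.comp contMDiff_fst).prodMk contMDiff_snd⟩

/-- The smooth groupoid of hermitean line bundles on `M`: the objects over `c` are the hermitean
line bundles on `c × M`, and the morphisms `L ⟶ L'` over `f : c ⟶ c'` are the isomorphisms
`L ≅ (f × 1)^* L'`. -/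
def hlbdl : SmoothGroupoid.{max 1 u, u} where
  Obj c := HermitianLineBundle ((𝓡 c.dim).prod (𝓡 d)) (c.carrier × M)
  Hom f L L' := Iso L (L'.pullback (Cart.timesId d M f))
  id L := Iso.refl L
  comp {_ _ _ f _ _ _ _} φ ψ := φ.trans (ψ.pullback (Cart.timesId d M f))
  id_comp _ := rfl
  comp_id _ := rfl
  assoc _ _ _ := rfl
  lift f L := ⟨L.pullback (Cart.timesId d M f), ⟨Iso.refl _⟩⟩
  fill f g _ _ N χ ψ := by
    refine ⟨Iso.trans (K := (N.pullback (Cart.timesId d M g)).pullback (Cart.timesId d M f)) χ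
      (ψ.pullback (Cart.timesId d M f)).symm, ?_, fun φ h => ?_⟩
    · refine Iso.ext fun x v => ?_
      exact LinearIsometryEquiv.apply_symm_apply (ψ.toEquiv _) _
    · refine Iso.ext fun x v => ?_
      rw [← h]
      exact (LinearIsometryEquiv.symm_apply_apply (ψ.toEquiv (Cart.timesId d M f x))
        (φ.toEquiv x v)).symm

variable {d M} in
/-- An isomorphism of hermitean line bundles on `c × M`, as a morphism over the identity of `c`. -/
def HermitianLineBundle.Iso.vertical {c : Cart}
    {L K : HermitianLineBundle ((𝓡 c.dim).prod (𝓡 d)) (c.carrier × M)} (φ : Iso L K) :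
    (hlbdl d M).Hom (𝟙 c) L K :=
  ⟨φ.toEquiv, φ.smooth⟩

/-- The monoid data on the smooth groupoid of hermitean line bundles on `M`: the trivial line bundle
and the tensor product. -/
def hlbdlData : SmoothMonoidData.{max 1 u, u} where
  X := hlbdl d M
  unit :=
    { obj := fun {c} _ => trivial ((𝓡 c.dim).prod (𝓡 d)) (c.carrier × M)
      map := fun {c _ _ _ _} _ => Iso.refl (trivial ((𝓡 c.dim).prod (𝓡 d)) (c.carrier × M))
      map_id := fun _ => rfl
      map_comp := fun _ _ => rfl }
  tensor :=
    { obj := fun L => L.1.tensor L.2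
      map := fun φ => Iso.tensor φ.1 φ.2
      map_id := fun L => Iso.ext_tensor fun x v w => rfl
      map_comp := by
        intro c₀ c₁ c₂ f g L K N φ ψ
        exact Iso.ext_tensor fun x v w => rfl }
  assoc :=
    { app := fun L => (tensorAssoc L.1.1 L.1.2 L.2).vertical
      naturality := by
        intro c c' f L L' φ
        exact tensorAssoc_naturality (L' := L'.1.1.pullback (Cart.timesId d M f))
          (K' := L'.1.2.pullback (Cart.timesId d M f)) (N' := L'.2.pullback (Cart.timesId d M f))
          φ.1.1 φ.1.2 φ.2 }
  leftUnitor :=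
    { app := fun L => (tensorLeftUnit L).vertical
      naturality := by
        intro c c' f L L' φ
        exact tensorLeftUnit_naturality (L' := L'.pullback (Cart.timesId d M f)) φ }
  rightUnitor :=
    { app := fun L => (tensorRightUnit L).vertical
      naturality := by
        intro c c' f L L' φ
        exact tensorRightUnit_naturality (L' := L'.pullback (Cart.timesId d M f)) φ }

section

variable {d M}

theorem vertical_vcomp {c : Cart}
    {L K N : HermitianLineBundle ((𝓡 c.dim).prod (𝓡 d)) (c.carrier × M)}
    (φ : Iso L K) (ψ : Iso K N) :
    (hlbdl d M).vcomp φ.vertical ψ.vertical = (φ.trans ψ).vertical := rfl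

theorem vertical_refl {c : Cart}
    (L : HermitianLineBundle ((𝓡 c.dim).prod (𝓡 d)) (c.carrier × M)) :
    (hlbdl d M).id L = (Iso.refl L).vertical := rfl

theorem vertical_mulHom {c : Cart}
    {L K L' K' : HermitianLineBundle ((𝓡 c.dim).prod (𝓡 d)) (c.carrier × M)}
    (φ : Iso L K) (ψ : Iso L' K') :
    (hlbdlData d M).mulHom (c := c) φ.vertical ψ.vertical = (φ.tensor ψ).vertical := rfl

variable {c : Cart} (L K N P : HermitianLineBundle ((𝓡 c.dim).prod (𝓡 d)) (c.carrier × M))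

theorem hlbdl_a : (hlbdlData d M).a (c := c) L K N = (tensorAssoc L K N).vertical := rfl

theorem hlbdl_l : (hlbdlData d M).l (c := c) L = (tensorLeftUnit L).vertical := rfl

theorem hlbdl_r : (hlbdlData d M).r (c := c) L = (tensorRightUnit L).vertical := rfl

theorem hlbdl_pentagon :
    (hlbdl d M).vcomp ((hlbdl d M).vcomp
        ((hlbdlData d M).mulHom (c := c) ((hlbdlData d M).a (c := c) L K N) ((hlbdl d M).id P))
        ((hlbdlData d M).a (c := c) L (K.tensor N) P))
      ((hlbdlData d M).mulHom (c := c) ((hlbdl d M).id L) ((hlbdlData d M).a (c := c) K N P)) =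
    (hlbdl d M).vcomp ((hlbdlData d M).a (c := c) (L.tensor K) N P)
      ((hlbdlData d M).a (c := c) L K (N.tensor P)) := by
  have h1 : (hlbdlData d M).mulHom (c := c) ((hlbdlData d M).a (c := c) L K N) ((hlbdl d M).id P) =
    ((tensorAssoc L K N).tensor (Iso.refl P)).vertical :=
    vertical_mulHom (tensorAssoc L K N) (Iso.refl P)
  have h2 : (hlbdlData d M).mulHom (c := c) ((hlbdl d M).id L) ((hlbdlData d M).a (c := c) K N P) =
    ((Iso.refl L).tensor (tensorAssoc K N P)).vertical :=
    vertical_mulHom (Iso.refl L) (tensorAssoc K N P)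
  exact (congrArg₂ (fun (s : (hlbdl d M).Hom (𝟙 c) (((L.tensor K).tensor N).tensor P)
        ((L.tensor (K.tensor N)).tensor P)) (t : (hlbdl d M).Hom (𝟙 c)
        (L.tensor ((K.tensor N).tensor P)) (L.tensor (K.tensor (N.tensor P)))) =>
      (hlbdl d M).vcomp ((hlbdl d M).vcomp s (tensorAssoc L (K.tensor N) P).vertical) t)
    h1 h2).trans (congrArg Iso.vertical (tensor_pentagon L K N P))

theorem hlbdl_triangle :
    (hlbdl d M).vcomp ((hlbdlData d M).a (c := c) L (trivial _ _) K)
      ((hlbdlData d M).mulHom (c := c) ((hlbdl d M).id L) ((hlbdlData d M).l (c := c) K)) =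
    (hlbdlData d M).mulHom (c := c) ((hlbdlData d M).r (c := c) L) ((hlbdl d M).id K) := by
  have h1 : (hlbdlData d M).mulHom (c := c) ((hlbdl d M).id L) ((hlbdlData d M).l (c := c) K) =
    ((Iso.refl L).tensor (tensorLeftUnit K)).vertical :=
    vertical_mulHom (Iso.refl L) (tensorLeftUnit K)
  have h2 : (hlbdlData d M).mulHom (c := c) ((hlbdlData d M).r (c := c) L) ((hlbdl d M).id K) =
    ((tensorRightUnit L).tensor (Iso.refl K)).vertical :=
    vertical_mulHom (tensorRightUnit L) (Iso.refl K)
  exact (congrArg (fun (t : (hlbdl d M).Hom (𝟙 c) (L.tensor ((trivial _ _).tensor K))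
      (L.tensor K)) => (hlbdl d M).vcomp (tensorAssoc L (trivial _ _) K).vertical t) h1).trans
    ((congrArg Iso.vertical (tensor_triangle L K)).trans h2.symm)

end

/-- The smooth monoid of hermitean line bundles on `M`. -/
def hlbdlMonoid : SmoothMonoid.{max 1 u, u} where
  toSmoothMonoidData := hlbdlData d M
  pentagon L K N P := hlbdl_pentagon L K N P
  triangle L K := hlbdl_triangle L K

section

variable {d M} {c : Cart}
  (L K N : HermitianLineBundle ((𝓡 c.dim).prod (𝓡 d)) (c.carrier × M))

/-- The braiding given by the flip of the tensor product. -/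
def hlbdlBraiding : TwoMorphism ((swap (hlbdl d M) (hlbdl d M)).comp (hlbdlData d M).tensor)
    (hlbdlData d M).tensor where
  app := fun {c} (L : HermitianLineBundle _ (c.carrier × M) × HermitianLineBundle _ _) =>
    (tensorComm L.2 L.1).vertical
  naturality := by
    intro c c' f L L' φ
    exact tensorComm_naturality (L' := L'.2.pullback (Cart.timesId d M f))
      (K' := L'.1.pullback (Cart.timesId d M f)) φ.2 φ.1

theorem hlbdl_b :
    ((hlbdlBraiding (d := d) (M := M)).app (c := c) (L, K) :
      (hlbdl d M).Hom (𝟙 c) (K.tensor L) (L.tensor K)) = (tensorComm K L).vertical := rfl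

theorem hlbdl_symm :
    (hlbdl d M).vcomp ((hlbdlBraiding (d := d) (M := M)).app (c := c) (L, K) :
      (hlbdl d M).Hom (𝟙 c) (K.tensor L) (L.tensor K))
      ((hlbdlBraiding (d := d) (M := M)).app (c := c) (K, L)) = (hlbdl d M).id (K.tensor L) :=
  congrArg Iso.vertical (tensor_symm K L)

theorem hlbdl_hexagon :
    (hlbdl d M).vcomp ((hlbdl d M).vcomp ((hlbdlData d M).a (c := c) L K N)
        ((hlbdlBraiding (d := d) (M := M)).app (c := c) (K.tensor N, L) :
          (hlbdl d M).Hom (𝟙 c) (L.tensor (K.tensor N)) ((K.tensor N).tensor L)))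
        ((hlbdlData d M).a (c := c) K N L) =
    (hlbdl d M).vcomp ((hlbdl d M).vcomp
        ((hlbdlData d M).mulHom (c := c)
          ((hlbdlBraiding (d := d) (M := M)).app (c := c) (K, L) :
            (hlbdl d M).Hom (𝟙 c) (L.tensor K) (K.tensor L)) ((hlbdl d M).id N))
        ((hlbdlData d M).a (c := c) K L N))
      ((hlbdlData d M).mulHom (c := c) ((hlbdl d M).id K)
        ((hlbdlBraiding (d := d) (M := M)).app (c := c) (N, L) :
          (hlbdl d M).Hom (𝟙 c) (L.tensor N) (N.tensor L))) := by
  have h1 : (hlbdlData d M).mulHom (c := c) (tensorComm L K).vertical ((hlbdl d M).id N) =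
    ((tensorComm L K).tensor (Iso.refl N)).vertical :=
    vertical_mulHom (tensorComm L K) (Iso.refl N)
  have h2 : (hlbdlData d M).mulHom (c := c) ((hlbdl d M).id K) (tensorComm L N).vertical =
    ((Iso.refl K).tensor (tensorComm L N)).vertical :=
    vertical_mulHom (Iso.refl K) (tensorComm L N)
  exact (congrArg Iso.vertical (tensor_hexagon L K N)).trans
    (congrArg₂ (fun (s : (hlbdl d M).Hom (𝟙 c) ((L.tensor K).tensor N) ((K.tensor L).tensor N))
        (t : (hlbdl d M).Hom (𝟙 c) (K.tensor (L.tensor N)) (K.tensor (N.tensor L))) =>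
      (hlbdl d M).vcomp ((hlbdl d M).vcomp s (tensorAssoc K L N).vertical) t) h1 h2).symm

end

/-- The symmetry of the smooth monoid of hermitean line bundles on `M`. -/
def hlbdlSymmetry : (hlbdlMonoid d M).Symmetry where
  braiding := hlbdlBraiding
  symm L K := hlbdl_symm L K
  hexagon L K N := hlbdl_hexagon L K N

/-- The smooth abelian 2-group of hermitean line bundles on `M`, with the tensor product. -/
def hlbdlTwoGroup : SmoothAbelianTwoGroup.{max 1 u, u} where
  toSmoothMonoid := hlbdlMonoid d M
  invertible := by
    apply Morphism.isEquivalence_of_fullyFaithful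
    · rintro c c' f ⟨L, K⟩ ⟨L', K'⟩ ⟨θ, φ⟩
      obtain ⟨ψ, hψ, hu⟩ := Iso.exists_unique_tensor (L' := L'.pullback (Cart.timesId d M f))
        (K' := K'.pullback (Cart.timesId d M f)) φ θ
      refine ⟨(φ, ψ), Prod.ext hψ rfl, ?_⟩
      rintro ⟨φ', ψ'⟩ h
      have h2 : φ' = φ := congrArg Prod.snd h
      subst h2
      exact Prod.ext rfl (hu ψ' (congrArg Prod.fst h))
    · rintro c ⟨P, L⟩
      obtain ⟨L', ⟨e⟩⟩ := exists_dual L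
      exact ⟨(L, L'.tensor P), ⟨((tensorAssoc L L' P).symm.trans
        ((e.tensor (Iso.refl P)).trans (tensorLeftUnit P)), Iso.refl L)⟩⟩
  symmetry := hlbdlSymmetry d M

end HLBdl

/-! ### The diffeological group `U(1)^M` -/

section CircleMaps

variable (d : ℕ) (M : Type u) [TopologicalSpace M] [ChartedSpace (EuclideanSpace ℝ (Fin d)) M]

/-- The abelian group `U(1)^M` of smooth maps `M ⟶ U(1)`. -/
abbrev CircleMaps : Type u := C^∞⟮𝓡 d, M; 𝓡 1, Circle⟯

/-- The mapping space diffeology on `U(1)^M`: a map `p : ℝⁿ → U(1)^M` is a plot if and only if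
`(t, x) ↦ p t x` is a smooth map `ℝⁿ × M → U(1)`. -/
instance : DiffeologicalSpace (CircleMaps d M) :=
  .ofCorePlotsOn {
    isPlotOn := fun {n u} _ p => ContMDiffOn ((𝓡 n).prod (𝓡 d)) (𝓡 1) ∞
      (fun q : EuclideanSpace ℝ (Fin n) × M => p q.1 q.2) (u ×ˢ Set.univ)
    isPlotOn_congr := fun _ _ _ h => contMDiffOn_congr fun q hq => by rw [h hq.1]
    isPlot := fun {n} p => ContMDiff ((𝓡 n).prod (𝓡 d)) (𝓡 1) ∞
      fun q : EuclideanSpace ℝ (Fin n) × M => p q.1 q.2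
    isPlotOn_univ := by
      intro n p
      rw [Set.univ_prod_univ, contMDiffOn_univ]
    isPlot_const := fun x => x.contMDiff.comp contMDiff_snd
    isPlotOn_reparam := by
      intro n m u v hu hv p f h hp hf
      have hF : ContMDiffOn ((𝓡 m).prod (𝓡 d)) ((𝓡 n).prod (𝓡 d)) ∞
          (fun q : EuclideanSpace ℝ (Fin m) × M => (f q.1, q.2)) (v ×ˢ Set.univ) :=
        (hf.contMDiffOn.comp contMDiffOn_fst fun q hq => hq.1).prodMk contMDiffOn_snd
      exact hp.comp hF fun q hq => ⟨h hq.1, Set.mem_univ _⟩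
    locality := by
      intro n u hu p hp q hq
      obtain ⟨v, hv, hqv, hpv⟩ := hp q.1 hq.1
      exact ((hpv q ⟨hqv, Set.mem_univ _⟩).contMDiffAt
        ((hv.prod isOpen_univ).mem_nhds ⟨hqv, Set.mem_univ _⟩)).contMDiffWithinAt }

instance : DiffeologicalGroup (CircleMaps d M) where
  isPlot_mul hp hq := ContMDiff.mul (n := ∞) hp hq
  isPlot_inv hp := ContMDiff.inv (n := ∞) hp

end CircleMaps

/-! ### String-admissible smooth 2-groups -/

/-- A space is 2-connected if it is nonempty, path-connected, and its first and second homotopy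
groups vanish. -/
def IsTwoConnected (X : Type u) [TopologicalSpace X] : Prop :=
  SimplyConnectedSpace X ∧ ∀ x : X, Subsingleton (π_ 2 X x)

/-- `X` is an Eilenberg-MacLane space `K(ℤ, 1)`. -/
def IsEilenbergMacLaneZOne (X : Type u) [TopologicalSpace X] : Prop :=
  PathConnectedSpace X ∧ ∀ x : X, Nonempty (π_ 1 X x ≃* Multiplicative ℤ) ∧
    ∀ n : ℕ, 2 ≤ n → Subsingleton (π_ n X x)

/-- The underlying topological space of a diffeological space, which carries the D-topology, is a
`K(ℤ, 1)`. -/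
def IsDiffeologicalKZOne (X : Type u) [DiffeologicalSpace X] : Prop :=
  @IsEilenbergMacLaneZOne X DiffeologicalSpace.dTopology

/-- A smooth 2-group is string-admissible if it is abelian and equivalent, as a smooth 2-group, to
the delooping of a diffeological abelian group whose underlying topological space is a
`K(ℤ, 1)`. -/
def IsStringAdmissible (A : SmoothTwoGroup.{u, v}) : Prop :=
  Nonempty A.toSmoothMonoid.Symmetry ∧
    ∃ (H : Type v) (_ : CommGroup H) (_ : DiffeologicalSpace H) (_ : DiffeologicalGroup H),
      IsDiffeologicalKZOne H ∧
      Nonempty (SmoothTwoGroup.Equivalence A (deloopingTwoGroup H).toSmoothTwoGroup)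

end

/-!
The theorem has two halves: hermitean line bundles on `c × M` are trivial, so that `HLBdl^M` only
remembers automorphisms of trivial bundles, which are smooth maps `c × M → U(1)`; and the group
`U(1)^M` of such maps is a quotient of a contractible group by `ℤ`.

**Triviality of line bundles.**  Let `X = c × M`, which is 2-connected, and let `L` be a hermitean
line bundle on `X`.  A discrete transport takes the place of a connection.  A partition of unity
embeds `L` into a trivial vector bundle, and projecting a unit vector from one fibre to a nearby one
and normalizing transports it along a path in small steps.  With a step size that varies
continuously with the path, the transported vector depends continuously on the path, although it is
not a homotopy invariant.  Two paths with the same endpoints thus differ by a phase in `U(1)`, a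
continuous function of the loop they form.  The space of loops in `X` is simply connected because
`π₁ X = π₂ X = 0`, so the phase has a real logarithm, normalized to vanish on trivial loops; by
uniqueness of lifts it is additive on triples of paths with the same endpoints.  Choosing paths from
a base point over contractible neighbourhoods gives local sections whose transition functions are
exponentials of an additive real cocycle (`HermitianLineBundle.exists_sections_log_transition`).  A
partition of unity writes this cocycle as a coboundary, so the local sections can be corrected by
phases to agree on overlaps, and the resulting continuous unit section can be smoothed.  A smooth
unit section is a trivialization (`nonempty_iso_trivial_of_isTwoConnected`).

**The equivalence.**  Automorphisms of the trivial hermitean line bundle on `c × M` are the smooth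
functions `c × M → U(1)`, that is, the plots `c → U(1)^M`, whence a fully faithful monoidal
1-morphism from the delooping of `U(1)^M` to `HLBdl^M` that hits the trivial bundles.  By the first
part it is essentially surjective, and a fully faithful and essentially surjective monoidal
1-morphism of smooth 2-groups is an equivalence (`SmoothTwoGroup.nonempty_equivalence`).

**The homotopy type of `U(1)^M`.**  As `M` is simply connected, a smooth family of maps
`M → U(1)` lifts through `ℝ → U(1)` to a smooth family of real functions.  Hence
`C^∞(M, ℝ) → U(1)^M` is a quotient map for the D-topologies, and it is a covering with deck group
`ℤ`, since `M` is connected and evaluation at a point separates the translates by multiples of `2π`.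
The total space is contracted by straight lines, so the fundamental group of `U(1)^M` is `ℤ` and the
higher homotopy groups vanish (`isDiffeologicalKZOne_circleMaps`).
-/

noncomputable section

/-! ### Lifting through coverings without local path-connectedness -/

section Lifting

open unitInterval

variable {E : Type*} {B : Type*} [TopologicalSpace E] [TopologicalSpace B] {p : E → B}

/-- A map on a simply connected space lifts through a covering map to a function that is continuous
along paths.  No local condition is imposed on the space, so the lift itself need not be
continuous. -/
theorem IsCoveringMap.exists_lift_continuous_along_paths (cov : IsCoveringMap p) {Z : Type*}
    [TopologicalSpace Z] [SimplyConnectedSpace Z] (g : C(Z, B)) (z₀ : Z) (e₀ : E)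
    (he : p e₀ = g z₀) :
    ∃ F : Z → E, F z₀ = e₀ ∧ (∀ z, p (F z) = g z) ∧ ∀ γ : C(I, Z), Continuous (F ∘ γ) := by
  have h0 : ∀ {z : Z} (P : Path z₀ z), (g.comp (P : C(I, Z))) 0 = p e₀ := fun P => by simp [he]
  let F : Z → E := fun z =>
    cov.liftPath (g.comp (PathConnectedSpace.somePath z₀ z : C(I, Z))) e₀ (h0 _) 1
  have hF : ∀ z, p (F z) = g z := fun z => by
    have := congrFun (cov.liftPath_lifts
      (g.comp (PathConnectedSpace.somePath z₀ z : C(I, Z))) e₀ (h0 _)) 1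
    simpa using this
  -- The value of the lift may be computed along any path and any lift of it.
  have key : ∀ {z : Z} {e : E} (P : Path z₀ z) (Q : Path e₀ e), (∀ t, p (Q t) = g (P t)) →
      F z = e := by
    intro z e P Q hPQ
    have h1 : F z = cov.liftPath (g.comp (P : C(I, Z))) e₀ (h0 P) 1 :=
      cov.liftPath_apply_one_eq_of_homotopicRel
        (ContinuousMap.HomotopicRel.comp_continuousMap
          (SimplyConnectedSpace.paths_homotopic (PathConnectedSpace.somePath z₀ z) P) g) e₀ _ _
    have h2 : (Q : I → E) = cov.liftPath (g.comp (P : C(I, Z))) e₀ (h0 P) :=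
      (cov.eq_liftPath_iff (h0 P)).2 ⟨Q.continuous, funext hPQ, Q.source⟩
    rw [h1, ← h2, Q.target]
  refine ⟨F, key (Path.refl z₀) (Path.refl e₀) fun _ => he, hF, fun γ => ?_⟩
  have h3 : (g.comp γ) 0 = p (F (γ 0)) := (hF _).symm
  suffices h : F ∘ γ = cov.liftPath (g.comp γ) (F (γ 0)) h3 by
    rw [h]; exact ContinuousMap.continuous _
  let Γ := cov.liftPath (g.comp γ) (F (γ 0)) h3
  have hΓ : ∀ t, p (Γ t) = g (γ t) := congrFun (cov.liftPath_lifts (g.comp γ) (F (γ 0)) h3)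
  have hΓ0 : Γ 0 = F (γ 0) := cov.liftPath_zero _ _ h3
  funext t
  let P₀ := PathConnectedSpace.somePath z₀ (γ 0)
  let Q₀ : Path e₀ (F (γ 0)) :=
    ⟨cov.liftPath (g.comp (P₀ : C(I, Z))) e₀ (h0 _), cov.liftPath_zero _ _ _, rfl⟩
  let P₁ : Path (γ 0) (γ t) := ⟨⟨fun s => γ (s * t), by fun_prop⟩, by simp, by simp⟩
  let Q₁ : Path (F (γ 0)) (Γ t) := ⟨⟨fun s => Γ (s * t), by fun_prop⟩, by simp [hΓ0], by simp⟩
  refine key (P₀.trans P₁) (Q₀.trans Q₁) fun s => ?_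
  simp only [Path.trans_apply]
  split_ifs
  · exact congrFun (cov.liftPath_lifts (g.comp (P₀ : C(I, Z))) e₀ (h0 _)) _
  · exact hΓ _

/-- On a locally path-connected space, a lift through a covering map is continuous as soon as it is
continuous along paths. -/
theorem IsCoveringMap.continuous_of_continuous_along_paths (cov : IsCoveringMap p) {W : Type*}
    [TopologicalSpace W] [LocallyPathConnectedSpace W] {f : W → E}
    (hpf : Continuous fun w => p (f w)) (hf : ∀ γ : C(I, W), Continuous (f ∘ γ)) :
    Continuous f := by
  refine continuous_iff_continuousAt.2 fun w₀ => ?_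
  obtain ⟨q, hq, hqp⟩ := cov.isLocalHomeomorph (f w₀)
  have hmem : p (f w₀) ∈ q.target := by rw [hqp]; exact q.map_source hq
  obtain ⟨U, ⟨hU, hUc⟩, hUs⟩ := (path_connected_basis w₀).mem_iff.1
    ((q.open_target.preimage hpf).mem_nhds hmem)
  have hev : (fun w => q.symm (p (f w))) =ᶠ[𝓝 w₀] f := by
    filter_upwards [hU] with w hw
    obtain ⟨γ, hγ⟩ := hUc.joinedIn _ (mem_of_mem_nhds hU) _ hw
    have h1 : (fun t => q.symm (p (f (γ t)))) = f ∘ γ := by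
      refine cov.eq_of_comp_eq ?_ (hf γ) ?_ 0 ?_
      · exact q.continuousOn_symm.comp_continuous (hpf.comp γ.continuous) fun t => hUs (hγ t)
      · funext t
        have := q.right_inv (hUs (hγ t))
        simp only [Function.comp_apply]
        rw [← hqp] at this
        exact this
      · simp only [Function.comp_apply, γ.source]
        rw [hqp, q.left_inv hq]
    simpa using congrFun h1 1
  exact ((q.continuousAt_symm hmem).comp (f := fun w => p (f w)) hpf.continuousAt).congr hev

end Lifting

/-! ### The loop space of a 2-connected space -/

section LoopSpace

open unitInterval

variable {X : Type*} [TopologicalSpace X]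

/-- A path-connected space without nontrivial loops at one point is simply connected. -/
theorem simplyConnectedSpace_of_fundamentalGroup [PathConnectedSpace X] (x₀ : X)
    (h : Subsingleton (FundamentalGroup X x₀)) : SimplyConnectedSpace X := by
  rw [simply_connected_iff_loops_nullhomotopic]
  refine ⟨inferInstance, fun x γ => ?_⟩
  let a := PathConnectedSpace.somePath x₀ x
  have h1 : Path.Homotopic.Quotient.mk ((a.trans γ).trans a.symm) =
      Path.Homotopic.Quotient.mk (Path.refl x₀) := @Subsingleton.elim _ h _ _
  rw [← Path.Homotopic.Quotient.eq]
  simp only [Path.Homotopic.Quotient.mk_trans, Path.Homotopic.Quotient.mk_symm,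
    Path.Homotopic.Quotient.mk_refl] at h1 ⊢
  have h2 := congrArg (fun q => (Path.Homotopic.Quotient.trans
    ((Path.Homotopic.Quotient.mk a).symm) q).trans (Path.Homotopic.Quotient.mk a)) h1
  simp only [Path.Homotopic.Quotient.trans_assoc, Path.Homotopic.Quotient.symm_trans,
    Path.Homotopic.Quotient.trans_refl] at h2
  rwa [← Path.Homotopic.Quotient.trans_assoc, Path.Homotopic.Quotient.symm_trans,
    Path.Homotopic.Quotient.refl_trans] at h2

/-- Homotopic paths are joined in the space of paths. -/
theorem Path.Homotopic.joined {x y : X} {p q : Path x y} (h : p.Homotopic q) : Joined p q := by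
  obtain ⟨F⟩ := h
  exact ⟨⟨⟨F.eval, Path.continuous_uncurry_iff.1 F.continuous⟩, F.eval_zero, F.eval_one⟩⟩

/-- One-dimensional generalized loops are loops. -/
def genLoopHomeomorphPath (N : Type*) [Unique N] (x : X) : GenLoop N X x ≃ₜ Path x x where
  toEquiv := genLoopEquivOfUnique N
  continuous_toFun := Path.continuous_uncurry_iff.1 <| by
    have h : Continuous fun q : GenLoop N X x × I => q.1 fun _ => q.2 := by fun_prop
    exact h
  continuous_invFun := by
    refine Continuous.subtype_mk (ContinuousMap.continuous_of_continuous_uncurry _ ?_) _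
    have h : Continuous fun q : Path x x × (N → I) => q.1 (q.2 default) := by fun_prop
    exact h

/-- The loop space of a simply connected space with vanishing second homotopy group is simply
connected. -/
theorem simplyConnectedSpace_loops [SimplyConnectedSpace X] (x₀ : X)
    (h : Subsingleton (π_ 2 X x₀)) : SimplyConnectedSpace (Path x₀ x₀) := by
  let N := {j : Fin 2 // j ≠ 0}
  have hN : Unique N := ⟨⟨⟨1, by decide⟩⟩, fun ⟨j, hj⟩ => by
    fin_cases j
    · exact absurd rfl hj
    · rfl⟩
  let e := genLoopHomeomorphPath N x₀
  have : PathConnectedSpace (Path x₀ x₀) :=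
    ⟨⟨Path.refl _⟩, fun p q => (SimplyConnectedSpace.paths_homotopic p q).joined⟩
  have : PathConnectedSpace (GenLoop N X x₀) :=
    e.symm.surjective.pathConnectedSpace e.symm.continuous
  have hs : Subsingleton (FundamentalGroup (GenLoop N X x₀) GenLoop.const) :=
    (homotopyGroupEquivFundamentalGroup (X := X) (x := x₀) (0 : Fin 2)).symm.injective.subsingleton
  have : SimplyConnectedSpace (GenLoop N X x₀) := simplyConnectedSpace_of_fundamentalGroup _ hs
  exact e.symm.toHomotopyEquiv.simplyConnectedSpace

end LoopSpace

/-! ### Continuous sections of a hermitean line bundle -/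

section Sections

variable {E : Type u₁} [NormedAddCommGroup E] [NormedSpace ℝ E] {H : Type u₂} [TopologicalSpace H]
  {I : ModelWithCorners ℝ E H} {X : Type u} [TopologicalSpace X] [ChartedSpace H X]

namespace HermitianLineBundle

/-- The coefficient of a vector with respect to a frame, as a linear form on the fibre.  It is
meaningful at the points of the domain of the frame. -/
def coef (L : HermitianLineBundle I X) (i : L.index) (x : X) : L.Fib x →ₗ[ℂ] ℂ :=
  (inner ℂ (L.frame i x) (L.frame i x))⁻¹ • (innerSL ℂ (L.frame i x)).toLinearMap

variable (L : HermitianLineBundle I X)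

theorem coef_smul_self {i : L.index} {x : X} (hx : x ∈ L.dom i) (a : ℂ) :
    L.coef i x (a • L.frame i x) = a := by
  have hne : inner ℂ (L.frame i x) (L.frame i x) ≠ 0 :=
    inner_self_ne_zero.2 (L.frame_ne_zero i x hx)
  have h : L.coef i x (a • L.frame i x) =
      (inner ℂ (L.frame i x) (L.frame i x))⁻¹ * inner ℂ (L.frame i x) (a • L.frame i x) := rfl
  rw [h, inner_smul_right, mul_left_comm, inv_mul_cancel₀ hne, mul_one]

theorem coef_smul_frame {i : L.index} {x : X} (hx : x ∈ L.dom i) (v : L.Fib x) :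
    L.coef i x v • L.frame i x = v := by
  obtain ⟨a, rfl⟩ := exists_smul (L.finrank_fib x) (L.frame_ne_zero i x hx) v
  rw [coef_smul_self L hx]

theorem coef_frame_mul {i j : L.index} {x : X} (hi : x ∈ L.dom i) (v : L.Fib x) :
    L.coef j x v = L.coef i x v * L.coef j x (L.frame i x) := by
  conv_lhs => rw [← L.coef_smul_frame hi v, map_smul, smul_eq_mul]

theorem contMDiffOn_coef_frame (i j : L.index) :
    ContMDiffOn I 𝓘(ℝ, ℂ) ∞ (fun x => L.coef j x (L.frame i x)) (L.dom i ∩ L.dom j) := by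
  obtain ⟨g, hg, hgf⟩ := L.transition i j
  exact hg.congr fun x hx => by rw [hgf x hx, L.coef_smul_self hx.2]

theorem norm_eq_coef {i : L.index} {x : X} (hx : x ∈ L.dom i) (v : L.Fib x) :
    ‖v‖ = ‖L.coef i x v‖ * ‖L.frame i x‖ := by
  conv_lhs => rw [← L.coef_smul_frame hx v, norm_smul]

theorem inner_eq_coef {i : L.index} {x : X} (hx : x ∈ L.dom i) (v v' : L.Fib x) :
    inner ℂ v v' =
      (starRingEnd ℂ) (L.coef i x v) * L.coef i x v' * ((‖L.frame i x‖ ^ 2 : ℝ) : ℂ) := by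
  conv_lhs => rw [← L.coef_smul_frame hx v, ← L.coef_smul_frame hx v', inner_smul_left,
    inner_smul_right, inner_self_eq_norm_sq_to_K]
  push_cast
  simp only [Complex.coe_algebraMap]
  ring

theorem continuousOn_norm_frame (i : L.index) :
    ContinuousOn (fun x => ‖L.frame i x‖) (L.dom i) :=
  (L.metric i).continuousOn.sqrt.congr fun _ _ => (Real.sqrt_sq (norm_nonneg _)).symm

/-- A family of vectors `v w` in the fibres over `y w` is continuous if its coefficients in the
local frames are. -/
def ContAlong {W : Type*} [TopologicalSpace W] (y : W → X) (v : ∀ w, L.Fib (y w)) : Prop :=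
  ∀ i, ContinuousOn (fun w => L.coef i (y w) (v w)) (y ⁻¹' (L.dom i))

variable {L} {W : Type*} [TopologicalSpace W] {y : W → X} {v v' : ∀ w, L.Fib (y w)}

theorem contAlong_of_local (hy : Continuous y)
    (h : ∀ w, ∃ i, y w ∈ L.dom i ∧ ContinuousAt (fun w => L.coef i (y w) (v w)) w) :
    L.ContAlong y v := by
  intro j w hw
  obtain ⟨i, hi, hc⟩ := h w
  have hop : IsOpen (y ⁻¹' (L.dom i ∩ L.dom j)) := ((L.dom i).2.inter (L.dom j).2).preimage hy
  have h1 : ContinuousAt (fun w => L.coef j (y w) (L.frame i (y w))) w :=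
    ((L.contMDiffOn_coef_frame i j).continuousOn.comp hy.continuousOn
      fun _ h => h).continuousAt (hop.mem_nhds ⟨hi, hw⟩)
  refine ((hc.mul h1).congr ?_).continuousWithinAt
  filter_upwards [((L.dom i).2.preimage hy).mem_nhds hi] with z hz
  exact (L.coef_frame_mul hz (v z)).symm

theorem ContAlong.continuousAt (hv : L.ContAlong y v) (hy : Continuous y) {i : L.index} {w : W}
    (hw : y w ∈ L.dom i) : ContinuousAt (fun w => L.coef i (y w) (v w)) w :=
  (hv i).continuousAt (((L.dom i).2.preimage hy).mem_nhds hw)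

theorem continuousAt_norm_frame (hy : Continuous y) {i : L.index} {w : W}
    (hw : y w ∈ L.dom i) : ContinuousAt (fun w => ‖L.frame i (y w)‖) w :=
  ((L.continuousOn_norm_frame i).continuousAt ((L.dom i).2.mem_nhds hw)).comp
    (f := y) hy.continuousAt

theorem ContAlong.norm (hv : L.ContAlong y v) (hy : Continuous y) :
    Continuous fun w => ‖v w‖ := by
  refine continuous_iff_continuousAt.2 fun w => ?_
  obtain ⟨i, hi⟩ := L.exists_mem_dom (y w)
  refine ((hv.continuousAt hy hi).norm.mul (continuousAt_norm_frame hy hi)).congr ?_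
  filter_upwards [((L.dom i).2.preimage hy).mem_nhds hi] with z hz
  exact (L.norm_eq_coef hz (v z)).symm

theorem ContAlong.inner (hv : L.ContAlong y v) (hv' : L.ContAlong y v') (hy : Continuous y) :
    Continuous fun w => inner ℂ (v w) (v' w) := by
  refine continuous_iff_continuousAt.2 fun w => ?_
  obtain ⟨i, hi⟩ := L.exists_mem_dom (y w)
  refine (((Complex.continuous_conj.continuousAt.comp (hv.continuousAt hy hi)).mul
    (hv'.continuousAt hy hi)).mul (Complex.continuous_ofReal.continuousAt.comp
      ((continuousAt_norm_frame hy hi).pow 2))).congr ?_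
  filter_upwards [((L.dom i).2.preimage hy).mem_nhds hi] with z hz
  exact (L.inner_eq_coef hz (v z) (v' z)).symm

theorem ContAlong.smul (hv : L.ContAlong y v) {a : W → ℂ} (ha : Continuous a) :
    L.ContAlong y fun w => a w • v w := fun i =>
  (ha.continuousOn.mul (hv i)).congr fun w _ => by
    rw [map_smul, smul_eq_mul, Pi.mul_apply]

/-! ### Discrete parallel transport -/

variable (ρ : PartitionOfUnity L.index X)

/-- The embedding of the fibres into `ℂ ^ index` given by a partition of unity subordinate to the
bundle atlas. -/
def emb (x : X) (v : L.Fib x) : L.index → ℂ := fun i => ρ i x * L.coef i x v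

/-- A linear map from `ℂ ^ index` to the fibre at `x`, which is a positive multiple of a left
inverse of the embedding `emb ρ x`. -/
def proj (x : X) (u : L.index → ℂ) : L.Fib x :=
  ∑ i ∈ ρ.finsupport x, ((ρ i x : ℂ) * u i) • L.frame i x

/-- The normalized projection of a vector of `ℂ ^ index` to the unit circle in the fibre at `x`. -/
def unitProj (x : X) (u : L.index → ℂ) : L.Fib x := ((‖proj ρ x u‖⁻¹ : ℝ) : ℂ) • proj ρ x u

theorem emb_smul (x : X) (a : ℂ) (v : L.Fib x) : emb ρ x (a • v) = a • emb ρ x v := by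
  funext i
  simp only [emb, map_smul, smul_eq_mul, Pi.smul_apply]
  ring

theorem proj_smul (x : X) (a : ℂ) (u : L.index → ℂ) : proj ρ x (a • u) = a • proj ρ x u := by
  simp only [proj, Finset.smul_sum, Pi.smul_apply, smul_eq_mul, smul_smul]
  exact Finset.sum_congr rfl fun i _ => by ring_nf

theorem norm_unitProj {x : X} {u : L.index → ℂ} (h : proj ρ x u ≠ 0) : ‖unitProj ρ x u‖ = 1 := by
  rw [unitProj, norm_smul, Complex.norm_real, norm_inv, norm_norm,
    inv_mul_cancel₀ (norm_ne_zero_iff.2 h)]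

variable {ρ} (hρ : ρ.IsSubordinate fun i => (L.dom i : Set X))

include hρ in
theorem mem_dom_of_ne_zero {i : L.index} {x : X} (h : ρ i x ≠ 0) : x ∈ L.dom i :=
  hρ i (subset_tsupport _ h)

include hρ in
theorem exists_proj_emb (x : X) :
    ∃ r : ℝ, 0 < r ∧ ∀ v : L.Fib x, proj ρ x (emb ρ x v) = (r : ℂ) • v := by
  refine ⟨∑ i ∈ ρ.finsupport x, ρ i x ^ 2, ?_, fun v => ?_⟩
  · obtain ⟨i, hi⟩ := ρ.exists_pos (Set.mem_univ x)
    exact Finset.sum_pos' (fun i _ => sq_nonneg _)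
      ⟨i, (ρ.mem_finsupport x).2 hi.ne', by positivity⟩
  · rw [proj, Complex.ofReal_sum, Finset.sum_smul]
    refine Finset.sum_congr rfl fun i hi => ?_
    have hx := mem_dom_of_ne_zero hρ ((ρ.mem_finsupport x).1 hi)
    conv_rhs => rw [← L.coef_smul_frame hx v, smul_smul]
    congr 1
    simp only [emb]
    push_cast
    ring

include hρ in
theorem proj_emb_ne_zero (x : X) {v : L.Fib x} (hv : v ≠ 0) : proj ρ x (emb ρ x v) ≠ 0 := by
  obtain ⟨r, hr, h⟩ := exists_proj_emb hρ x
  rw [h]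
  exact smul_ne_zero (Complex.ofReal_ne_zero.2 hr.ne') hv

include hρ in
theorem unitProj_emb (x : X) {v : L.Fib x} (hv : ‖v‖ = 1) : unitProj ρ x (emb ρ x v) = v := by
  obtain ⟨r, hr, h⟩ := exists_proj_emb hρ x
  rw [unitProj, h, norm_smul, hv, mul_one, Complex.norm_real, Real.norm_of_nonneg hr.le, smul_smul,
    ← Complex.ofReal_mul, inv_mul_cancel₀ hr.ne', Complex.ofReal_one, one_smul]

include hρ in
theorem continuous_emb (hy : Continuous y) (hv : L.ContAlong y v) :
    Continuous fun w => emb ρ (y w) (v w) := by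
  refine continuous_pi fun i => continuous_iff_continuousAt.2 fun w => ?_
  by_cases hw : y w ∈ tsupport (ρ i)
  · exact (Complex.continuous_ofReal.comp ((ρ i).continuous.comp hy)).continuousAt.mul
      (hv.continuousAt hy (hρ i hw))
  · refine (continuousAt_const (y := (0 : ℂ))).congr ?_
    filter_upwards [((isClosed_tsupport _).isOpen_compl.preimage hy).mem_nhds hw] with z hz
    simp only [emb]
    rw [image_eq_zero_of_notMem_tsupport hz, Complex.ofReal_zero, zero_mul]

include hρ in
theorem contAlong_proj (hy : Continuous y) {u : W → L.index → ℂ} (hu : Continuous u) :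
    L.ContAlong y fun w => proj ρ (y w) (u w) := by
  refine contAlong_of_local hy fun w => ?_
  obtain ⟨j, hj⟩ := L.exists_mem_dom (y w)
  refine ⟨j, hj, ?_⟩
  have h1 : ContinuousAt (fun z => ∑ i ∈ ρ.fintsupport (y w),
      ((ρ i (y z) : ℂ) * u z i) * L.coef j (y z) (L.frame i (y z))) w := by
    refine tendsto_finsetSum _ fun i hi => ?_
    have hi' : y w ∈ L.dom i := hρ i ((ρ.mem_fintsupport_iff _ i).1 hi)
    have hop : IsOpen (y ⁻¹' (L.dom i ∩ L.dom j)) := ((L.dom i).2.inter (L.dom j).2).preimage hy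
    have h2 : ContinuousAt (fun w => L.coef j (y w) (L.frame i (y w))) w :=
      ((L.contMDiffOn_coef_frame i j).continuousOn.comp hy.continuousOn
        fun _ h => h).continuousAt (hop.mem_nhds ⟨hi', hj⟩)
    exact ((Complex.continuous_ofReal.comp ((ρ i).continuous.comp hy)).mul
      ((continuous_apply i).comp hu)).continuousAt.mul h2
  refine h1.congr ?_
  filter_upwards [hy.continuousAt.eventually (ρ.eventually_finsupport_subset (y w))] with z hz
  rw [proj, map_sum, ← Finset.sum_subset hz]
  · simp only [map_smul, smul_eq_mul]
  · intro i _ hi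
    have h0 : ρ i (y z) = 0 := by
      by_contra h
      exact hi ((ρ.mem_finsupport _).2 h)
    rw [h0, Complex.ofReal_zero, zero_mul, zero_mul]

include hρ in
theorem contAlong_unitProj (hy : Continuous y) {u : W → L.index → ℂ} (hu : Continuous u)
    (h : ∀ w, proj ρ (y w) (u w) ≠ 0) : L.ContAlong y fun w => unitProj ρ (y w) (u w) := by
  have h1 := contAlong_proj hρ hy hu
  exact h1.smul (Complex.continuous_ofReal.comp
    ((h1.norm hy).inv₀ fun w => norm_ne_zero_iff.2 (h w)))

end HermitianLineBundle

end Sections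

section Transport

open unitInterval

variable {E : Type u₁} [NormedAddCommGroup E] [NormedSpace ℝ E] {H : Type u₂} [TopologicalSpace H]
  {J : ModelWithCorners ℝ E H} {X : Type u} [TopologicalSpace X] [ChartedSpace H X]
  {L : HermitianLineBundle J X} {W : Type*} [TopologicalSpace W]

namespace HermitianLineBundle

/-- A choice of unit vectors in the fibres, without any continuity. -/
def unitVec (L : HermitianLineBundle J X) (x : X) : L.Fib x :=
  (exists_unit (L.finrank_fib x)).choose

theorem norm_unitVec (x : X) : ‖L.unitVec x‖ = 1 := (exists_unit (L.finrank_fib x)).choose_spec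

variable (ρ : PartitionOfUnity L.index X)

/-- The norm of the connecting map `L_x ⟶ L_y` defined by a partition of unity. -/
def connNorm (x y : X) : ℝ := ‖proj ρ y (emb ρ x (L.unitVec x))‖

theorem norm_proj_emb (x y : X) (v : L.Fib x) : ‖proj ρ y (emb ρ x v)‖ = ‖v‖ * connNorm ρ x y := by
  have h0 : L.unitVec x ≠ 0 := fun h => by simpa [h] using norm_unitVec (L := L) x
  obtain ⟨a, rfl⟩ := exists_smul (L.finrank_fib x) h0 v
  rw [emb_smul, proj_smul, norm_smul, norm_smul, norm_unitVec, mul_one, connNorm]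

/-- A lower bound for the lengths of the time intervals over which the connecting maps along a path
may vanish.  Unlike the optimal such bound, this infimum of a positive function is continuous in the
path. -/
def stepBound (γ : C(I, X)) : ℝ :=
  sInf ((fun s : I × I => dist s.1 s.2 + connNorm ρ (γ s.1) (γ s.2)) '' Set.univ)

theorem stepBound_le (γ : C(I, X)) (s t : I) :
    stepBound ρ γ ≤ dist s t + connNorm ρ (γ s) (γ t) := by
  refine csInf_le ⟨0, ?_⟩ ⟨(s, t), Set.mem_univ _, rfl⟩
  rintro _ ⟨q, -, rfl⟩
  exact add_nonneg dist_nonneg (norm_nonneg _)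

variable {ρ} (hρ : ρ.IsSubordinate fun i => (L.dom i : Set X))
include hρ

theorem connNorm_self_pos (x : X) : 0 < connNorm ρ x x :=
  norm_pos_iff.2 (proj_emb_ne_zero hρ x fun h => by simpa [h] using norm_unitVec (L := L) x)

theorem continuous_connNorm : Continuous fun q : X × X => connNorm ρ q.1 q.2 := by
  refine continuous_iff_continuousAt.2 fun q => ?_
  obtain ⟨i, hi⟩ := L.exists_mem_dom q.1
  have hop : IsOpen (Prod.fst ⁻¹' (L.dom i : Set X) : Set (X × X)) :=
    (L.dom i).2.preimage continuous_fst
  suffices h : ContinuousOn (fun q : X × X => connNorm ρ q.1 q.2)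
      (Prod.fst ⁻¹' (L.dom i : Set X)) from h.continuousAt (hop.mem_nhds hi)
  rw [continuousOn_iff_continuous_domRestrict]
  let W := (Prod.fst ⁻¹' (L.dom i : Set X) : Set (X × X))
  have hy1 : Continuous fun w : W => w.1.1 := by fun_prop
  have hy2 : Continuous fun w : W => w.1.2 := by fun_prop
  have hf : L.ContAlong (fun w : W => w.1.1) fun w => L.frame i w.1.1 :=
    contAlong_of_local hy1 fun w => ⟨i, w.2, by
      refine (continuousAt_const (y := (1 : ℂ))).congr (Filter.Eventually.of_forall fun z => ?_)
      have := L.coef_smul_self z.2 1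
      rw [one_smul] at this
      exact this.symm⟩
  have h1 := (contAlong_proj hρ hy2 (continuous_emb hρ hy1 hf)).norm hy2
  have h2 := hf.norm hy1
  refine (h1.div h2 fun w => norm_ne_zero_iff.2 (L.frame_ne_zero i _ w.2)).congr fun w => ?_
  have h3 : ‖L.frame i w.1.1‖ ≠ 0 := norm_ne_zero_iff.2 (L.frame_ne_zero i _ w.2)
  have h4 := norm_proj_emb ρ w.1.1 w.1.2 (L.frame i w.1.1)
  exact (congrArg (· / ‖L.frame i w.1.1‖) h4).trans (mul_div_cancel_left₀ _ h3)

theorem stepBound_pos (γ : C(I, X)) : 0 < stepBound ρ γ := by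
  have hc : Continuous fun s : I × I => dist s.1 s.2 + connNorm ρ (γ s.1) (γ s.2) :=
    continuous_dist.add ((continuous_connNorm hρ).comp (by fun_prop :
      Continuous fun s : I × I => (γ s.1, γ s.2)))
  obtain ⟨⟨s, t⟩, -, hst⟩ := isCompact_univ.exists_sInf_image_eq Set.univ_nonempty hc.continuousOn
  rw [stepBound, hst]
  by_cases h : s = t
  · subst h
    exact add_pos_of_nonneg_of_pos dist_nonneg (connNorm_self_pos hρ _)
  · exact add_pos_of_pos_of_nonneg (dist_pos.2 h) (norm_nonneg _)

theorem continuous_stepBound {Γ : W → C(I, X)} (hΓ : Continuous fun q : W × I => Γ q.1 q.2) :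
    Continuous fun w => stepBound ρ (Γ w) := by
  refine isCompact_univ.continuous_sInf (f := fun w (s : I × I) =>
    dist s.1 s.2 + connNorm ρ (Γ w s.1) (Γ w s.2)) ?_
  have h1 : Continuous fun q : W × (I × I) => Γ q.1 q.2.1 :=
    hΓ.comp (continuous_fst.prodMk (continuous_fst.comp continuous_snd))
  have h2 : Continuous fun q : W × (I × I) => Γ q.1 q.2.2 :=
    hΓ.comp (continuous_fst.prodMk (continuous_snd.comp continuous_snd))
  exact ((continuous_fst.comp continuous_snd).dist (continuous_snd.comp continuous_snd)).add
    ((continuous_connNorm hρ).comp (h1.prodMk h2))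

omit hρ
variable (ρ)

/-- The times at which the discrete transport along a path stops: multiples of half the step
bound. -/
def stepTime (γ : C(I, X)) (k : ℕ) : I :=
  Set.projIcc 0 1 zero_le_one (k * (stepBound ρ γ / 2))

/-- Discrete parallel transport of a unit vector along a path, in terms of the embedding of the
fibres: in each step the vector is projected to the next fibre and normalized. -/
def transportSeq {x₀ : X} (v₀ : L.Fib x₀) (γ : C(I, X)) : ℕ → L.index → ℂ
  | 0 => emb ρ x₀ v₀
  | k + 1 => emb ρ (γ (stepTime ρ γ (k + 1)))
      (unitProj ρ (γ (stepTime ρ γ (k + 1))) (transportSeq v₀ γ k))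

/-- The end point of discrete parallel transport along a path. -/
def transport {x₀ x : X} (v₀ : L.Fib x₀) (γ : Path x₀ x) : L.Fib x :=
  unitProj ρ x (transportSeq ρ v₀ (γ : C(I, X)) ⌈2 / stepBound ρ (γ : C(I, X))⌉₊)

variable {ρ}
include hρ

theorem stepTime_eq_one {γ : C(I, X)} {k : ℕ} (hk : 2 / stepBound ρ γ ≤ k) :
    stepTime ρ γ k = 1 := by
  refine Set.projIcc_of_right_le _ ?_
  rw [div_le_iff₀ (stepBound_pos hρ γ)] at hk
  linarith

theorem dist_stepTime_lt (γ : C(I, X)) (k : ℕ) :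
    dist (stepTime ρ γ k) (stepTime ρ γ (k + 1)) < stepBound ρ γ := by
  have hpos := stepBound_pos hρ γ
  have h := Set.abs_projIcc_sub_projIcc (a := (0 : ℝ)) (b := 1) (h := zero_le_one)
    (c := k * (stepBound ρ γ / 2)) (d := (k + 1 : ℕ) * (stepBound ρ γ / 2))
  have h2 : |(k * (stepBound ρ γ / 2) : ℝ) - (k + 1 : ℕ) * (stepBound ρ γ / 2)| =
      stepBound ρ γ / 2 := by
    rw [abs_sub_comm, abs_of_nonneg] <;> push_cast <;> linarith
  rw [h2] at h
  rw [Subtype.dist_eq, Real.dist_eq]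
  exact h.trans_lt (by linarith)

variable {x₀ : X} {v₀ : L.Fib x₀} (hv₀ : ‖v₀‖ = 1)
include hv₀

theorem exists_transportSeq_eq {γ : C(I, X)} (hγ : γ 0 = x₀) (k : ℕ) :
    (∃ v : L.Fib (γ (stepTime ρ γ k)), ‖v‖ = 1 ∧ transportSeq ρ v₀ γ k = emb ρ _ v) ∧
      proj ρ (γ (stepTime ρ γ (k + 1))) (transportSeq ρ v₀ γ k) ≠ 0 := by
  have step : ∀ k, (∃ v : L.Fib (γ (stepTime ρ γ k)), ‖v‖ = 1 ∧
      transportSeq ρ v₀ γ k = emb ρ _ v) →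
      proj ρ (γ (stepTime ρ γ (k + 1))) (transportSeq ρ v₀ γ k) ≠ 0 := by
    rintro k ⟨v, hv, h⟩
    rw [h, ← norm_pos_iff, norm_proj_emb, hv, one_mul]
    have h1 := stepBound_le ρ γ (stepTime ρ γ k) (stepTime ρ γ (k + 1))
    have h2 := dist_stepTime_lt hρ γ k
    linarith
  have main : ∀ k, ∃ v : L.Fib (γ (stepTime ρ γ k)), ‖v‖ = 1 ∧
      transportSeq ρ v₀ γ k = emb ρ _ v := by
    intro k
    induction k with
    | zero =>
      have h0 : γ (stepTime ρ γ 0) = x₀ := by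
        rw [← hγ, stepTime, Set.projIcc_of_le_left _ (by simp)]
        rfl
      subst h0
      exact ⟨v₀, hv₀, rfl⟩
    | succ k ih => exact ⟨_, norm_unitProj ρ (step k ih), rfl⟩
  exact ⟨main k, step k (main k)⟩

theorem transport_eq {x : X} (γ : Path x₀ x) {k : ℕ}
    (hk : 2 / stepBound ρ (γ : C(I, X)) ≤ k) :
    proj ρ x (transportSeq ρ v₀ (γ : C(I, X)) k) ≠ 0 ∧
      transport ρ v₀ γ = unitProj ρ x (transportSeq ρ v₀ (γ : C(I, X)) k) := by
  have hend : ∀ k : ℕ, 2 / stepBound ρ (γ : C(I, X)) ≤ k →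
      (γ : C(I, X)) (stepTime ρ (γ : C(I, X)) k) = x := fun k hk => by
    rw [stepTime_eq_one hρ hk]; exact γ.target
  have hval : ∀ k : ℕ, 2 / stepBound ρ (γ : C(I, X)) ≤ k → ∃ v : L.Fib x, ‖v‖ = 1 ∧
      transportSeq ρ v₀ (γ : C(I, X)) k = emb ρ x v := by
    intro k hk
    have h := (exists_transportSeq_eq hρ hv₀ γ.source k).1
    have hx : γ.toContinuousMap (stepTime ρ γ.toContinuousMap k) = x := hend k hk
    rwa [hx] at h
  refine ⟨?_, ?_⟩
  · obtain ⟨v, hv, h⟩ := hval k hk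
    rw [h]
    exact proj_emb_ne_zero hρ x fun h => by simp [h] at hv
  · have hN := Nat.ceil_le.2 hk
    rw [transport]
    induction k, hN using Nat.le_induction with
    | base => rfl
    | succ k hle ih =>
      have hk' : 2 / stepBound ρ (γ : C(I, X)) ≤ k := Nat.ceil_le.1 hle
      obtain ⟨v, hv, h⟩ := hval k hk'
      rw [ih hk', transportSeq, hend (k + 1) (hk'.trans (by push_cast; linarith)), h,
        unitProj_emb hρ x hv, unitProj_emb hρ x hv]

theorem norm_transport {x : X} (γ : Path x₀ x) : ‖transport ρ v₀ γ‖ = 1 := by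
  obtain ⟨h1, h2⟩ := transport_eq hρ hv₀ γ (Nat.le_ceil _)
  rw [h2, norm_unitProj ρ h1]

/-- Discrete parallel transport is continuous in the path. -/
theorem contAlong_transport {y : W → X} (hy : Continuous y) {Γ : ∀ w, Path x₀ (y w)}
    (hΓ : Continuous fun q : W × I => Γ q.1 q.2) :
    L.ContAlong y fun w => transport ρ v₀ (Γ w) := by
  have hδ : Continuous fun w => stepBound ρ (Γ w : C(I, X)) := continuous_stepBound hρ hΓ
  have ht : ∀ k, Continuous fun w => Γ w (stepTime ρ (Γ w : C(I, X)) k) := fun k => by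
    have h : Continuous fun w => stepTime ρ (Γ w : C(I, X)) k :=
      continuous_projIcc.comp (continuous_const.mul (hδ.div_const 2))
    exact hΓ.comp (continuous_id.prodMk h)
  have hu : ∀ k, Continuous fun w => transportSeq ρ v₀ (Γ w : C(I, X)) k := by
    intro k
    induction k with
    | zero => exact continuous_const
    | succ k ih =>
      exact continuous_emb hρ (ht (k + 1)) (contAlong_unitProj hρ (ht (k + 1)) ih fun w =>
        (exists_transportSeq_eq hρ hv₀ (Γ w).source k).2)
  refine contAlong_of_local hy fun w₀ => ?_
  obtain ⟨i, hi⟩ := L.exists_mem_dom (y w₀)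
  refine ⟨i, hi, ?_⟩
  -- Near `w₀`, a fixed number of steps suffices.
  have hpos := stepBound_pos hρ (Γ w₀ : C(I, X))
  let U : Set W := {w | stepBound ρ (Γ w₀ : C(I, X)) / 2 < stepBound ρ (Γ w : C(I, X))}
  have hU : IsOpen U := isOpen_lt continuous_const hδ
  have hw₀ : w₀ ∈ U := half_lt_self hpos
  let k := ⌈4 / stepBound ρ (Γ w₀ : C(I, X))⌉₊
  have hk : ∀ w ∈ U, 2 / stepBound ρ (Γ w : C(I, X)) ≤ k := fun w hw => by
    refine le_trans ?_ (Nat.le_ceil _)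
    rw [div_le_div_iff₀ (stepBound_pos hρ _) hpos]
    have : stepBound ρ (Γ w₀ : C(I, X)) / 2 < stepBound ρ (Γ w : C(I, X)) := hw
    linarith
  have h1 : L.ContAlong (fun w : U => y w) fun w =>
      unitProj ρ (y w) (transportSeq ρ v₀ (Γ w : C(I, X)) k) :=
    contAlong_unitProj hρ (by fun_prop) ((hu k).comp continuous_subtype_val) fun w =>
      (transport_eq hρ hv₀ (Γ w) (hk w w.2)).1
  have h2 := h1.continuousAt (by fun_prop) (w := ⟨w₀, hw₀⟩) hi
  refine (hU.isOpenEmbedding_subtypeVal.continuousAt_iff (x := ⟨w₀, hw₀⟩)).1 (h2.congr ?_)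
  refine Filter.Eventually.of_forall fun w => ?_
  simp only [Function.comp_apply]
  rw [(transport_eq hρ hv₀ (Γ w) (hk w w.2)).2]

end HermitianLineBundle

end Transport

/-! ### Phases of transport along loops -/

section Phase

open unitInterval

variable {E : Type u₁} [NormedAddCommGroup E] [NormedSpace ℝ E] {H : Type u₂} [TopologicalSpace H]
  {J : ModelWithCorners ℝ E H} {X : Type u} [TopologicalSpace X] [ChartedSpace H X]
  {L : HermitianLineBundle J X} {W : Type*} [TopologicalSpace W]

instance unitInterval.locallyPathConnectedSpace : LocallyPathConnectedSpace I :=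
  (isQuotientMap_projIcc (h := zero_le_one' ℝ)).locallyPathConnectedSpace

/-- The point `t / 2` of the unit interval. -/
def unitInterval.halve (t : I) : I := ⟨t / 2, by linarith [t.2.1], by linarith [t.2.2]⟩

theorem unitInterval.continuous_halve : Continuous unitInterval.halve :=
  Continuous.subtype_mk (continuous_subtype_val.div_const 2) _

theorem unitInterval.symm_halve_one : σ (halve 1) = halve 1 := by
  ext; simp [halve]; norm_num

/-- The first half of a loop. -/
def Path.firstHalf {x₀ : X} (ℓ : Path x₀ x₀) : Path x₀ (ℓ (unitInterval.halve 1)) where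
  toFun t := ℓ (unitInterval.halve t)
  continuous_toFun := ℓ.continuous.comp unitInterval.continuous_halve
  source' := by
    have : unitInterval.halve 0 = 0 := by ext; simp [unitInterval.halve]
    rw [this, ℓ.source]
  target' := rfl

/-- The second half of a loop, reversed. -/
def Path.secondHalf {x₀ : X} (ℓ : Path x₀ x₀) : Path x₀ (ℓ (unitInterval.halve 1)) where
  toFun t := ℓ (σ (unitInterval.halve t))
  continuous_toFun :=
    ℓ.continuous.comp (unitInterval.continuous_symm.comp unitInterval.continuous_halve)
  source' := by
    have : unitInterval.halve 0 = 0 := by ext; simp [unitInterval.halve]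
    rw [this, symm_zero, ℓ.target]
  target' := congrArg ℓ unitInterval.symm_halve_one

theorem Path.trans_symm_halve {x₀ x : X} (γ γ' : Path x₀ x) (t : I) :
    γ.trans γ'.symm (unitInterval.halve t) = γ t := by
  rw [Path.trans_apply, dif_pos (by simp only [unitInterval.halve]; linarith [t.2.2])]
  congr 1
  ext
  simp only [unitInterval.halve]
  ring

theorem Path.trans_symm_symm_halve {x₀ x : X} (γ γ' : Path x₀ x) (t : I) :
    γ.trans γ'.symm (σ (unitInterval.halve t)) = γ' t := by
  have h := Path.trans_symm_halve γ' γ t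
  have h2 : γ.trans γ'.symm = (γ'.trans γ.symm).symm := by rw [Path.trans_symm, Path.symm_symm]
  rw [h2]
  change (γ'.trans γ.symm) (σ (σ (unitInterval.halve t))) = _
  rw [unitInterval.symm_symm, h]

namespace HermitianLineBundle

theorem norm_inner_of_unit {x : X} {v v' : L.Fib x} (hv : ‖v‖ = 1) (hv' : ‖v'‖ = 1) :
    ‖inner ℂ v' v‖ = 1 := by
  obtain ⟨a, rfl⟩ := exists_smul (L.finrank_fib x) (norm_ne_zero_iff.1 (hv'.trans_ne one_ne_zero)) v
  rw [norm_smul, hv', mul_one] at hv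
  rw [inner_smul_right, inner_self_eq_norm_sq_to_K, hv']
  simp [hv]

theorem inner_smul_of_unit {x : X} (v : L.Fib x) {v' : L.Fib x} (hv' : ‖v'‖ = 1) :
    inner ℂ v' v • v' = v := by
  obtain ⟨a, rfl⟩ := exists_smul (L.finrank_fib x) (norm_ne_zero_iff.1 (hv'.trans_ne one_ne_zero)) v
  rw [inner_smul_right, inner_self_eq_norm_sq_to_K, hv']
  simp

variable {ρ : PartitionOfUnity L.index X} (hρ : ρ.IsSubordinate fun i => (L.dom i : Set X))
  {x₀ : X} {v₀ : L.Fib x₀} (hv₀ : ‖v₀‖ = 1)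

/-- The difference of the transports along two paths with the same end points. -/
def phase {x : X} (γ γ' : Path x₀ x) : Circle :=
  ⟨inner ℂ (transport ρ v₀ γ') (transport ρ v₀ γ), mem_sphere_zero_iff_norm.2
    (norm_inner_of_unit (norm_transport hρ hv₀ γ) (norm_transport hρ hv₀ γ'))⟩

theorem transport_eq_phase_smul {x : X} (γ γ' : Path x₀ x) :
    transport ρ v₀ γ = (phase hρ hv₀ γ γ' : ℂ) • transport ρ v₀ γ' :=
  (inner_smul_of_unit _ (norm_transport hρ hv₀ γ')).symm

theorem phase_self {x : X} (γ : Path x₀ x) : phase hρ hv₀ γ γ = 1 := by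
  ext
  change inner ℂ (transport ρ v₀ γ) (transport ρ v₀ γ) = 1
  rw [inner_self_eq_norm_sq_to_K, norm_transport hρ hv₀]
  simp

theorem phase_mul {x : X} (γ γ' γ'' : Path x₀ x) :
    phase hρ hv₀ γ γ' * phase hρ hv₀ γ' γ'' = phase hρ hv₀ γ γ'' := by
  have h1 := transport_eq_phase_smul hρ hv₀ γ γ'
  rw [transport_eq_phase_smul hρ hv₀ γ' γ'', transport_eq_phase_smul hρ hv₀ γ γ'', smul_smul] at h1
  have h0 : transport ρ v₀ γ'' ≠ 0 :=
    norm_ne_zero_iff.1 ((norm_transport hρ hv₀ γ'').trans_ne one_ne_zero)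
  ext
  exact (smul_left_injective ℂ h0 h1).symm

theorem continuous_phase {y : W → X} (hy : Continuous y) {Γ Γ' : ∀ w, Path x₀ (y w)}
    (hΓ : Continuous fun q : W × I => Γ q.1 q.2) (hΓ' : Continuous fun q : W × I => Γ' q.1 q.2) :
    Continuous fun w => phase hρ hv₀ (Γ w) (Γ' w) :=
  Continuous.subtype_mk ((contAlong_transport hρ hv₀ hy hΓ').inner
    (contAlong_transport hρ hv₀ hy hΓ) hy) _

theorem phase_congr {x x' : X} {γ₁ γ₂ : Path x₀ x} {γ₁' γ₂' : Path x₀ x'}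
    (h₁ : ∀ t, γ₁ t = γ₁' t) (h₂ : ∀ t, γ₂ t = γ₂' t) :
    phase hρ hv₀ γ₁ γ₂ = phase hρ hv₀ γ₁' γ₂' := by
  have hx : x = x' := by rw [← γ₁.target, ← γ₁'.target, h₁]
  subst hx
  rw [Path.ext (funext h₁), Path.ext (funext h₂)]

theorem phase_halves {x : X} (γ γ' : Path x₀ x) :
    phase hρ hv₀ (γ.trans γ'.symm).firstHalf (γ.trans γ'.symm).secondHalf = phase hρ hv₀ γ γ' :=
  phase_congr hρ hv₀ (Path.trans_symm_halve γ γ') (Path.trans_symm_symm_halve γ γ')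

/-- On a 2-connected space, the phases of loops have real logarithms that are continuous along paths
of loops. -/
theorem exists_log_phase [SimplyConnectedSpace X] (hπ : Subsingleton (π_ 2 X x₀)) :
    ∃ Θ : Path x₀ x₀ → ℝ, Θ (Path.refl x₀) = 0 ∧
      (∀ ℓ, Circle.exp (Θ ℓ) = phase hρ hv₀ ℓ.firstHalf ℓ.secondHalf) ∧
      ∀ γ : C(I, Path x₀ x₀), Continuous (Θ ∘ γ) := by
  have := simplyConnectedSpace_loops x₀ hπ
  have hev : Continuous fun q : Path x₀ x₀ × I => q.1 q.2 := by fun_prop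
  have hc : Continuous fun ℓ : Path x₀ x₀ => phase hρ hv₀ ℓ.firstHalf ℓ.secondHalf :=
    continuous_phase hρ hv₀ (y := fun ℓ : Path x₀ x₀ => ℓ (unitInterval.halve 1))
      (by fun_prop)
      (hev.comp (continuous_fst.prodMk (unitInterval.continuous_halve.comp continuous_snd)))
      (hev.comp (continuous_fst.prodMk
        (unitInterval.continuous_symm.comp (unitInterval.continuous_halve.comp continuous_snd))))
  have h1 : phase hρ hv₀ (Path.refl x₀).firstHalf (Path.refl x₀).secondHalf = 1 :=
    (phase_congr hρ hv₀ (γ₁' := Path.refl x₀) (γ₂' := Path.refl x₀) (fun _ => rfl)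
      fun _ => rfl).trans (phase_self hρ hv₀ _)
  exact Circle.isCoveringMap_exp.exists_lift_continuous_along_paths ⟨_, hc⟩ (Path.refl x₀) 0
    (Circle.exp_zero.trans h1.symm)

variable {Θ : Path x₀ x₀ → ℝ}
  (hΘ : ∀ ℓ, Circle.exp (Θ ℓ) = phase hρ hv₀ ℓ.firstHalf ℓ.secondHalf)
  (hΘc : ∀ γ : C(I, Path x₀ x₀), Continuous (Θ ∘ γ))

include hΘ in
theorem exp_log_phase {x : X} (γ γ' : Path x₀ x) :
    Circle.exp (Θ (γ.trans γ'.symm)) = phase hρ hv₀ γ γ' := by rw [hΘ, phase_halves]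

include hΘ hΘc in
/-- Continuity of `Θ` on the loop space itself is not available, but it follows for families over
locally path-connected spaces from the continuity along paths. -/
theorem continuous_log_phase [LocallyPathConnectedSpace W] {y : W → X} (hy : Continuous y)
    {Γ Γ' : ∀ w, Path x₀ (y w)} (hΓ : Continuous fun q : W × I => Γ q.1 q.2)
    (hΓ' : Continuous fun q : W × I => Γ' q.1 q.2) :
    Continuous fun w => Θ ((Γ w).trans (Γ' w).symm) := by
  have hφ : Continuous fun w => (Γ w).trans (Γ' w).symm :=
    Path.continuous_uncurry_iff.1 (Path.trans_continuous_family _ hΓ _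
      (Path.symm_continuous_family _ hΓ'))
  refine Circle.isCoveringMap_exp.continuous_of_continuous_along_paths ?_ fun γ =>
    hΘc ⟨fun t => (Γ (γ t)).trans (Γ' (γ t)).symm, hφ.comp γ.continuous⟩
  simp only [exp_log_phase hρ hv₀ hΘ]
  exact continuous_phase hρ hv₀ hy hΓ hΓ'

/-- A continuous real function on the unit interval with trivial exponential is constant. -/
theorem _root_.eq_of_circleExp_eq_one {f : I → ℝ} (hf : Continuous f)
    (h : ∀ t, Circle.exp (f t) = 1) : f 0 = f 1 :=
  Circle.isCoveringMap_exp.const_of_comp hf (fun s t => (h s).trans (h t).symm) 0 1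

include hΘ hΘc in
/-- The path `γ` shrinks to its starting point; along the shrinking, the phase is trivial. -/
theorem log_phase_self (h0 : Θ (Path.refl x₀) = 0) {x : X} (γ : Path x₀ x) :
    Θ (γ.trans γ.symm) = 0 := by
  let Γ : ∀ s : I, Path x₀ (γ s) := fun s =>
    ⟨⟨fun t => γ (s * t), by fun_prop⟩, by simp, by simp⟩
  have hΓ : Continuous fun q : I × I => Γ q.1 q.2 := by
    change Continuous fun q : I × I => γ (q.1 * q.2)
    fun_prop
  have h1 := eq_of_circleExp_eq_one
    (continuous_log_phase hρ hv₀ hΘ hΘc γ.continuous hΓ hΓ) fun t => by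
      rw [exp_log_phase hρ hv₀ hΘ, phase_self]
  have hzero : (Γ 0).trans (Γ 0).symm = (Path.refl x₀).cast (by simp) (by simp) := by
    ext t
    rw [Path.trans_apply]
    split_ifs <;> simp [Γ]
  have hone : (Γ 1).trans (Γ 1).symm = γ.trans γ.symm := by
    ext t
    rw [Path.trans_apply, Path.trans_apply]
    split_ifs <;> simp [Γ]
  rw [← hone, ← h1, hzero]
  exact h0

include hΘ hΘc in
/-- The logarithms of the phases satisfy the cocycle condition: the defect is constant as `γ` moves
to `γ'` with fixed end points, and it vanishes for `γ = γ'`. -/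
theorem log_phase_add [SimplyConnectedSpace X] (h0 : Θ (Path.refl x₀) = 0) {x : X}
    (γ γ' γ'' : Path x₀ x) :
    Θ (γ.trans γ'.symm) + Θ (γ'.trans γ''.symm) = Θ (γ.trans γ''.symm) := by
  obtain ⟨F⟩ := (SimplyConnectedSpace.paths_homotopic γ γ').joined
  have hc : ∀ δ : Path x₀ x, Continuous fun s => Θ ((F s).trans δ.symm) := fun δ =>
    continuous_log_phase (y := fun _ => x) hρ hv₀ hΘ hΘc continuous_const
      (Path.continuous_uncurry_iff.2 F.continuous) (by fun_prop)
  have h1 := eq_of_circleExp_eq_one (((hc γ').add continuous_const).sub (hc γ''))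
    (f := fun s => Θ ((F s).trans γ'.symm) + Θ (γ'.trans γ''.symm) - Θ ((F s).trans γ''.symm))
    fun s => by
      rw [Circle.exp_sub, Circle.exp_add, exp_log_phase hρ hv₀ hΘ, exp_log_phase hρ hv₀ hΘ,
        exp_log_phase hρ hv₀ hΘ, phase_mul, div_self']
  simp only [F.source, F.target, log_phase_self hρ hv₀ hΘ hΘc h0] at h1
  linarith

end HermitianLineBundle

/-! ### Local sections with logarithmic transition functions -/

/-- Around every point of a path-connected, strongly locally contractible space, paths from the base
point can be chosen continuously. -/
theorem exists_continuous_paths [PathConnectedSpace X] [StronglyLocallyContractibleSpace X]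
    (x₀ x : X) : ∃ V : TopologicalSpace.Opens X, x ∈ V ∧ ∃ γ : ∀ y : V, Path x₀ (y : X),
      Continuous fun q : V × I => γ q.1 q.2 := by
  obtain ⟨s, ⟨hs, hsc⟩, -⟩ := (contractible_basis x).mem_iff.1 (Filter.univ_mem (f := 𝓝 x))
  obtain ⟨p, ⟨F⟩⟩ := id_nullhomotopic s
  let V : TopologicalSpace.Opens X := ⟨interior s, isOpen_interior⟩
  have hV : ∀ y : V, (y : X) ∈ s := fun y => interior_subset y.2
  let α := PathConnectedSpace.somePath x₀ (p : X)
  let β : ∀ y : V, Path (p : X) (y : X) := fun y =>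
    { toFun := fun t => F (σ t, ⟨y, hV y⟩)
      continuous_toFun := by fun_prop
      source' := by simp
      target' := by simp }
  have hβ : Continuous fun q : V × I => β q.1 q.2 := by
    have hi : Continuous fun q : V × I => (⟨q.1, hV q.1⟩ : s) :=
      Continuous.subtype_mk (continuous_subtype_val.comp continuous_fst) _
    exact continuous_subtype_val.comp (F.continuous.comp
      ((unitInterval.continuous_symm.comp continuous_snd).prodMk hi))
  refine ⟨V, mem_interior_iff_mem_nhds.2 hs, fun y => α.trans (β y), ?_⟩
  exact Path.trans_continuous_family (fun _ => α) (by fun_prop) β hβ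

namespace HermitianLineBundle

/-- A hermitean line bundle on a 2-connected space has local continuous unit sections whose
transition functions have logarithms that satisfy the cocycle condition. -/
theorem exists_sections_log_transition [NormalSpace X] [ParacompactSpace X]
    [SimplyConnectedSpace X] [StronglyLocallyContractibleSpace X]
    (hπ : ∀ x : X, Subsingleton (π_ 2 X x)) (L : HermitianLineBundle J X) :
    ∃ (V : X → TopologicalSpace.Opens X) (s : X → ∀ y, L.Fib y) (θ : X → X → X → ℝ),
      (∀ x, x ∈ V x) ∧ (∀ x y, ‖s x y‖ = 1) ∧
      (∀ x, L.ContAlong (Subtype.val : V x → X) fun y => s x y) ∧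
      (∀ x z y, y ∈ V x → y ∈ V z → s x y = (Circle.exp (θ x z y) : ℂ) • s z y) ∧
      (∀ x z w y, y ∈ V x → y ∈ V z → y ∈ V w → θ x z y + θ z w y = θ x w y) ∧
      ∀ x z, ContinuousOn (θ x z) (V x ∩ V z) := by
  classical
  obtain ⟨ρ, hρ⟩ := PartitionOfUnity.exists_isSubordinate isClosed_univ
    (fun i => (L.dom i : Set X)) (fun i => (L.dom i).2) fun x _ =>
      Set.mem_iUnion.2 (L.exists_mem_dom x)
  obtain ⟨x₀⟩ : Nonempty X := inferInstance
  have hv₀ : ‖L.unitVec x₀‖ = 1 := norm_unitVec x₀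
  obtain ⟨Θ, h0, hΘ, hΘc⟩ := exists_log_phase hρ hv₀ (hπ x₀)
  choose V hV γ hγ using exists_continuous_paths x₀
  refine ⟨V, fun x y => if h : y ∈ V x then transport ρ (L.unitVec x₀) (γ x ⟨y, h⟩) else
    L.unitVec y, fun x z y => if h : y ∈ V x ∧ y ∈ V z then
      Θ ((γ x ⟨y, h.1⟩).trans (γ z ⟨y, h.2⟩).symm) else 0, hV, ?_, ?_, ?_, ?_, ?_⟩
  · intro x y
    dsimp only
    split_ifs with h
    · exact norm_transport hρ hv₀ _
    · exact norm_unitVec y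
  · intro x
    have h := contAlong_transport hρ hv₀ continuous_subtype_val (hγ x)
    convert h using 2 with y
    exact dif_pos y.2
  · intro x z y hx hz
    dsimp only
    simp only [dif_pos hx, dif_pos hz, dif_pos (And.intro hx hz)]
    rw [exp_log_phase hρ hv₀ hΘ]
    exact transport_eq_phase_smul hρ hv₀ _ _
  · intro x z w y hx hz hw
    simp only [dif_pos (And.intro hx hz), dif_pos (And.intro hz hw), dif_pos (And.intro hx hw)]
    exact log_phase_add hρ hv₀ hΘ hΘc h0 _ _ _
  · intro x z
    rw [continuousOn_iff_continuous_domRestrict]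
    have hop : IsOpen (V x ∩ V z : Set X) := (V x).2.inter (V z).2
    have : LocallyPathConnectedSpace (V x ∩ V z : Set X) := hop.locallyPathConnectedSpace
    have hi : ∀ x' (h : (V x ∩ V z : Set X) ⊆ V x'),
        Continuous fun q : (V x ∩ V z : Set X) × I => γ x' ⟨q.1, h q.1.2⟩ q.2 := fun x' h =>
      (hγ x').comp ((Continuous.subtype_mk (continuous_subtype_val.comp continuous_fst) _).prodMk
        continuous_snd)
    refine (continuous_log_phase hρ hv₀ hΘ hΘc
      (y := fun w : (V x ∩ V z : Set X) => (w : X)) (Γ := fun w => γ x ⟨w, w.2.1⟩)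
      (Γ' := fun w => γ z ⟨w, w.2.2⟩) continuous_subtype_val
      (hi x Set.inter_subset_left) (hi z Set.inter_subset_right)).congr fun y => ?_
    have hx : (y : X) ∈ V x := y.2.1
    have hz : (y : X) ∈ V z := y.2.2
    simp only [Set.domRestrict_apply, dif_pos (And.intro hx hz)]

end HermitianLineBundle

end Phase

/-! ### Triviality of hermitean line bundles on 2-connected manifolds -/

section Trivialization

variable {E : Type u₁} [NormedAddCommGroup E] [NormedSpace ℝ E] {H : Type u₂} [TopologicalSpace H]
  {J : ModelWithCorners ℝ E H} {X : Type u} [TopologicalSpace X] [ChartedSpace H X]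

namespace HermitianLineBundle

/-- A hermitean line bundle on a 2-connected space has a continuous unit section: the logarithms of
the transition functions form a cocycle with values in the continuous functions, which is the
coboundary of its average with respect to a partition of unity. -/
theorem exists_continuous_unit_section [NormalSpace X] [ParacompactSpace X]
    [SimplyConnectedSpace X] [StronglyLocallyContractibleSpace X]
    (hπ : ∀ x : X, Subsingleton (π_ 2 X x)) (L : HermitianLineBundle J X) :
    ∃ S : ∀ y, L.Fib y, (∀ y, ‖S y‖ = 1) ∧ L.ContAlong id S := by
  obtain ⟨V, s, θ, hV, hs, hsc, hθ, hcoc, hθc⟩ := exists_sections_log_transition hπ L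
  obtain ⟨ρ, hρ⟩ := PartitionOfUnity.exists_isSubordinate isClosed_univ
    (fun x => (V x : Set X)) (fun x => (V x).2) fun x _ => Set.mem_iUnion.2 ⟨x, hV x⟩
  have hρV : ∀ {z y}, z ∈ ρ.finsupport y → y ∈ V z := fun {z y} h =>
    hρ z (subset_tsupport _ ((ρ.mem_finsupport y).1 h))
  let h : X → X → ℝ := fun x y => ∑ z ∈ ρ.finsupport y, ρ z y * θ x z y
  have hdiff : ∀ {x w y}, y ∈ V x → y ∈ V w → h x y = θ x w y + h w y := by
    intro x w y hx hw
    have h1 : ∀ z ∈ ρ.finsupport y, ρ z y * θ x z y = ρ z y * θ x w y + ρ z y * θ w z y :=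
      fun z hz => by rw [← mul_add, hcoc x w z y hx hw (hρV hz)]
    simp only [h]
    rw [Finset.sum_congr rfl h1, Finset.sum_add_distrib, ← Finset.sum_mul,
      ρ.sum_finsupport (Set.mem_univ y), one_mul]
  have hc : ∀ {x y₀}, y₀ ∈ V x → ContinuousAt (h x) y₀ := by
    intro x y₀ hx
    have h1 : ContinuousAt (fun y => ∑ z ∈ ρ.fintsupport y₀, ρ z y * θ x z y) y₀ := by
      refine tendsto_finsetSum _ fun z hz => ?_
      have hz' : y₀ ∈ V z := hρ z ((ρ.mem_fintsupport_iff _ z).1 hz)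
      exact (ρ z).continuous.continuousAt.mul ((hθc x z).continuousAt
        (((V x).2.inter (V z).2).mem_nhds ⟨hx, hz'⟩))
    refine h1.congr ?_
    filter_upwards [ρ.eventually_finsupport_subset y₀] with y hy
    refine (Finset.sum_subset hy fun z _ hz => ?_).symm
    have h0 : ρ z y = 0 := by
      by_contra h
      exact hz ((ρ.mem_finsupport _).2 h)
    rw [h0, zero_mul]
  let S : ∀ y, L.Fib y := fun y => (Circle.exp (-h y y) : ℂ) • s y y
  have hS : ∀ {x y}, y ∈ V x → S y = (Circle.exp (-h x y) : ℂ) • s x y := by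
    intro x y hx
    simp only [S]
    rw [hdiff hx (hV y), hθ x y y hx (hV y), smul_smul, ← Circle.coe_mul, ← Circle.exp_add]
    congr 3
    ring
  refine ⟨S, fun y => ?_, contAlong_of_local continuous_id fun x => ?_⟩
  · rw [norm_smul, Circle.norm_coe, hs, mul_one]
  · obtain ⟨i, hi⟩ := L.exists_mem_dom x
    refine ⟨i, hi, ?_⟩
    have h1 : ContinuousAt (fun y => L.coef i y (s x y)) x :=
      ((V x).2.isOpenEmbedding_subtypeVal.continuousAt_iff (x := ⟨x, hV x⟩)).1
        ((hsc x).continuousAt continuous_subtype_val hi)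
    have h2 : ContinuousAt (fun y => (Circle.exp (-h x y) : ℂ)) x :=
      continuous_subtype_val.continuousAt.comp
        (Circle.exp.continuous.continuousAt.comp (hc (hV x)).neg)
    refine (h2.mul h1).congr ?_
    filter_upwards [(V x).2.mem_nhds (hV x)] with y hy
    simp only [id, Pi.mul_apply]
    rw [hS hy, map_smul, smul_eq_mul]

/-- A continuous unit section of a hermitean line bundle can be approximated by a smooth one. -/
theorem exists_smooth_unit_section [FiniteDimensional ℝ E] [IsManifold J ∞ X] [T2Space X]
    [SigmaCompactSpace X] {L : HermitianLineBundle J X} {S : ∀ y, L.Fib y}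
    (hS : ∀ y, ‖S y‖ = 1) (hSc : L.ContAlong id S) :
    ∃ T : ∀ y, L.Fib y, (∀ y, ‖T y‖ = 1) ∧
      ∀ i, ContMDiffOn J 𝓘(ℝ, ℂ) ∞ (fun y => L.coef i y (T y)) (L.dom i) := by
  choose i hi using L.exists_mem_dom
  -- Around `x`, the section is compared with the multiple of the local frame that agrees with it
  -- at `x`.
  let e : X → ∀ y, L.Fib y := fun x y => L.coef (i x) x (S x) • L.frame (i x) y
  let f : X → X → ℝ := fun x y => (inner ℂ (S y) (e x y) : ℂ).re
  have hf : ∀ x, ContinuousOn (f x) (L.dom (i x)) := by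
    intro x
    have h1 : ContinuousOn (fun y => (starRingEnd ℂ) (L.coef (i x) y (S y)) *
        L.coef (i x) x (S x) * ((‖L.frame (i x) y‖ ^ 2 : ℝ) : ℂ)) (L.dom (i x)) :=
      ((Complex.continuous_conj.comp_continuousOn (hSc (i x))).mul continuousOn_const).mul
        (Complex.continuous_ofReal.comp_continuousOn (L.metric (i x)).continuousOn)
    refine (Complex.continuous_re.comp_continuousOn h1).congr fun y hy => ?_
    simp only [f, e, Function.comp]
    rw [L.inner_eq_coef hy, L.coef_smul_self hy]
  let U : X → Set X := fun x => L.dom (i x) ∩ f x ⁻¹' Set.Ioi 0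
  have hU : ∀ x, IsOpen (U x) := fun x => (hf x).isOpen_inter_preimage (L.dom (i x)).2 isOpen_Ioi
  have hxU : ∀ x, x ∈ U x := by
    refine fun x => ⟨hi x, ?_⟩
    have : e x x = S x := L.coef_smul_frame (hi x) (S x)
    change 0 < f x x
    simp only [f, this]
    rw [inner_self_eq_norm_sq_to_K, hS]
    simp
  obtain ⟨ρ, hρ⟩ := SmoothPartitionOfUnity.exists_isSubordinate J isClosed_univ U hU
    fun x _ => Set.mem_iUnion.2 ⟨x, hxU x⟩
  have hρU : ∀ {x y}, x ∈ ρ.finsupport y → y ∈ U x := fun {x y} h =>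
    hρ x (subset_tsupport _ ((ρ.mem_finsupport y).1 h))
  let T : ∀ y, L.Fib y := fun y => ∑ x ∈ ρ.finsupport y, (ρ x y : ℂ) • e x y
  have hT0 : ∀ y, T y ≠ 0 := by
    intro y h0
    have h1 : (inner ℂ (S y) (T y) : ℂ).re = ∑ x ∈ ρ.finsupport y, ρ x y * f x y := by
      simp only [T, f, inner_sum, inner_smul_right, Complex.re_sum, Complex.re_ofReal_mul]
    rw [h0, inner_zero_right, Complex.zero_re] at h1
    obtain ⟨x, hx⟩ := ρ.exists_pos_of_mem (Set.mem_univ y)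
    refine h1.not_lt (Finset.sum_pos' (fun z hz => mul_nonneg (ρ.nonneg z y) (hρU hz).2.le)
      ⟨x, ?_⟩)
    have hx' : x ∈ ρ.finsupport y := (ρ.mem_finsupport y).2 hx.ne'
    exact ⟨hx', mul_pos hx (hρU hx').2⟩
  have hTs : ∀ j, ContMDiffOn J 𝓘(ℝ, ℂ) ∞ (fun y => L.coef j y (T y)) (L.dom j) := by
    intro j y₀ hy₀
    have h1 : ContMDiffAt J 𝓘(ℝ, ℂ) ∞ (fun y => ∑ᶠ x, ρ x y • L.coef j y (e x y)) y₀ := by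
      refine ρ.contMDiffAt_finsum fun x hx => ?_
      have hy : y₀ ∈ L.dom (i x) := (hρ x hx).1
      have h2 := smoothOn_mul (contMDiffOn_const (c := L.coef (i x) x (S x)))
        (L.contMDiffOn_coef_frame (i x) j)
      refine (h2.congr fun y _ => ?_).contMDiffAt
        (((L.dom (i x)).2.inter (L.dom j).2).mem_nhds ⟨hy, hy₀⟩)
      simp only [e, map_smul, smul_eq_mul]
    refine ContMDiffAt.contMDiffWithinAt (h1.congr_of_eventuallyEq (Filter.Eventually.of_forall ?_))
    intro y
    simp only [T]
    rw [← ρ.sum_finsupport_smul_eq_finsum (φ := fun x y => L.coef j y (e x y)), map_sum]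
    exact Finset.sum_congr rfl fun x _ => by rw [map_smul, smul_eq_mul, Complex.real_smul]
  refine ⟨fun y => ((‖T y‖⁻¹ : ℝ) : ℂ) • T y, fun y => ?_, fun j => ?_⟩
  · rw [norm_smul, Complex.norm_real, norm_inv, norm_norm,
      inv_mul_cancel₀ (norm_ne_zero_iff.2 (hT0 y))]
  · have hn : ContMDiffOn J 𝓘(ℝ, ℝ) ∞ (fun y => ‖T y‖ ^ 2) (L.dom j) := by
      have h1 : ContDiff ℝ ∞ fun z : ℂ => ‖z‖ ^ 2 := contDiff_norm_sq ℝ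
      refine ((h1.contMDiff.comp_contMDiffOn (hTs j)).mul (L.metric j)).congr fun y hy => ?_
      rw [L.norm_eq_coef hy, mul_pow]
      rfl
    have hinv : ContMDiffOn J 𝓘(ℝ, ℂ) ∞ (fun y => ((‖T y‖⁻¹ : ℝ) : ℂ)) (L.dom j) := by
      intro y hy
      have hne : ‖T y‖ ^ 2 ≠ 0 := pow_ne_zero 2 (norm_ne_zero_iff.2 (hT0 y))
      have h1 : ContDiffAt ℝ ∞ (fun t : ℝ => (((Real.sqrt t)⁻¹ : ℝ) : ℂ)) (‖T y‖ ^ 2) :=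
        Complex.ofRealCLM.contDiff.contDiffAt.comp _ ((Real.contDiffAt_sqrt hne).inv
          (Real.sqrt_ne_zero'.2 (lt_of_le_of_ne (by positivity) hne.symm)))
      refine (h1.contMDiffAt.comp_contMDiffWithinAt y (hn y hy)).congr (fun z _ => ?_) ?_ <;>
        simp [Real.sqrt_sq]
    refine (smoothOn_mul hinv (hTs j)).congr fun y _ => ?_
    rw [map_smul, smul_eq_mul]

/-- A hermitean line bundle on a 2-connected manifold is trivial. -/
theorem nonempty_iso_trivial [FiniteDimensional ℝ E] [IsManifold J ∞ X] [T2Space X]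
    [SigmaCompactSpace X] [SimplyConnectedSpace X] [StronglyLocallyContractibleSpace X]
    (hπ : ∀ x : X, Subsingleton (π_ 2 X x)) (L : HermitianLineBundle J X) :
    Nonempty (Iso (trivial J X) L) := by
  have : LocallyCompactSpace X := Manifold.locallyCompact_of_finiteDimensional J
  obtain ⟨S, hS, hSc⟩ := exists_continuous_unit_section hπ L
  obtain ⟨T, hT, hTs⟩ := exists_smooth_unit_section hS hSc
  choose φ hφ using fun x => exists_isometry (Module.finrank_self ℂ) (L.finrank_fib x)
    (norm_one (α := ℂ)) (hT x)
  refine ⟨⟨φ, smooth_of_local (L := trivial J X) (K := L) φ fun x => ?_⟩⟩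
  obtain ⟨j, hj⟩ := L.exists_mem_dom x
  refine ⟨(), j, L.dom j, (L.dom j).2, hj, fun y hy => ⟨_root_.trivial, hy⟩, _, hTs j,
    fun y hy => ?_⟩
  exact (hφ y).trans (L.coef_smul_frame hy (T y)).symm

end HermitianLineBundle

end Trivialization

/-! ### Homotopy groups of contractible spaces and products -/

section HomotopyGroups

open unitInterval

variable {X : Type*} [TopologicalSpace X] {Y : Type*} [TopologicalSpace Y] {N : Type*}

theorem subsingleton_homotopyGroup_iff {x : X} :
    Subsingleton (HomotopyGroup N X x) ↔
      ∀ f : GenLoop N X x, f.1.HomotopicRel (.const _ x) (Cube.boundary N) := by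
  constructor
  · intro h f
    exact Quotient.exact (s := GenLoop.Homotopic.setoid N x)
      (h.elim (Quotient.mk _ f) (Quotient.mk _ GenLoop.const))
  · intro h
    have h1 : ∀ q : HomotopyGroup N X x, q = Quotient.mk _ GenLoop.const := fun q => by
      induction q using Quotient.inductionOn with
      | h f => exact Quotient.sound (h f)
    exact ⟨fun p q => (h1 p).trans (h1 q).symm⟩

/-- The homotopy groups of a space vanish at a base point onto which the space contracts in the
pointed sense. -/
theorem subsingleton_homotopyGroup_of_contraction {x₀ : X} {K : I × X → X} (hK : Continuous K)
    (h0 : ∀ x, K (0, x) = x) (h1 : ∀ x, K (1, x) = x₀) (hfix : ∀ t, K (t, x₀) = x₀) :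
    Subsingleton (HomotopyGroup N X x₀) :=
  subsingleton_homotopyGroup_iff.2 fun f =>
    ⟨{ toFun := fun q => K (q.1, f q.2)
       continuous_toFun := by fun_prop
       map_zero_left := fun y => h0 _
       map_one_left := fun y => h1 _
       prop' := fun t y hy => by
        have : f.1 y = x₀ := f.2 y hy
        change K (t, f.1 y) = f.1 y
        rw [this, hfix] }⟩

theorem subsingleton_homotopyGroup_prod {x : X} {y : Y} (hX : Subsingleton (HomotopyGroup N X x))
    (hY : Subsingleton (HomotopyGroup N Y y)) : Subsingleton (HomotopyGroup N (X × Y) (x, y)) := by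
  rw [subsingleton_homotopyGroup_iff] at hX hY ⊢
  intro f
  have hf : ∀ c ∈ Cube.boundary N, f.1 c = (x, y) := f.2
  obtain ⟨F⟩ := hX ⟨ContinuousMap.fst.comp f.1, fun c hc => congrArg Prod.fst (hf c hc)⟩
  obtain ⟨G⟩ := hY ⟨ContinuousMap.snd.comp f.1, fun c hc => congrArg Prod.snd (hf c hc)⟩
  exact ⟨ContinuousMap.HomotopyRel.prod F G⟩

theorem subsingleton_homotopyGroup_of_homeomorph {V : Type*} [AddCommGroup V] [Module ℝ V]
    [TopologicalSpace V] [ContinuousAdd V] [ContinuousSMul ℝ V] (e : X ≃ₜ V) (x₀ : X) :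
    Subsingleton (HomotopyGroup N X x₀) := by
  refine subsingleton_homotopyGroup_of_contraction
    (K := fun q => e.symm ((1 - (q.1 : ℝ)) • e q.2 + (q.1 : ℝ) • e x₀)) (by fun_prop) ?_ ?_ ?_
  · intro x; simp
  · intro x; simp
  · intro t
    rw [← add_smul, sub_add_cancel, one_smul, e.symm_apply_apply]

instance [ContractibleSpace X] [SimplyConnectedSpace Y] : SimplyConnectedSpace (X × Y) := by
  obtain ⟨h⟩ := ContractibleSpace.hequiv X Unit
  exact ((h.prodCongr (.refl Y)).trans
    (Homeomorph.punitProd Y).toHomotopyEquiv).simplyConnectedSpace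

end HomotopyGroups

/-! ### Local contractibility of manifolds -/

section LocallyContractible

instance {V : Type*} [NormedAddCommGroup V] [NormedSpace ℝ V] :
    StronglyLocallyContractibleSpace V :=
  .of_bases (fun _ => Metric.nhds_basis_ball) fun x _ hr =>
    (convex_ball x _).contractibleSpace ⟨x, Metric.mem_ball_self hr⟩

/-- A space that is locally homeomorphic to a strongly locally contractible space is strongly
locally contractible. -/
theorem ChartedSpace.stronglyLocallyContractibleSpace (H : Type*) [TopologicalSpace H]
    [StronglyLocallyContractibleSpace H] (X : Type*) [TopologicalSpace X] [ChartedSpace H X] :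
    StronglyLocallyContractibleSpace X where
  contractible_basis x := by
    refine Filter.hasBasis_self.2 fun t ht => ?_
    have hx := mem_chart_source H x
    have hop := (chartAt H x).open_source
    have := (chartAt H x).isOpenEmbedding_restrict.stronglyLocallyContractibleSpace
    have ht' : (Subtype.val : (chartAt H x).source → X) ⁻¹' t ∈ 𝓝 ⟨x, hx⟩ :=
      continuous_subtype_val.continuousAt.preimage_mem_nhds ht
    obtain ⟨s, ⟨hs, hsc⟩, hst⟩ := (contractible_basis _).mem_iff.1 ht'
    refine ⟨Subtype.val '' s, hop.isOpenMap_subtype_val.image_mem_nhds hs, ?_,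
      Set.image_subset_iff.2 hst⟩
    exact (Topology.IsEmbedding.subtypeVal.homeomorphImage s).contractibleSpace_iff.1 hsc

end LocallyContractible

/-! ### Line bundles on products with Cartesian spaces -/

section Cartesian

variable {d : ℕ} {M : Type u} [TopologicalSpace M] [T2Space M] [SecondCountableTopology M]
  [ChartedSpace (EuclideanSpace ℝ (Fin d)) M] [IsManifold (𝓡 d) ∞ M]

theorem nonempty_iso_trivial_of_isTwoConnected (hM : IsTwoConnected M) (c : Cart)
    (L : HermitianLineBundle ((𝓡 c.dim).prod (𝓡 d)) (c.carrier × M)) :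
    Nonempty (HermitianLineBundle.Iso
      (HermitianLineBundle.trivial ((𝓡 c.dim).prod (𝓡 d)) (c.carrier × M)) L) := by
  obtain ⟨hM1, hM2⟩ := hM
  obtain ⟨e'⟩ := c.diffeo
  let e : c.carrier ≃ₜ EuclideanSpace ℝ (Fin c.dim) := e'.toHomeomorph
  have : T2Space c.carrier := e.symm.t2Space
  have : SecondCountableTopology c.carrier := e.isEmbedding.secondCountableTopology
  have : ContractibleSpace c.carrier := e.contractibleSpace
  have : StronglyLocallyContractibleSpace c.carrier :=
    ChartedSpace.stronglyLocallyContractibleSpace (EuclideanSpace ℝ (Fin c.dim)) _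
  have : StronglyLocallyContractibleSpace M :=
    ChartedSpace.stronglyLocallyContractibleSpace (EuclideanSpace ℝ (Fin d)) _
  have : LocallyCompactSpace (c.carrier × M) :=
    Manifold.locallyCompact_of_finiteDimensional ((𝓡 c.dim).prod (𝓡 d))
  exact HermitianLineBundle.nonempty_iso_trivial (fun x => subsingleton_homotopyGroup_prod
    (subsingleton_homotopyGroup_of_homeomorph e x.1) (hM2 x.2)) L

end Cartesian

/-! ### Inverses of fully faithful monoidal 1-morphisms -/

namespace SmoothGroupoid

variable {A : SmoothGroupoid.{u, v}} {B : SmoothGroupoid.{u₁, v₁}} {c c' c'' : Cart}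
  {f : c ⟶ c'} {f' : c' ⟶ c''}

/-- Composition of a morphism over `f` with a morphism of the fibre over its source.  The composite
lies over `𝟙 c ≫ f`, which is definitionally equal to `f`. -/
def lcomp (A : SmoothGroupoid.{u, v}) {x y : A.Obj c} {z : A.Obj c'} (α : A.Hom (𝟙 c) x y)
    (φ : A.Hom f y z) : A.Hom f x z := A.comp α φ

/-- Composition of a morphism over `f` with a morphism of the fibre over its target, again as a
morphism over `f`. -/
def rcomp (A : SmoothGroupoid.{u, v}) {x : A.Obj c} {y z : A.Obj c'} (φ : A.Hom f x y)
    (β : A.Hom (𝟙 c') y z) : A.Hom f x z := A.comp φ β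

theorem lcomp_eq_vcomp {x y z : A.Obj c} (α : A.Hom (𝟙 c) x y) (β : A.Hom (𝟙 c) y z) :
    A.lcomp α β = A.vcomp α β := rfl

theorem rcomp_eq_vcomp {x y z : A.Obj c} (α : A.Hom (𝟙 c) x y) (β : A.Hom (𝟙 c) y z) :
    A.rcomp α β = A.vcomp α β := rfl

theorem id_lcomp {x : A.Obj c} {y : A.Obj c'} (φ : A.Hom f x y) : A.lcomp (A.id x) φ = φ :=
  A.id_comp φ

theorem rcomp_id {x : A.Obj c} {y : A.Obj c'} (φ : A.Hom f x y) : A.rcomp φ (A.id y) = φ :=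
  A.comp_id φ

theorem lcomp_lcomp {x y z : A.Obj c} {w : A.Obj c'} (α : A.Hom (𝟙 c) x y) (β : A.Hom (𝟙 c) y z)
    (φ : A.Hom f z w) : A.lcomp α (A.lcomp β φ) = A.lcomp (A.vcomp α β) φ := (A.assoc α β φ).symm

theorem rcomp_rcomp {x : A.Obj c} {y z w : A.Obj c'} (φ : A.Hom f x y) (α : A.Hom (𝟙 c') y z)
    (β : A.Hom (𝟙 c') z w) : A.rcomp (A.rcomp φ α) β = A.rcomp φ (A.vcomp α β) := A.assoc φ α β

theorem rcomp_lcomp {x y : A.Obj c} {z w : A.Obj c'} (α : A.Hom (𝟙 c) x y) (φ : A.Hom f y z)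
    (β : A.Hom (𝟙 c') z w) : A.rcomp (A.lcomp α φ) β = A.lcomp α (A.rcomp φ β) := A.assoc α φ β

theorem lcomp_comp {x y : A.Obj c} {z : A.Obj c'} {w : A.Obj c''} (α : A.Hom (𝟙 c) x y)
    (φ : A.Hom f y z) (ψ : A.Hom f' z w) :
    A.lcomp α (A.comp φ ψ) = A.comp (A.lcomp α φ) ψ := (A.assoc α φ ψ).symm

theorem rcomp_comp {x : A.Obj c} {y z : A.Obj c'} {w : A.Obj c''} (φ : A.Hom f x y)
    (β : A.Hom (𝟙 c') y z) (ψ : A.Hom f' z w) :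
    A.comp (A.rcomp φ β) ψ = A.comp φ (A.lcomp β ψ) := A.assoc φ β ψ

theorem comp_rcomp {x : A.Obj c} {y : A.Obj c'} {z w : A.Obj c''} (φ : A.Hom f x y)
    (ψ : A.Hom f' y z) (β : A.Hom (𝟙 c'') z w) :
    A.comp φ (A.rcomp ψ β) = A.rcomp (A.comp φ ψ) β := (A.assoc φ ψ β).symm

/-- The morphisms of the fibres are invertible. -/
theorem exists_vcomp_inv {x y : A.Obj c} (α : A.Hom (𝟙 c) x y) :
    ∃ β : A.Hom (𝟙 c) y x, A.vcomp α β = A.id x ∧ A.vcomp β α = A.id y := by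
  obtain ⟨β, hβ, -⟩ := A.fill (𝟙 c) (𝟙 c) (A.id y) α
  have hβ' : A.vcomp β α = A.id y := hβ
  refine ⟨β, cancel_right (f := 𝟙 c) (g := 𝟙 c) α ?_, hβ'⟩
  change A.vcomp (A.vcomp α β) α = A.vcomp (A.id x) α
  rw [vcomp_assoc, hβ', vcomp_id, id_vcomp]

namespace Morphism

variable (F : Morphism B A)

theorem map_lcomp {x y : B.Obj c} {z : B.Obj c'} (α : B.Hom (𝟙 c) x y) (φ : B.Hom f y z) :
    F.map (B.lcomp α φ) = A.lcomp (F.map α) (F.map φ) := F.map_comp α φ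

theorem map_rcomp {x : B.Obj c} {y z : B.Obj c'} (φ : B.Hom f x y) (β : B.Hom (𝟙 c') y z) :
    F.map (B.rcomp φ β) = A.rcomp (F.map φ) (F.map β) := F.map_comp φ β

/-- A 1-morphism is fully faithful if it is bijective on the morphisms over each morphism of
Cartesian spaces. -/
def FullyFaithful : Prop := ∀ ⦃c c' : Cart⦄ ⦃f : c ⟶ c'⦄ ⦃x : B.Obj c⦄ ⦃y : B.Obj c'⦄
  (ψ : A.Hom f (F.obj x) (F.obj y)), ∃! φ : B.Hom f x y, F.map φ = ψ

variable {F} (hF : F.FullyFaithful)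

namespace FullyFaithful

include hF in
theorem hom_ext {p : A.Obj c} {x : B.Obj c} {y : B.Obj c'} (α : A.Hom (𝟙 c) p (F.obj x))
    {φ ψ : B.Hom f x y} (h : A.lcomp α (F.map φ) = A.lcomp α (F.map ψ)) : φ = ψ := by
  obtain ⟨β, -, hβ⟩ := exists_vcomp_inv α
  refine (hF (F.map ψ)).unique ?_ rfl
  have := congrArg (A.lcomp β) h
  rwa [lcomp_lcomp, lcomp_lcomp, hβ, id_lcomp, id_lcomp] at this

include hF in
theorem exists_lcomp_map_eq {p : A.Obj c} {x : B.Obj c} {y : B.Obj c'}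
    (α : A.Hom (𝟙 c) p (F.obj x)) (ψ : A.Hom f p (F.obj y)) :
    ∃ φ : B.Hom f x y, A.lcomp α (F.map φ) = ψ := by
  obtain ⟨β, hβ, -⟩ := exists_vcomp_inv α
  obtain ⟨φ, hφ, -⟩ := hF (A.lcomp β ψ)
  exact ⟨φ, by rw [hφ, lcomp_lcomp, hβ, id_lcomp]⟩

/-- The morphism `φ` determined by `α ≫ F φ = ψ`. -/
def desc {p : A.Obj c} {x : B.Obj c} {y : B.Obj c'} (α : A.Hom (𝟙 c) p (F.obj x))
    (ψ : A.Hom f p (F.obj y)) : B.Hom f x y := (hF.exists_lcomp_map_eq α ψ).choose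

theorem lcomp_map_desc {p : A.Obj c} {x : B.Obj c} {y : B.Obj c'} (α : A.Hom (𝟙 c) p (F.obj x))
    (ψ : A.Hom f p (F.obj y)) : A.lcomp α (F.map (hF.desc α ψ)) = ψ :=
  (hF.exists_lcomp_map_eq α ψ).choose_spec

variable {g : ∀ ⦃c : Cart⦄, A.Obj c → B.Obj c}
  (e : ∀ ⦃c : Cart⦄ (z : A.Obj c), A.Hom (𝟙 c) z (F.obj (g z)))

/-- The action on morphisms of the inverse of a fully faithful 1-morphism. -/
def inverseMap {z : A.Obj c} {w : A.Obj c'} (ψ : A.Hom f z w) : B.Hom f (g z) (g w) :=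
  hF.desc (e z) (A.rcomp ψ (e w))

theorem lcomp_inverseMap {z : A.Obj c} {w : A.Obj c'} (ψ : A.Hom f z w) :
    A.lcomp (e z) (F.map (hF.inverseMap e ψ)) = A.rcomp ψ (e w) := hF.lcomp_map_desc _ _

/-- The inverse of a fully faithful 1-morphism given by a choice of preimages of the objects. -/
def inverse : Morphism A B where
  obj {c} z := g z
  map ψ := hF.inverseMap e ψ
  map_id z := hF.hom_ext (e z) <| by
    rw [lcomp_inverseMap, F.map_id, rcomp_eq_vcomp, lcomp_eq_vcomp, id_vcomp, vcomp_id]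
  map_comp {_ _ _ _ _ x y z} φ ψ := hF.hom_ext (e x) <| by
    rw [lcomp_inverseMap, F.map_comp, lcomp_comp, lcomp_inverseMap, rcomp_comp, lcomp_inverseMap,
      comp_rcomp]

end FullyFaithful

end Morphism

end SmoothGroupoid

open SmoothGroupoid

namespace SmoothMonoid

variable {A : SmoothMonoid.{u, v}} {B : SmoothMonoid.{u₁, v₁}} {c c' : Cart} {f : c ⟶ c'}

/-- The identity of the unit objects over a morphism of Cartesian spaces. -/
def unitMap (A : SmoothMonoid.{u, v}) (f : c ⟶ c') : A.X.Hom f (A.one c) (A.one c') :=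
  A.unit.map (f := f) (x := ()) (y := ()) ()

/-- The product of morphisms over the same morphism of Cartesian spaces. -/
def mulMap (A : SmoothMonoid.{u, v}) {x x' : A.X.Obj c} {y y' : A.X.Obj c'} (φ : A.X.Hom f x y)
    (φ' : A.X.Hom f x' y') : A.X.Hom f (A.mul x x') (A.mul y y') :=
  A.tensor.map (x := (x, x')) (y := (y, y')) (φ, φ')

theorem lcomp_mulMap {p p' x x' : A.X.Obj c} {y y' : A.X.Obj c'} (α : A.X.Hom (𝟙 c) p x)
    (α' : A.X.Hom (𝟙 c) p' x') (φ : A.X.Hom f x y) (φ' : A.X.Hom f x' y') :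
    A.X.lcomp (A.mulHom α α') (A.mulMap φ φ') = A.mulMap (A.X.lcomp α φ) (A.X.lcomp α' φ') :=
  (A.tensor.map_comp (x := (p, p')) (y := (x, x')) (z := (y, y')) (f := 𝟙 c) (g := f)
    (α, α') (φ, φ')).symm

theorem rcomp_mulMap {x x' : A.X.Obj c} {y y' z z' : A.X.Obj c'} (φ : A.X.Hom f x y)
    (φ' : A.X.Hom f x' y') (β : A.X.Hom (𝟙 c') y z) (β' : A.X.Hom (𝟙 c') y' z') :
    A.X.rcomp (A.mulMap φ φ') (A.mulHom β β') = A.mulMap (A.X.rcomp φ β) (A.X.rcomp φ' β') :=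
  (A.tensor.map_comp (x := (x, x')) (y := (y, y')) (z := (z, z')) (f := f) (g := 𝟙 c')
    (φ, φ') (β, β')).symm

theorem HomData.rcomp_mu (S : HomData B A) {x x' : B.X.Obj c} {y y' : B.X.Obj c'}
    (φ : B.X.Hom f x y) (φ' : B.X.Hom f x' y') :
    A.X.rcomp (A.mulMap (S.F.map φ) (S.F.map φ')) (S.mu y y') =
      A.X.lcomp (S.mu x x') (S.F.map (B.mulMap φ φ')) :=
  S.tensorIso.naturality (x := (x, x')) (y := (y, y')) (φ, φ')

theorem mulHom_a (A : SmoothMonoid.{u, v}) {x y z x' y' z' : A.X.Obj c}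
    (φ : A.X.Hom (𝟙 c) x x') (ψ : A.X.Hom (𝟙 c) y y') (χ : A.X.Hom (𝟙 c) z z') :
    A.X.vcomp (A.mulHom (A.mulHom φ ψ) χ) (A.a x' y' z') =
      A.X.vcomp (A.a x y z) (A.mulHom φ (A.mulHom ψ χ)) :=
  A.assoc.naturality (x := ((x, y), z)) (y := ((x', y'), z')) (f := 𝟙 c) ((φ, ψ), χ)

theorem mulHom_l (A : SmoothMonoid.{u, v}) {x x' : A.X.Obj c} (φ : A.X.Hom (𝟙 c) x x') :
    A.X.vcomp (A.mulHom (A.X.id (A.one c)) φ) (A.l x') = A.X.vcomp (A.l x) φ := by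
  have h := A.leftUnitor.naturality φ
  have h1 : A.unit.map (f := 𝟙 c) (x := ()) (y := ()) () = A.X.id (A.one c) := A.unit.map_id ()
  rw [← h1]
  exact h

theorem mulHom_r (A : SmoothMonoid.{u, v}) {x x' : A.X.Obj c} (φ : A.X.Hom (𝟙 c) x x') :
    A.X.vcomp (A.mulHom φ (A.X.id (A.one c))) (A.r x') = A.X.vcomp (A.r x) φ := by
  have h := A.rightUnitor.naturality φ
  have h1 : A.unit.map (f := 𝟙 c) (x := ()) (y := ()) () = A.X.id (A.one c) := A.unit.map_id ()
  rw [← h1]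
  exact h

theorem mulHom_split_left (A : SmoothMonoid.{u, v}) {x y x' y' : A.X.Obj c}
    (φ : A.X.Hom (𝟙 c) x y) (φ' : A.X.Hom (𝟙 c) x' y') :
    A.mulHom φ φ' = A.X.vcomp (A.mulHom φ (A.X.id x')) (A.mulHom (A.X.id y) φ') := by
  rw [← mulHom_vcomp, vcomp_id, id_vcomp]

theorem mulHom_split_right (A : SmoothMonoid.{u, v}) {x y x' y' : A.X.Obj c}
    (φ : A.X.Hom (𝟙 c) x y) (φ' : A.X.Hom (𝟙 c) x' y') :
    A.mulHom φ φ' = A.X.vcomp (A.mulHom (A.X.id x) φ') (A.mulHom φ (A.X.id y')) := by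
  rw [← mulHom_vcomp, vcomp_id, id_vcomp]

namespace Hom

variable (S : Hom B A) (hF : S.F.FullyFaithful) {g : ∀ ⦃c : Cart⦄, A.X.Obj c → B.X.Obj c}
  (e : ∀ ⦃c : Cart⦄ (z : A.X.Obj c), A.X.Hom (𝟙 c) z (S.F.obj (g z)))

/-- The morphism `x ⊗ y ⟶ F (g x ⊗ g y)`. -/
def mulMu (x y : A.X.Obj c) : A.X.Hom (𝟙 c) (A.mul x y) (S.F.obj (B.mul (g x) (g y))) :=
  A.X.vcomp (A.mulHom (e x) (e y)) (S.mu (g x) (g y))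

/-- The components `g x ⊗ g y ⟶ g (x ⊗ y)` of the monoidal structure on the inverse.  They are
determined by the requirement that `e` is a monoidal 2-morphism. -/
def inverseMu (x y : A.X.Obj c) : B.X.Hom (𝟙 c) (B.mul (g x) (g y)) (g (A.mul x y)) :=
  hF.desc (S.mulMu e x y) (e (A.mul x y))

/-- The components `1 ⟶ g 1` of the monoidal structure on the inverse. -/
def inverseEps (c : Cart) : B.X.Hom (𝟙 c) (B.one c) (g (A.one c)) :=
  hF.desc (S.eps c) (e (A.one c))

theorem mulMu_inverseMu (x y : A.X.Obj c) :
    A.X.vcomp (S.mulMu e x y) (S.F.map (S.inverseMu hF e x y)) = e (A.mul x y) :=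
  hF.lcomp_map_desc _ _

theorem eps_inverseEps (c : Cart) :
    A.X.vcomp (S.eps c) (S.F.map (S.inverseEps hF e c)) = e (A.one c) :=
  hF.lcomp_map_desc _ _

theorem vcomp_inverseMap {z w : A.X.Obj c} (ψ : A.X.Hom (𝟙 c) z w) :
    A.X.vcomp (e z) (S.F.map (hF.inverseMap e ψ)) = A.X.vcomp ψ (e w) :=
  hF.lcomp_inverseMap e ψ

theorem inverseMu_natural {x x' : A.X.Obj c} {y y' : A.X.Obj c'} (φ : A.X.Hom f x y)
    (φ' : A.X.Hom f x' y') :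
    B.X.rcomp (B.mulMap (hF.inverseMap e φ) (hF.inverseMap e φ')) (S.inverseMu hF e y y') =
      B.X.lcomp (S.inverseMu hF e x x') (hF.inverseMap e (A.mulMap φ φ')) := by
  refine hF.hom_ext (S.mulMu e x x') ?_
  rw [S.F.map_rcomp, S.F.map_lcomp, lcomp_lcomp, mulMu_inverseMu, hF.lcomp_inverseMap,
    ← rcomp_lcomp, mulMu, ← lcomp_lcomp, ← S.rcomp_mu, ← rcomp_lcomp, lcomp_mulMap,
    hF.lcomp_inverseMap, hF.lcomp_inverseMap, ← rcomp_mulMap, rcomp_rcomp, rcomp_rcomp,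
    ← vcomp_assoc]
  exact congrArg _ (S.mulMu_inverseMu hF e y y')

theorem inverseEps_natural (f : c ⟶ c') :
    B.X.rcomp (B.unitMap f) (S.inverseEps hF e c') =
      B.X.lcomp (S.inverseEps hF e c) (hF.inverseMap e (A.unitMap f)) := by
  have h : A.X.rcomp (A.unitMap f) (S.eps c') = A.X.lcomp (S.eps c) (S.F.map (B.unitMap f)) :=
    S.unitIso.naturality (f := f) (x := ()) (y := ()) ()
  refine hF.hom_ext (S.eps c) ?_
  rw [S.F.map_rcomp, S.F.map_lcomp, lcomp_lcomp, ← rcomp_lcomp, ← h, rcomp_rcomp, eps_inverseEps,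
    eps_inverseEps, hF.lcomp_inverseMap]

theorem mulMu_mulHom_left (x y z : A.X.Obj c) :
    A.X.vcomp (A.X.vcomp (A.mulHom (S.mulMu e x y) (e z)) (S.mu (B.mul (g x) (g y)) (g z)))
        (S.F.map (B.mulHom (S.inverseMu hF e x y) (B.X.id (g z)))) =
      S.mulMu e (A.mul x y) z := by
  have h := S.mu_natural (S.inverseMu hF e x y) (B.X.id (g z))
  rw [S.F.map_id] at h
  rw [vcomp_assoc, ← h, ← vcomp_assoc, ← mulHom_vcomp, vcomp_id, mulMu_inverseMu]
  rfl

theorem mulMu_mulHom_right (x y z : A.X.Obj c) :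
    A.X.vcomp (A.X.vcomp (A.mulHom (e x) (S.mulMu e y z)) (S.mu (g x) (B.mul (g y) (g z))))
        (S.F.map (B.mulHom (B.X.id (g x)) (S.inverseMu hF e y z))) =
      S.mulMu e x (A.mul y z) := by
  have h := S.mu_natural (B.X.id (g x)) (S.inverseMu hF e y z)
  rw [S.F.map_id] at h
  rw [vcomp_assoc, ← h, ← vcomp_assoc, ← mulHom_vcomp, vcomp_id, mulMu_inverseMu]
  rfl

theorem mulMu_a (x y z : A.X.Obj c) :
    A.X.vcomp (A.X.vcomp (A.mulHom (S.mulMu e x y) (e z)) (S.mu (B.mul (g x) (g y)) (g z)))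
        (S.F.map (B.a (g x) (g y) (g z))) =
      A.X.vcomp (A.a x y z)
        (A.X.vcomp (A.mulHom (e x) (S.mulMu e y z)) (S.mu (g x) (B.mul (g y) (g z)))) := by
  have h1 : A.mulHom (S.mulMu e x y) (e z) =
      A.X.vcomp (A.mulHom (A.mulHom (e x) (e y)) (e z))
        (A.mulHom (S.mu (g x) (g y)) (A.X.id (S.F.obj (g z)))) := by
    rw [← mulHom_vcomp, vcomp_id]; rfl
  have h2 : A.mulHom (e x) (S.mulMu e y z) =
      A.X.vcomp (A.mulHom (e x) (A.mulHom (e y) (e z)))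
        (A.mulHom (A.X.id (S.F.obj (g x))) (S.mu (g y) (g z))) := by
    rw [← mulHom_vcomp, vcomp_id]; rfl
  have h3 := S.associativity (g x) (g y) (g z)
  rw [h1, h2]
  simp only [vcomp_assoc] at h3 ⊢
  rw [h3, ← vcomp_assoc, mulHom_a, vcomp_assoc]

theorem inverse_associativity (x y z : A.X.Obj c) :
    B.X.vcomp (B.X.vcomp (B.mulHom (S.inverseMu hF e x y) (B.X.id (g z)))
        (S.inverseMu hF e (A.mul x y) z)) (hF.inverseMap e (A.a x y z)) =
      B.X.vcomp (B.X.vcomp (B.a (g x) (g y) (g z))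
        (B.mulHom (B.X.id (g x)) (S.inverseMu hF e y z))) (S.inverseMu hF e x (A.mul y z)) := by
  refine hF.hom_ext (A.X.vcomp (A.mulHom (S.mulMu e x y) (e z)) (S.mu (B.mul (g x) (g y)) (g z))) ?_
  rw [lcomp_eq_vcomp, lcomp_eq_vcomp]
  simp only [Morphism.map_vcomp]
  trans A.X.vcomp (A.a x y z) (e (A.mul x (A.mul y z)))
  · rw [← vcomp_assoc, ← vcomp_assoc, mulMu_mulHom_left, mulMu_inverseMu, vcomp_inverseMap]
  · rw [← vcomp_assoc, ← vcomp_assoc, mulMu_a, vcomp_assoc (A.a x y z), mulMu_mulHom_right,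
      vcomp_assoc, mulMu_inverseMu]

theorem inverse_left_unitality (x : A.X.Obj c) :
    B.X.vcomp (B.X.vcomp (B.mulHom (S.inverseEps hF e c) (B.X.id (g x)))
        (S.inverseMu hF e (A.one c) x)) (hF.inverseMap e (A.l x)) = B.l (g x) := by
  have h := S.mu_natural (S.inverseEps hF e c) (B.X.id (g x))
  rw [S.F.map_id] at h
  refine hF.hom_ext (A.X.vcomp (A.mulHom (S.eps c) (e x)) (S.mu (B.one c) (g x))) ?_
  rw [lcomp_eq_vcomp, lcomp_eq_vcomp]
  simp only [Morphism.map_vcomp]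
  trans A.X.vcomp (A.l x) (e x)
  · have h1 : A.X.vcomp (A.X.vcomp (A.mulHom (S.eps c) (e x)) (S.mu (B.one c) (g x)))
        (S.F.map (B.mulHom (S.inverseEps hF e c) (B.X.id (g x)))) = S.mulMu e (A.one c) x := by
      rw [vcomp_assoc, ← h, ← vcomp_assoc, ← mulHom_vcomp, vcomp_id, eps_inverseEps]
      rfl
    rw [← vcomp_assoc, ← vcomp_assoc, h1, mulMu_inverseMu, vcomp_inverseMap]
  · have h1 := S.left_unitality (g x)
    rw [vcomp_assoc] at h1
    rw [mulHom_split_right, vcomp_assoc, vcomp_assoc, h1, mulHom_l]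

theorem inverse_right_unitality (x : A.X.Obj c) :
    B.X.vcomp (B.X.vcomp (B.mulHom (B.X.id (g x)) (S.inverseEps hF e c))
        (S.inverseMu hF e x (A.one c))) (hF.inverseMap e (A.r x)) = B.r (g x) := by
  have h := S.mu_natural (B.X.id (g x)) (S.inverseEps hF e c)
  rw [S.F.map_id] at h
  refine hF.hom_ext (A.X.vcomp (A.mulHom (e x) (S.eps c)) (S.mu (g x) (B.one c))) ?_
  rw [lcomp_eq_vcomp, lcomp_eq_vcomp]
  simp only [Morphism.map_vcomp]
  trans A.X.vcomp (A.r x) (e x)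
  · have h1 : A.X.vcomp (A.X.vcomp (A.mulHom (e x) (S.eps c)) (S.mu (g x) (B.one c)))
        (S.F.map (B.mulHom (B.X.id (g x)) (S.inverseEps hF e c))) = S.mulMu e x (A.one c) := by
      rw [vcomp_assoc, ← h, ← vcomp_assoc, ← mulHom_vcomp, vcomp_id, eps_inverseEps]
      rfl
    rw [← vcomp_assoc, ← vcomp_assoc, h1, mulMu_inverseMu, vcomp_inverseMap]
  · have h1 := S.right_unitality (g x)
    rw [vcomp_assoc] at h1
    rw [mulHom_split_left, vcomp_assoc, vcomp_assoc, h1, mulHom_r]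

/-- The inverse of a fully faithful monoidal 1-morphism. -/
def inverse : Hom A B where
  F := hF.inverse e
  tensorIso :=
    { app := fun x => S.inverseMu hF e x.1 x.2
      naturality := fun φ => S.inverseMu_natural hF e φ.1 φ.2 }
  unitIso :=
    { app := fun {c} _ => S.inverseEps hF e c
      naturality := fun {_ _ f _ _} _ => S.inverseEps_natural hF e f }
  associativity := S.inverse_associativity hF e
  left_unitality := S.inverse_left_unitality hF e
  right_unitality := S.inverse_right_unitality hF e

/-- The natural morphism `x ⟶ F (g x)`, as a monoidal 2-morphism. -/
def inverseUnit : TwoHom (Hom.id A) ((S.inverse hF e).comp S) where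
  theta :=
    { app := fun x => e x
      naturality := fun φ => (hF.lcomp_inverseMap e φ).symm }
  tensor_compat x y := by
    change A.X.vcomp (A.mulHom (e x) (e y))
        (A.X.vcomp (S.mu (g x) (g y)) (S.F.map (S.inverseMu hF e x y))) =
      A.X.vcomp (A.X.id (A.mul x y)) (e (A.mul x y))
    rw [← vcomp_assoc, id_vcomp]
    exact S.mulMu_inverseMu hF e x y
  unit_compat c := by
    change A.X.vcomp (A.X.id (A.one c)) (e (A.one c)) =
      A.X.vcomp (S.eps c) (S.F.map (S.inverseEps hF e c))
    rw [eps_inverseEps, id_vcomp]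

/-- The components of the natural morphism `g (F y) ⟶ y`. -/
def counitApp (y : B.X.Obj c) : B.X.Hom (𝟙 c) (g (S.F.obj y)) y :=
  hF.desc (e (S.F.obj y)) (A.X.id (S.F.obj y))

theorem vcomp_counitApp (y : B.X.Obj c) :
    A.X.vcomp (e (S.F.obj y)) (S.F.map (S.counitApp hF e y)) = A.X.id (S.F.obj y) :=
  hF.lcomp_map_desc _ _

theorem counit_natural {x : B.X.Obj c} {y : B.X.Obj c'} (φ : B.X.Hom f x y) :
    B.X.rcomp (hF.inverseMap e (S.F.map φ)) (S.counitApp hF e y) =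
      B.X.lcomp (S.counitApp hF e x) φ := by
  refine hF.hom_ext (e (S.F.obj x)) ?_
  rw [S.F.map_rcomp, S.F.map_lcomp, lcomp_lcomp, vcomp_counitApp, ← rcomp_lcomp,
    hF.lcomp_inverseMap, rcomp_rcomp, vcomp_counitApp, id_lcomp, rcomp_id]

theorem counit_tensor_compat (x y : B.X.Obj c) :
    B.X.vcomp (B.mulHom (S.counitApp hF e x) (S.counitApp hF e y)) (B.X.id (B.mul x y)) =
      B.X.vcomp (B.X.vcomp (S.inverseMu hF e (S.F.obj x) (S.F.obj y))
        (hF.inverseMap e (S.mu x y))) (S.counitApp hF e (B.mul x y)) := by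
  refine hF.hom_ext (S.mulMu e (S.F.obj x) (S.F.obj y)) ?_
  rw [lcomp_eq_vcomp, lcomp_eq_vcomp, vcomp_id]
  simp only [Morphism.map_vcomp]
  trans S.mu x y
  · rw [mulMu, vcomp_assoc, ← S.mu_natural, ← vcomp_assoc, ← mulHom_vcomp, vcomp_counitApp,
      vcomp_counitApp, mulHom_id, id_vcomp]
  · rw [← vcomp_assoc, ← vcomp_assoc, mulMu_inverseMu, vcomp_inverseMap, vcomp_assoc,
      vcomp_counitApp, vcomp_id]

theorem counit_unit_compat (c : Cart) :
    B.X.vcomp (B.X.vcomp (S.inverseEps hF e c) (hF.inverseMap e (S.eps c)))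
      (S.counitApp hF e (B.one c)) = B.X.id (B.one c) := by
  refine hF.hom_ext (S.eps c) ?_
  rw [lcomp_eq_vcomp, lcomp_eq_vcomp]
  simp only [Morphism.map_vcomp, S.F.map_id]
  rw [← vcomp_assoc, ← vcomp_assoc, eps_inverseEps, vcomp_inverseMap, vcomp_assoc,
    vcomp_counitApp]

/-- The natural morphism `g (F y) ⟶ y`, as a monoidal 2-morphism. -/
def inverseCounit : TwoHom (S.comp (S.inverse hF e)) (Hom.id B) where
  theta :=
    { app := fun y => S.counitApp hF e y
      naturality := S.counit_natural hF e }
  tensor_compat := S.counit_tensor_compat hF e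
  unit_compat := S.counit_unit_compat hF e

end Hom

end SmoothMonoid

/-- A fully faithful 1-morphism of smooth 2-groups that is essentially surjective on fibres is an
equivalence. -/
theorem SmoothTwoGroup.nonempty_equivalence {A : SmoothTwoGroup.{u, v}}
    {B : SmoothTwoGroup.{u₁, v₁}} (S : SmoothMonoid.Hom B.toSmoothMonoid A.toSmoothMonoid)
    (hF : S.F.FullyFaithful)
    (hes : ∀ ⦃c : Cart⦄ (z : A.X.Obj c), ∃ x : B.X.Obj c, Nonempty (A.X.Hom (𝟙 c) z (S.F.obj x))) :
    Nonempty (SmoothTwoGroup.Equivalence A B) := by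
  choose g e using hes
  exact ⟨S.inverse hF (fun c z => (e z).some), S, S.inverseUnit hF _, S.inverseCounit hF _⟩

/-! ### Automorphisms of the trivial line bundle -/

theorem Circle.contMDiff_coe : ContMDiff (𝓡 1) 𝓘(ℝ, ℂ) ∞ fun z : Circle => (z : ℂ) :=
  have := Fact.mk Complex.finrank_real_complex
  contMDiff_coe_sphere (E := ℂ) (n := 1)

theorem Circle.contMDiff_of_coe {E : Type*} [NormedAddCommGroup E] [NormedSpace ℝ E] {H : Type*}
    [TopologicalSpace H] {I : ModelWithCorners ℝ E H} {X : Type*} [TopologicalSpace X]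
    [ChartedSpace H X] [IsManifold I ∞ X] {f : X → Circle}
    (hf : ContMDiff I 𝓘(ℝ, ℂ) ∞ fun x => (f x : ℂ)) : ContMDiff I (𝓡 1) ∞ f :=
  have := Fact.mk Complex.finrank_real_complex
  hf.codRestrict_sphere (E := ℂ) (n := 1) fun x => (f x).2

namespace HermitianLineBundle

section CircleIso

variable {E : Type u₁} [NormedAddCommGroup E] [NormedSpace ℝ E] {H : Type u₂} [TopologicalSpace H]
  {I : ModelWithCorners ℝ E H} {X : Type u} [TopologicalSpace X] [ChartedSpace H X]

/-- The multiplication by an element of the circle, as an isometry of the complex line. -/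
def circleIsometry (z : Circle) : ℂ ≃ₗᵢ[ℂ] ℂ where
  toLinearEquiv := LinearEquiv.smulOfNeZero ℂ ℂ (z : ℂ) z.coe_ne_zero
  norm_map' v := by
    change ‖(z : ℂ) • v‖ = ‖v‖
    rw [norm_smul, Circle.norm_coe, one_mul]

/-- The automorphism of the trivial line bundle given by a smooth function to the circle. -/
def circleIso (h : C^∞⟮I, X; 𝓡 1, Circle⟯) : Iso (trivial I X) (trivial I X) where
  toEquiv x := circleIsometry (h x)
  smooth _ _ := ⟨fun x => (h x : ℂ),
    (Circle.contMDiff_coe.comp h.contMDiff).contMDiffOn, fun _ _ => rfl⟩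

/-- The action of an automorphism of the trivial line bundle on the fibre `ℂ` over `x`. -/
def trivialMap (φ : Iso (trivial I X) (trivial I X)) (x : X) (v : ℂ) : ℂ := φ.toEquiv x v

/-- Every automorphism of the trivial line bundle is the multiplication by a smooth function to the
circle. -/
theorem exists_eq_circleIso [IsManifold I ∞ X] (φ : Iso (trivial I X) (trivial I X)) :
    ∃ h : C^∞⟮I, X; 𝓡 1, Circle⟯, circleIso h = φ := by
  have hφ : ∀ x, trivialMap φ x 1 ∈ Metric.sphere (0 : ℂ) 1 := fun x =>
    mem_sphere_zero_iff_norm.2 (((φ.toEquiv x).norm_map (1 : ℂ)).trans (norm_one (α := ℂ)))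
  have hs : ContMDiff I 𝓘(ℝ, ℂ) ∞ fun x => trivialMap φ x 1 := by
    obtain ⟨g, hg, hgf⟩ := φ.smooth () ()
    refine contMDiffOn_univ.1 (hg.congr_mono (fun x _ => ?_) fun x _ =>
      ⟨_root_.trivial, _root_.trivial⟩)
    exact (hgf x ⟨_root_.trivial, _root_.trivial⟩).trans (mul_one (g x))
  refine ⟨⟨fun x => ⟨_, hφ x⟩, Circle.contMDiff_of_coe hs⟩, Iso.ext fun x (v : ℂ) => ?_⟩
  have h1 : trivialMap φ x (v • (1 : ℂ)) = v • trivialMap φ x 1 := (φ.toEquiv x).map_smul v (1 : ℂ)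
  change trivialMap φ x 1 * v = trivialMap φ x v
  rw [mul_comm, ← smul_eq_mul, ← h1, smul_eq_mul, mul_one]

end CircleIso

end HermitianLineBundle

/-! ### From the delooping of `U(1)^M` to line bundles -/

section DeloopingToLineBundles

open HermitianLineBundle
open scoped TensorProduct

variable {d : ℕ} {M : Type u} [TopologicalSpace M] [ChartedSpace (EuclideanSpace ℝ (Fin d)) M]
  {c c' : Cart}

/-- A smooth map from a Cartesian space `c` to `U(1)^M` is a smooth map `c × M → U(1)`. -/
def Cart.uncurry (h : c.smoothMaps (CircleMaps d M)) :
    C^∞⟮(𝓡 c.dim).prod (𝓡 d), c.carrier × M; 𝓡 1, Circle⟯ where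
  val q := h.1 q.1 q.2
  property := by
    obtain ⟨e⟩ := c.diffeo
    have h1 : ContMDiff ((𝓡 c.dim).prod (𝓡 d)) (𝓡 1) ∞
        fun q : EuclideanSpace ℝ (Fin c.dim) × M => h.1 (e.symm q.1) q.2 :=
      h.2 c.dim e.symm e.symm.contMDiff
    have h2 : ContMDiff ((𝓡 c.dim).prod (𝓡 d)) ((𝓡 c.dim).prod (𝓡 d)) ∞
        fun q : c.carrier × M => (e q.1, q.2) :=
      (e.contMDiff.comp contMDiff_fst).prodMk contMDiff_snd
    refine (h1.comp h2).congr fun q => ?_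
    simp only [Function.comp, e.symm_apply_apply]

theorem Cart.exists_uncurry_eq
    (k : C^∞⟮(𝓡 c.dim).prod (𝓡 d), c.carrier × M; 𝓡 1, Circle⟯) :
    ∃ h : c.smoothMaps (CircleMaps d M), Cart.uncurry h = k :=
  ⟨⟨fun t => ⟨fun x => k (t, x), k.contMDiff.comp (contMDiff_const.prodMk contMDiff_id)⟩,
    fun _ _ hp => k.contMDiff.comp ((hp.comp contMDiff_fst).prodMk contMDiff_snd)⟩, rfl⟩

variable (d M)

/-- The 1-morphism that sends a Cartesian space `c` to the trivial line bundle on `c × M`, and a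
smooth map `h : c → U(1)^M` to the multiplication by `h`. -/
def deloopingToHlbdl : Morphism (delooping (CircleMaps d M)) (hlbdl d M) where
  obj {c} _ := trivial ((𝓡 c.dim).prod (𝓡 d)) (c.carrier × M)
  map {_ _ _ _ _} h := circleIso (Cart.uncurry h)
  map_id {c} _ := Iso.ext fun x (v : ℂ) => one_mul v
  map_comp {_ _ _ f _ _ _ _} h h' := Iso.ext fun x (v : ℂ) => by
    change ((h.1 x.1 x.2 * h'.1 (Cart.map f x.1) x.2 : Circle) : ℂ) * v =
      (h'.1 (Cart.map f x.1) x.2 : ℂ) * ((h.1 x.1 x.2 : ℂ) * v)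
    rw [Circle.coe_mul]
    ring

theorem deloopingToHlbdl_fullyFaithful [IsManifold (𝓡 d) ∞ M] :
    (deloopingToHlbdl d M).FullyFaithful := by
  intro c c' f x y ψ
  obtain ⟨k, hk⟩ := exists_eq_circleIso (I := (𝓡 c.dim).prod (𝓡 d)) (X := c.carrier × M) ψ
  obtain ⟨h, rfl⟩ := Cart.exists_uncurry_eq k
  refine ⟨h, hk, fun h' hh' => ?_⟩
  refine Subtype.ext (funext fun t => ContMDiffMap.ext fun m => Circle.ext ?_)
  have h1 : circleIso (Cart.uncurry h') = circleIso (Cart.uncurry h) :=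
    (show circleIso (Cart.uncurry h') = ψ from hh').trans hk.symm
  have h2 : (h'.1 t m : ℂ) * 1 = (h.1 t m : ℂ) * 1 :=
    congrArg (fun χ => trivialMap χ (t, m) 1) h1
  rwa [mul_one, mul_one] at h2

/-- The monoidal structure on `deloopingToHlbdl`. -/
def deloopingHomData : SmoothMonoid.HomData
    (deloopingTwoGroup (CircleMaps d M)).toSmoothMonoid (hlbdlMonoid d M) where
  F := deloopingToHlbdl d M
  tensorIso :=
    { app := fun {c} _ =>
        (tensorLeftUnit (trivial ((𝓡 c.dim).prod (𝓡 d)) (c.carrier × M))).vertical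
      naturality := by
        rintro c c' f x y ⟨h, h'⟩
        refine Iso.ext_tensor fun x (v : ℂ) (w : ℂ) => ?_
        change ((h.1 x.1 x.2 : ℂ) * v) * ((h'.1 x.1 x.2 : ℂ) * w) =
          ((h.1 x.1 x.2 * h'.1 x.1 x.2 : Circle) : ℂ) * (v * w)
        rw [Circle.coe_mul]
        ring }
  unitIso :=
    { app := fun {c} _ =>
        (Iso.refl (trivial ((𝓡 c.dim).prod (𝓡 d)) (c.carrier × M))).vertical
      naturality := fun _ => Iso.ext fun x (v : ℂ) => (one_mul v).symm }

/-- The monoidal 1-morphism from the delooping of `U(1)^M` to the hermitean line bundles on `M`. -/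
def deloopingHom : SmoothMonoid.Hom
    (deloopingTwoGroup (CircleMaps d M)).toSmoothMonoid (hlbdlMonoid d M) where
  toHomData := deloopingHomData d M
  associativity {c} _ _ _ := by
    refine Iso.ext_tensor₃ (L := trivial ((𝓡 c.dim).prod (𝓡 d)) (c.carrier × M))
      (K := trivial _ _) (N := trivial _ _) (P := trivial _ _) fun x (a : ℂ) (b : ℂ) (e : ℂ) => ?_
    change ((1 : Circle) : ℂ) * ((a * b) * e) = a * (b * e)
    rw [Circle.coe_one, one_mul, mul_assoc]
  left_unitality {c} _ := by
    refine Iso.ext_tensor (L := trivial ((𝓡 c.dim).prod (𝓡 d)) (c.carrier × M))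
      (K := trivial _ _) (N := trivial _ _) fun x (a : ℂ) (b : ℂ) => ?_
    change ((1 : Circle) : ℂ) * (a * b) = a * b
    rw [Circle.coe_one, one_mul]
  right_unitality {c} _ := by
    refine Iso.ext_tensor (L := trivial ((𝓡 c.dim).prod (𝓡 d)) (c.carrier × M))
      (K := trivial _ _) (N := trivial _ _) fun x (a : ℂ) (b : ℂ) => ?_
    change ((1 : Circle) : ℂ) * (a * b) = b * a
    rw [Circle.coe_one, one_mul, mul_comm]

theorem nonempty_equivalence_delooping [T2Space M] [SecondCountableTopology M]
    [IsManifold (𝓡 d) ∞ M] (hM : IsTwoConnected M) :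
    Nonempty (SmoothTwoGroup.Equivalence (hlbdlTwoGroup d M).toSmoothTwoGroup
      (deloopingTwoGroup (CircleMaps d M)).toSmoothTwoGroup) :=
  SmoothTwoGroup.nonempty_equivalence (deloopingHom d M) (deloopingToHlbdl_fullyFaithful d M)
    fun c L => by
      obtain ⟨φ⟩ := nonempty_iso_trivial_of_isTwoConnected hM c L
      exact ⟨(), ⟨φ.symm.vertical⟩⟩

end DeloopingToLineBundles

/-! ### Coverings and higher homotopy groups -/

section Covering

open unitInterval

/-- In a cube of dimension at least two, a covering map that is constant on the boundary has only
constant lifts on the boundary. -/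
theorem IsCoveringMap.const_on_boundary {E B : Type*} [TopologicalSpace E] [TopologicalSpace B]
    {p : E → B} (cov : IsCoveringMap p) {N : Type*} [Nontrivial N] {F : (N → I) → E}
    (hF : Continuous F) {b : B} (hb : ∀ y ∈ Cube.boundary N, p (F y) = b) {y : N → I}
    (hy : y ∈ Cube.boundary N) : F y = F 0 := by
  classical
  have key : ∀ P : I → N → I, Continuous P → (∀ t, P t ∈ Cube.boundary N) → F (P 0) = F (P 1) :=
    fun P hP hPb => cov.const_of_comp (hF.comp hP)
      (fun s t => (hb _ (hPb s)).trans (hb _ (hPb t)).symm) 0 1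
  obtain ⟨i, hi⟩ := hy
  obtain ⟨j, hj⟩ := exists_ne i
  -- First the coordinates other than `i` are moved to `0`, then the coordinate `i`.
  have h1 := key (fun t k => if k = i then y i else σ t * y k)
    (continuous_pi fun k => by split_ifs <;> fun_prop) fun t => ⟨i, by simpa using hi⟩
  have h2 := key (fun t k => if k = i then σ t * y i else 0)
    (continuous_pi fun k => by split_ifs <;> fun_prop) fun t => ⟨j, by simp [hj]⟩
  have e1 : (fun k => if k = i then y i else σ 0 * y k) = y := by
    funext k
    split_ifs with h <;> simp [h]
  have e2 : (fun k => if k = i then y i else σ 1 * y k) =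
      fun k => if k = i then σ 0 * y i else 0 := by
    funext k
    split_ifs <;> simp
  have e3 : (fun k => if k = i then σ 1 * y i else 0) = (0 : N → I) := by
    funext k
    split_ifs <;> simp
  rw [e1, e2] at h1
  rw [e3] at h2
  exact h1.trans h2

/-- Higher homotopy groups vanish downstairs if they vanish upstairs. -/
theorem IsCoveringMap.subsingleton_homotopyGroup {E B : Type*} [TopologicalSpace E]
    [TopologicalSpace B] {p : E → B} (cov : IsCoveringMap p) {N : Type*} [Nontrivial N] {e₀ : E}
    (h : Subsingleton (HomotopyGroup N E e₀)) : Subsingleton (HomotopyGroup N B (p e₀)) := by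
  rw [subsingleton_homotopyGroup_iff] at h ⊢
  intro f
  obtain ⟨i⟩ : Nonempty N := inferInstance
  have h0 : (0 : N → I) ∈ Cube.boundary N := ⟨i, Or.inl rfl⟩
  have hf : ∀ y ∈ Cube.boundary N, f.1 y = p e₀ := f.2
  -- The lift is obtained from the homotopy lifting property, as the cube contracts to the origin.
  let H : C(I × (N → I), B) := ⟨fun q => f.1 fun k => q.1 * q.2 k, by fun_prop⟩
  have H0 : ∀ y, H (0, y) = p ((ContinuousMap.const (N → I) e₀) y) := fun y => by
    have : (fun k => 0 * y k) = (0 : N → I) := by funext k; simp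
    change f.1 (fun k => 0 * y k) = p e₀
    rw [this, hf 0 h0]
  let K := cov.liftHomotopy H (.const _ e₀) H0
  have hK : ∀ q, p (K q) = H q := fun q => congrFun (cov.liftHomotopy_lifts H _ H0) q
  have hK0 : ∀ y, K (0, y) = e₀ := fun y => cov.liftHomotopy_zero H _ H0 y
  let F : C(N → I, E) := ⟨fun y => K (1, y), by fun_prop⟩
  have hpF : ∀ y, p (F y) = f.1 y := fun y => (hK (1, y)).trans <| by
    change f.1 (fun k => 1 * y k) = f.1 y
    simp
  have hF0 : F 0 = e₀ := by
    have h1 := cov.const_of_comp (g := fun t : I => K (t, 0)) (by fun_prop) (fun s t => by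
      rw [hK, hK]
      change f.1 (fun k => s * 0) = f.1 (fun k => t * 0)
      simp) 1 0
    exact h1.trans (hK0 0)
  have hFb : ∀ y ∈ Cube.boundary N, F y = e₀ := fun y hy =>
    (cov.const_on_boundary F.continuous (fun y hy => (hpF y).trans (hf y hy)) hy).trans hF0
  have h2 := (h ⟨F, hFb⟩).comp_continuousMap ⟨p, cov.continuous⟩
  have e1 : (⟨p, cov.continuous⟩ : C(E, B)).comp F = f.1 := ContinuousMap.ext hpF
  rw [e1] at h2
  exact h2

end Covering

/-! ### Logarithms of smooth functions to the circle -/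

/-- A continuous logarithm of a smooth function to the circle is smooth. -/
theorem contMDiff_of_contMDiff_circleExp {E : Type*} [NormedAddCommGroup E] [NormedSpace ℝ E]
    {H : Type*} [TopologicalSpace H] {J : ModelWithCorners ℝ E H} {X : Type*} [TopologicalSpace X]
    [ChartedSpace H X] {θ : X → ℝ} (hθ : Continuous θ)
    (h : ContMDiff J (𝓡 1) ∞ fun x => Circle.exp (θ x)) : ContMDiff J 𝓘(ℝ, ℝ) ∞ θ := by
  intro x
  -- Near `x`, the function is recovered from its exponential by the principal branch of the
  -- logarithm, centred at the value at `x`.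
  let g : ℂ → ℝ := fun z => (Complex.log (z * Circle.exp (-θ x))).im + θ x
  have hval : (Circle.exp (θ x) : ℂ) * Circle.exp (-θ x) = 1 := by
    rw [← Circle.coe_mul, ← Circle.exp_add, add_neg_cancel, Circle.exp_zero, Circle.coe_one]
  have hg : ContDiffAt ℝ ∞ g (Circle.exp (θ x)) := by
    have h1 : ContDiffAt ℝ ∞ Complex.log ((Circle.exp (θ x) : ℂ) * Circle.exp (-θ x)) := by
      rw [hval]
      exact (Complex.contDiffAt_log Complex.one_mem_slitPlane).restrict_scalars ℝ
    have h2 : ContDiffAt ℝ ∞ (fun z : ℂ => Complex.log (z * Circle.exp (-θ x)))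
        (Circle.exp (θ x)) :=
      ContDiffAt.comp (g := Complex.log) (f := fun z : ℂ => z * Circle.exp (-θ x)) _ h1
        (contDiffAt_id.mul contDiffAt_const)
    exact (ContDiffAt.comp (g := Complex.imCLM) _ Complex.imCLM.contDiff.contDiffAt h2).add
      contDiffAt_const
  have hs : ContMDiffAt J 𝓘(ℝ, ℂ) ∞ (fun y => (Circle.exp (θ y) : ℂ)) x :=
    (Circle.contMDiff_coe.comp h) x
  refine (hg.contMDiffAt.comp x hs).congr_of_eventuallyEq ?_
  have hnear : ∀ᶠ y in 𝓝 x, θ y - θ x ∈ Set.Ioo (-Real.pi) Real.pi := by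
    refine (hθ.sub continuous_const).continuousAt.eventually_mem (isOpen_Ioo.mem_nhds ?_)
    simp [Real.pi_pos]
  filter_upwards [hnear] with y hy
  have h1 : (Circle.exp (θ y) : ℂ) * Circle.exp (-θ x) =
      Complex.exp ((θ y - θ x : ℝ) * Complex.I) := by
    rw [← Circle.coe_mul, ← Circle.exp_add, Circle.coe_exp, sub_eq_add_neg]
  simp only [Function.comp, g]
  rw [h1, Complex.log_exp] <;> simp [hy.1, hy.2.le]

/-! ### The space of smooth real functions -/

section RealMaps

open unitInterval

variable (d : ℕ) (M : Type u) [TopologicalSpace M] [ChartedSpace (EuclideanSpace ℝ (Fin d)) M]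

/-- The vector space of smooth real functions on `M`. -/
abbrev RealMaps : Type u := C^∞⟮𝓡 d, M; 𝓘(ℝ, ℝ), ℝ⟯

variable {d M}

/-- A family of smooth functions on `M` parametrized by a normed space is smooth if it is jointly
smooth. -/
def RealMaps.IsSmoothFamily {V : Type*} [NormedAddCommGroup V] [NormedSpace ℝ V]
    (p : V → RealMaps d M) : Prop :=
  ContMDiff (𝓘(ℝ, V).prod (𝓡 d)) 𝓘(ℝ, ℝ) ∞ fun q : V × M => p q.1 q.2

/-- The D-topology of the mapping space diffeology: a set is open if its preimages under all smooth
families parametrized by `ℝⁿ` are. -/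
instance : TopologicalSpace (RealMaps d M) where
  IsOpen U := ∀ (n : ℕ) (p : EuclideanSpace ℝ (Fin n) → RealMaps d M),
    RealMaps.IsSmoothFamily p → IsOpen (p ⁻¹' U)
  isOpen_univ _ _ _ := isOpen_univ
  isOpen_inter _ _ hU hV n p hp := (hU n p hp).inter (hV n p hp)
  isOpen_sUnion S hS n p hp := by
    rw [Set.sUnion_eq_biUnion, Set.preimage_iUnion₂]
    exact isOpen_biUnion fun U hU => hS U hU n p hp

namespace RealMaps

theorem IsSmoothFamily.continuous {V : Type*} [NormedAddCommGroup V] [NormedSpace ℝ V]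
    [FiniteDimensional ℝ V] {p : V → RealMaps d M} (hp : IsSmoothFamily p) : Continuous p := by
  have h1 : IsSmoothFamily (p ∘ (toEuclidean (E := V)).symm) := by
    have : ContMDiff ((𝓡 (Module.finrank ℝ V)).prod (𝓡 d)) (𝓘(ℝ, V).prod (𝓡 d)) ∞
        fun q : EuclideanSpace ℝ (Fin (Module.finrank ℝ V)) × M =>
          ((toEuclidean (E := V)).symm q.1, q.2) :=
      ((toEuclidean (E := V)).symm.contDiff.contMDiff.comp contMDiff_fst).prodMk contMDiff_snd
    exact ContMDiff.comp hp this
  have h2 : Continuous (p ∘ (toEuclidean (E := V)).symm) :=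
    continuous_def.2 fun U hU => hU _ _ h1
  have h3 : p = (p ∘ (toEuclidean (E := V)).symm) ∘ toEuclidean := by
    funext v
    simp
  rw [h3]
  exact h2.comp (toEuclidean (E := V)).continuous

theorem continuous_of_families {Y : Type*} [TopologicalSpace Y] {f : RealMaps d M → Y}
    (h : ∀ (n : ℕ) (p : EuclideanSpace ℝ (Fin n) → RealMaps d M), IsSmoothFamily p →
      Continuous fun t => f (p t)) : Continuous f :=
  continuous_def.2 fun _ hU n p hp => hU.preimage (h n p hp)

theorem continuous_add_const (e : RealMaps d M) : Continuous fun x : RealMaps d M => x + e :=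
  continuous_of_families fun _ _ hp => IsSmoothFamily.continuous
    (ContMDiff.add hp (e.contMDiff.comp contMDiff_snd))

theorem continuous_eval (m : M) : Continuous fun x : RealMaps d M => x m :=
  continuous_of_families fun _ _ hp =>
    (ContMDiff.continuous hp).comp (continuous_id.prodMk continuous_const)

/-- The straight-line contraction onto a point is continuous.  As the D-topology of a product need
not be the product topology, this uses the exponential law for the unit interval. -/
theorem continuous_contraction (e : RealMaps d M) :
    Continuous fun q : I × RealMaps d M => (1 - (q.1 : ℝ)) • q.2 + (q.1 : ℝ) • e := by
  have key : ∀ {V : Type} [NormedAddCommGroup V] [NormedSpace ℝ V] [FiniteDimensional ℝ V]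
      (p : V → RealMaps d M), IsSmoothFamily p →
      Continuous fun q : V × I => (1 - (q.2 : ℝ)) • p q.1 + (q.2 : ℝ) • e := by
    intro V _ _ _ p hp
    have h1 : IsSmoothFamily fun r : V × ℝ => (1 - r.2) • p r.1 + r.2 • e := by
      have hr : ContMDiff (𝓘(ℝ, V × ℝ).prod (𝓡 d)) 𝓘(ℝ, ℝ) ∞ fun q : (V × ℝ) × M => q.1.2 :=
        contDiff_snd.contMDiff.comp contMDiff_fst
      have hv : ContMDiff (𝓘(ℝ, V × ℝ).prod (𝓡 d)) (𝓘(ℝ, V).prod (𝓡 d)) ∞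
          fun q : (V × ℝ) × M => (q.1.1, q.2) :=
        (contDiff_fst.contMDiff.comp contMDiff_fst).prodMk contMDiff_snd
      exact ((contMDiff_const.sub hr).mul (ContMDiff.comp hp hv)).add
        (hr.mul (e.contMDiff.comp contMDiff_snd))
    exact h1.continuous.comp
      (continuous_fst.prodMk (continuous_subtype_val.comp continuous_snd))
  have hc : ∀ x : RealMaps d M, Continuous fun t : I => (1 - (t : ℝ)) • x + (t : ℝ) • e := fun x =>
    (key (fun _ : ℝ => x) (x.contMDiff.comp contMDiff_snd)).comp
      (continuous_const (y := (0 : ℝ)).prodMk continuous_id)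
  have h2 : Continuous fun x : RealMaps d M => (⟨_, hc x⟩ : C(I, RealMaps d M)) :=
    continuous_of_families fun _ p hp =>
      ContinuousMap.continuous_of_continuous_uncurry _ (key p hp)
  exact (ContinuousMap.continuous_uncurry_of_continuous ⟨_, h2⟩).comp continuous_swap

instance : ContractibleSpace (RealMaps d M) :=
  (contractible_iff_id_nullhomotopic _).2 ⟨0, ⟨
    { toFun := fun q => (1 - (q.1 : ℝ)) • q.2 + (q.1 : ℝ) • (0 : RealMaps d M)
      continuous_toFun := continuous_contraction 0
      map_zero_left := fun x => by simp
      map_one_left := fun x => by simp }⟩⟩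

theorem subsingleton_homotopyGroup (N : Type*) (e : RealMaps d M) :
    Subsingleton (HomotopyGroup N (RealMaps d M) e) :=
  subsingleton_homotopyGroup_of_contraction (continuous_contraction e) (fun x => by simp)
    (fun x => by simp) fun t => by rw [← add_smul, sub_add_cancel, one_smul]

end RealMaps

end RealMaps

/-! ### The universal covering of `U(1)^M` -/

section CircleMaps

open RealMaps

variable {d : ℕ} {M : Type u} [TopologicalSpace M] [ChartedSpace (EuclideanSpace ℝ (Fin d)) M]

/-- The D-topology of `U(1)^M`. -/
instance : TopologicalSpace (CircleMaps d M) := DiffeologicalSpace.dTopology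

namespace RealMaps

/-- The exponential map from the smooth real functions to `U(1)^M`. -/
def exp (e : RealMaps d M) : CircleMaps d M :=
  ⟨fun m => Circle.exp (e m), contMDiff_circleExp.comp e.contMDiff⟩

theorem exp_apply (e : RealMaps d M) (m : M) : exp e m = Circle.exp (e m) := rfl

theorem continuous_exp : Continuous (exp (d := d) (M := M)) :=
  continuous_of_families fun _ _ hp =>
    Diffeology.IsPlot.continuous (contMDiff_circleExp.comp hp)

/-- Plots of `U(1)^M` lift to smooth families of real functions. -/
theorem exists_exp_family_eq [SimplyConnectedSpace M] {n : ℕ}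
    {p : EuclideanSpace ℝ (Fin n) → CircleMaps d M} (hp : Diffeology.IsPlot p) :
    ∃ q : EuclideanSpace ℝ (Fin n) → RealMaps d M, IsSmoothFamily q ∧ ∀ t, exp (q t) = p t := by
  have hP : ContMDiff ((𝓡 n).prod (𝓡 d)) (𝓡 1) ∞
    fun q : EuclideanSpace ℝ (Fin n) × M => p q.1 q.2 := hp
  have : LocallyPathConnectedSpace M :=
    ChartedSpace.locallyPathConnectedSpace (EuclideanSpace ℝ (Fin d)) M
  obtain ⟨m₀⟩ : Nonempty M := inferInstance
  obtain ⟨s, hs⟩ := Circle.exp_surjective (p 0 m₀)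
  obtain ⟨F, ⟨-, hF⟩, -⟩ := Circle.isCoveringMap_exp.existsUnique_continuousMap_lifts
    (⟨_, hP.continuous⟩ : C(EuclideanSpace ℝ (Fin n) × M, Circle)) (0, m₀) s hs
  have hFe : ∀ q, Circle.exp (F q) = p q.1 q.2 := congrFun hF
  have hFs : ContMDiff ((𝓡 n).prod (𝓡 d)) 𝓘(ℝ, ℝ) ∞ F :=
    contMDiff_of_contMDiff_circleExp F.continuous (hP.congr hFe)
  exact ⟨fun t => ⟨fun m => F (t, m), hFs.comp (contMDiff_const.prodMk contMDiff_id)⟩, hFs,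
    fun t => ContMDiffMap.ext fun m => hFe (t, m)⟩

theorem exp_surjective [SimplyConnectedSpace M] :
    Function.Surjective (exp (d := d) (M := M)) := fun x => by
  obtain ⟨q, -, hq⟩ := exists_exp_family_eq (n := 0) (Diffeology.isPlot_const (x := x))
  exact ⟨q 0, hq 0⟩

theorem isQuotientMap_exp [SimplyConnectedSpace M] :
    Topology.IsQuotientMap (exp (d := d) (M := M)) := by
  refine (Topology.isQuotientMap_iff _).2 ⟨Topology.isCoinducing_iff.2 fun U =>
    ⟨fun hU => ?_, fun hU => hU.preimage continuous_exp⟩, exp_surjective⟩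
  refine Diffeology.isOpen_iff_preimages_plots.2 fun n p hp => ?_
  obtain ⟨q, hq, hqp⟩ := exists_exp_family_eq hp
  have h1 : IsOpen (q ⁻¹' (exp ⁻¹' U)) := hU.preimage hq.continuous
  have h2 : q ⁻¹' (exp ⁻¹' U) = p ⁻¹' U := Set.ext fun t => by
    simp only [Set.mem_preimage, hqp]
  rwa [h2] at h1

theorem exp_eq_exp_iff [PreconnectedSpace M] [Nonempty M] {e₁ e₂ : RealMaps d M} :
    exp e₁ = exp e₂ ↔ ∃ k : ℤ, ∀ m, e₁ m = e₂ m + k * (2 * Real.pi) := by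
  constructor
  · intro h
    have h1 : ∀ m, Circle.exp (e₁ m - e₂ m) = 1 := fun m => by
      rw [Circle.exp_sub, div_eq_one]
      exact DFunLike.congr_fun h m
    obtain ⟨m₀⟩ := ‹Nonempty M›
    obtain ⟨k, hk⟩ := Circle.exp_eq_one.1 (h1 m₀)
    refine ⟨k, fun m => ?_⟩
    have h2 := Circle.isCoveringMap_exp.const_of_comp (g := fun m => e₁ m - e₂ m)
      (e₁.contMDiff.continuous.sub e₂.contMDiff.continuous)
      (fun m m' => (h1 m).trans (h1 m').symm) m m₀
    linarith
  · rintro ⟨k, hk⟩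
    refine ContMDiffMap.ext fun m => ?_
    rw [exp_apply, exp_apply, hk, Circle.exp_add, Circle.exp_int_mul_two_pi, mul_one]

/-- The action of `ℤ` on the smooth real functions by the translations by multiples of `2π`. -/
instance : AddAction ℤ (RealMaps d M) where
  vadd k e := e + ContMDiffMap.const (k * (2 * Real.pi))
  zero_vadd e := ContMDiffMap.ext fun m => by
    change e m + ((0 : ℤ) : ℝ) * (2 * Real.pi) = e m
    simp
  add_vadd k l e := ContMDiffMap.ext fun m => by
    change e m + ((k + l : ℤ) : ℝ) * (2 * Real.pi) = e m + l * (2 * Real.pi) + k * (2 * Real.pi)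
    push_cast
    ring

/-- On a simply connected manifold, the exponential map is the quotient by the free action of
`ℤ`. -/
theorem isAddQuotientCoveringMap_exp [SimplyConnectedSpace M] :
    IsAddQuotientCoveringMap (exp (d := d) (M := M)) ℤ where
  toIsQuotientMap := isQuotientMap_exp
  continuous_const_vadd k := continuous_add_const _
  apply_eq_iff_mem_orbit {e₁ e₂} := by
    rw [exp_eq_exp_iff]
    exact exists_congr fun k => ⟨fun h => ContMDiffMap.ext fun m => (h m).symm,
      fun h m => (DFunLike.congr_fun h m).symm⟩
  disjoint e := by
    obtain ⟨m₀⟩ : Nonempty M := inferInstance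
    refine ⟨(fun x : RealMaps d M => x m₀) ⁻¹' Metric.ball (e m₀) Real.pi,
      (continuous_eval m₀).continuousAt.preimage_mem_nhds (Metric.ball_mem_nhds _ Real.pi_pos), ?_⟩
    rintro k ⟨_, ⟨x, hx, rfl⟩, hkx⟩
    have h1 : |x m₀ - e m₀| < Real.pi := hx
    have h2 : |x m₀ + k * (2 * Real.pi) - e m₀| < Real.pi := hkx
    have h3 : |(k : ℝ)| * (2 * Real.pi) < 1 * (2 * Real.pi) := by
      rw [← abs_of_pos Real.two_pi_pos, ← abs_mul, abs_of_pos Real.two_pi_pos]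
      rw [abs_lt] at h1 h2 ⊢
      constructor <;> linarith [h1.1, h1.2, h2.1, h2.2]
    have h4 : |k| < 1 := by exact_mod_cast lt_of_mul_lt_mul_right h3 Real.two_pi_pos.le
    exact Int.abs_lt_one_iff.1 h4

end RealMaps

theorem isDiffeologicalKZOne_circleMaps [SimplyConnectedSpace M] :
    IsDiffeologicalKZOne (CircleMaps d M) := by
  have hcov := isAddQuotientCoveringMap_exp (d := d) (M := M)
  refine ⟨exp_surjective.pathConnectedSpace continuous_exp, fun x => ?_⟩
  obtain ⟨e, rfl⟩ := exp_surjective x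
  refine ⟨⟨HomotopyGroup.pi1MulEquivFundamentalGroup.trans
    ((hcov.fundamentalGroupEquiv ⟨e, rfl⟩).trans MulOpposite.opMulEquiv.symm)⟩, fun n hn => ?_⟩
  have : Nontrivial (Fin n) := Fin.nontrivial_iff_two_le.2 hn
  exact hcov.isCoveringMap.subsingleton_homotopyGroup (subsingleton_homotopyGroup _ e)

end CircleMaps

theorem mainTheorem6 {d : ℕ} (M : Type u) [TopologicalSpace M] [T2Space M]
    [SecondCountableTopology M] [ChartedSpace (EuclideanSpace ℝ (Fin d)) M]
    [IsManifold (𝓡 d) ∞ M] (hM : IsTwoConnected M) :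
    IsStringAdmissible (hlbdlTwoGroup d M).toSmoothTwoGroup ∧
      IsDiffeologicalKZOne (CircleMaps d M) ∧
      Nonempty (SmoothTwoGroup.Equivalence (hlbdlTwoGroup d M).toSmoothTwoGroup
        (deloopingTwoGroup (CircleMaps d M)).toSmoothTwoGroup) := by
  have := hM.1
  have h1 : IsDiffeologicalKZOne (CircleMaps d M) := isDiffeologicalKZOne_circleMaps
  have h2 := nonempty_equivalence_delooping d M hM
  exact ⟨⟨⟨hlbdlSymmetry d M⟩, CircleMaps d M, inferInstance, inferInstance, inferInstance, h1, h2⟩,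
    h1, h2⟩

end
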